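/- **Setting.** Let $A$ be a Hopf algebra over $\mathbb C$ with bijective antipode $S$, and let $(\Gamma,\mathrm d)$ be an $N$-dimensional bicovariant first order differential calculus over $A$: $\Gamma$ is an $A$-bimodule, $\mathrm d:A\to\Gamma$ is linear, $\mathrm d(xy)=(\mathrm dx)y+x\,\mathrm dy$, $\Gamma=A\,\mathrm dA$, and there are a left coaction $\Delta_\Gamma:\Gamma\to A\otimes\Gamma$ and a right coaction ${}_\Gamma\Delta:\Gamma\to\Gamma\otimes A$ with $\Delta_\Gamma(x\,\mathrm dy)=\Delta(x)(\mathrm{id}\otimes\mathrm d)\Delta(y)$ and ${}_\Gamma\Delta(x\,\mathrm dy)=\Delta(x)(\mathrm d\otimes\mathrm{id})\Delta(y)$. Fix a free left $A$-module basis $\omega_1,\dots,\omega_N$ of $\Gamma$ consisting of left invariant forms. Sums over repeated indices are understood. Define functionals $X_i,f_{ij}$ on $A$ and elements $J_{ij}\in A$ by $$\mathrm dx=x_{(1)}X_i(x_{(2)})\,\omega_i,\qquad \omega_i x=x_{(1)}f_{ij}(x_{(2)})\,\omega_j,\qquad {}_\Gamma\Delta(\omega_j)=\omega_i\otimes J_{ij},$$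 and put $\sigma^{ij}_{kl}=f_{kj}(J_{il})$, $C_{ij}^k=X_j(J_{ik})$, $\eta_j=\omega_iS(J_{ij})$. Functionals on $A$ are multiplied by convolution, and $S^{\pm1}(h)=h\circ S^{\pm1}$ for a functional $h$. Let $\mathcal U_\Gamma$ be the algebra of functionals generated by all $X_i,f_{jk}$. The calculus is *$S$-compatible* if $S(f_{ij})\in\mathcal U_\Gamma$ for all $i,j$; assume this. Let $\sigma$ be the braiding of $\Gamma\otimes_A\Gamma$ (the bimodule map with $\sigma(\omega\otimes\eta)=\eta\otimes\omega$ for $\omega$ left invariant and $\eta$ right invariant), and let $\Gamma^\wedge=\Gamma^{\otimes}/\langle\ker(1-\sigma)\rangle$, where $\Gamma^\otimes$ is the tensor algebra of the $A$-bimodule $\Gamma$. Assume that $\mathrm d$ extends to a degree one graded derivation of $\Gamma^\wedge$ with $\mathrm d^2=0$, and write $\mathrm d$ for this (unique) extension. **The quantum Cartan algebra.** $\mathcal C_\Gamma$ is the $\mathbb Z_2$-graded algebra generated by the algebra $\mathcal U_\Gamma$ (even) and odd elements $\xi_1,\dots,\xi_N,\delta$, subject to $$\xi_i\delta+\delta\xi_i=X_i,\quad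 \delta^2=0,\quad \xi_if_{kj}=\sigma^{ij}_{nm}f_{kn}\xi_m,\quad \xi_iX_j-\sigma^{ij}_{kl}X_k\xi_l=C_{ij}^k\xi_k,\quad f_{ij}\delta=\delta f_{ij},\quad X_i\delta=\delta X_i,$$ and $c_{ij}\xi_i\xi_j=0$ for all scalars $c_{ij}$ with $c_{ij}\sigma^{ij}_{kl}=c_{kl}$ for all $k,l$. **Theorem.** (a) There are an algebra map $\Delta$ from $\mathcal C_\Gamma$ to the $\mathbb Z_2$-graded tensor product $\mathcal C_\Gamma\otimes\mathcal C_\Gamma$ and an algebra map $\varepsilon:\mathcal C_\Gamma\to\mathbb C$ with $$\Delta(X_i)=1\otimes X_i+X_j\otimes f_{ji},\quad \Delta(f_{ij})=f_{ik}\otimes f_{kj},\quad \Delta(\xi_i)=1\otimes\xi_i+\xi_j\otimes f_{ji},\quad \Delta(\delta)=1\otimes\delta+\delta\otimes1,$$ $\varepsilon(X_i)=\varepsilon(\xi_i)=\varepsilon(\delta)=0$, $\varepsilon(f_{ij})=\delta_{ij}$, and a bijective $\mathbb Z_2$-graded algebra anti-homomorphism $S$ of $\mathcal C_\Gamma$ with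 $f_{ij}\mapsto S(f_{ij})$, $X_i\mapsto-X_jS(f_{ji})$, $\xi_i\mapsto-\xi_jS(f_{ji})$, $\delta\mapsto-\delta$. (b) The coproduct of $A$ and the left coaction of $\Gamma$ extend to an algebra map $\Gamma^\wedge\to A\otimes\Gamma^\wedge$, $\alpha\mapsto\alpha_{(-1)}\otimes\alpha_{(0)}$; put $\alpha\triangleleft h=h(\alpha_{(-1)})\alpha_{(0)}$ for a functional $h$. There are linear maps $i_1,\dots,i_N$ of $\Gamma^\wedge$ of degree $-1$ (the right inner derivatives) with $i_j(\eta_i)=\delta_{ij}$ and $$i_j(\alpha\wedge\beta)=i_j(\alpha)\wedge\beta+(-1)^{|\alpha|}\,(\alpha\triangleleft S^{-1}(f_{kj}))\wedge i_k(\beta).$$ (c) For these maps, and with $R_j=-S^{-1}(X_j)$, there is exactly one $\mathbb Z_2$-graded algebra anti-homomorphism $\rho:\mathcal C_\Gamma\to\mathrm{End}(\Gamma^\wedge)$, $x\mapsto\rho_x$ (that is, $\rho_1=\mathrm{id}$ and $\rho_{xy}=(-1)^{|x||y|}\rho_y\rho_x$), such that for all $j,k$ $$\rho_{R_j}(\alpha)=\alpha\triangleleft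 R_j,\qquad \rho_{S^{-1}(f_{jk})}(\alpha)=\alpha\triangleleft S^{-1}(f_{jk}),\qquad \rho_{-S^{-1}(\xi_j)}=i_j,\qquad \rho_{S^{-1}(\delta)}=\mathrm d .$$ It makes $\Gamma^\wedge$ a right $\mathcal C_\Gamma$-module algebra: $\rho$ is compatible with the $\mathbb Z_2$-gradings, and for homogeneous $\alpha$ and all $\beta\in\Gamma^\wedge$, $x\in\mathcal C_\Gamma$, $$\rho_x(\alpha\wedge\beta)=(-1)^{|x_{(2)}||\alpha|}\rho_{x_{(1)}}(\alpha)\wedge\rho_{x_{(2)}}(\beta),\qquad \rho_x(1)=\varepsilon(x)1 .$$ -/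

import Mathlib

open scoped TensorProduct
open MulOpposite WithConv

noncomputable section

namespace QuantumCartan

/-! ### Hopf algebra generalities -/

section Dual

variable {A : Type*} [Ring A] [HopfAlgebra ℂ A]

/-- The inverse of a bijective antipode. -/
def antipodeInv (hS : Function.Bijective (HopfAlgebra.antipode ℂ : A →ₗ[ℂ] A)) : A →ₗ[ℂ] A :=
  (LinearEquiv.ofBijective (HopfAlgebra.antipode ℂ : A →ₗ[ℂ] A) hS).symm.toLinearMap

end Dual

/-! ### Bicovariant first order differential calculi -/

/-- The map `(a ⊗ b) ⊗ (c ⊗ ρ) ↦ a c ⊗ b ρ`. -/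
def smulTensor (A Γ : Type*) [Ring A] [Algebra ℂ A] [AddCommGroup Γ] [Module ℂ Γ] [Module A Γ]
    [IsScalarTower ℂ A Γ] : A ⊗[ℂ] A →ₗ[ℂ] A ⊗[ℂ] Γ →ₗ[ℂ] A ⊗[ℂ] Γ :=
  TensorProduct.map₂ (LinearMap.mul ℂ A) (Algebra.lsmul ℂ ℂ Γ).toLinearMap

/-- The map `(a ⊗ b) ⊗ (ρ ⊗ c) ↦ a ρ ⊗ b c`. -/
def smulTensor' (A Γ : Type*) [Ring A] [Algebra ℂ A] [AddCommGroup Γ] [Module ℂ Γ] [Module A Γ]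
    [IsScalarTower ℂ A Γ] : A ⊗[ℂ] A →ₗ[ℂ] Γ ⊗[ℂ] A →ₗ[ℂ] Γ ⊗[ℂ] A :=
  TensorProduct.map₂ (Algebra.lsmul ℂ ℂ Γ).toLinearMap (LinearMap.mul ℂ A)

/-- A bicovariant first order differential calculus `(Γ, d)` over the Hopf algebra `A`.  The right
multiplication of the bimodule `Γ` is the action of `Aᵐᵒᵖ`.  The left and right coactions
`Γ → A ⊗ Γ` and `Γ → Γ ⊗ A` are determined by `d` through `coactL_smul_d` and `coactR_smul_d`. -/
structure BicovariantCalculus (A : Type*) [Ring A] [HopfAlgebra ℂ A]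
    (Γ : Type*) [AddCommGroup Γ] [Module ℂ Γ] [Module A Γ] [Module Aᵐᵒᵖ Γ]
    [SMulCommClass A Aᵐᵒᵖ Γ] [IsScalarTower ℂ A Γ] [IsScalarTower ℂ Aᵐᵒᵖ Γ] where
  /-- the differential -/
  d : A →ₗ[ℂ] Γ
  leibniz : ∀ x y : A, d (x * y) = op y • d x + x • d y
  span_range_d : Submodule.span A (Set.range d) = ⊤
  /-- the left coaction -/
  coactL : Γ →ₗ[ℂ] A ⊗[ℂ] Γ
  coactL_counit : ∀ ρ,
    TensorProduct.lid ℂ Γ ((Coalgebra.counit (R := ℂ) (A := A)).rTensor Γ (coactL ρ)) = ρ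
  coactL_coassoc : ∀ ρ,
    TensorProduct.assoc ℂ A A Γ ((Coalgebra.comul (R := ℂ) (A := A)).rTensor Γ (coactL ρ)) =
      coactL.lTensor A (coactL ρ)
  coactL_smul_d : ∀ x y : A,
    coactL (x • d y) =
      smulTensor A Γ (Coalgebra.comul x) (d.lTensor A (Coalgebra.comul y))
  /-- the right coaction -/
  coactR : Γ →ₗ[ℂ] Γ ⊗[ℂ] A
  coactR_counit : ∀ ρ,
    TensorProduct.rid ℂ Γ ((Coalgebra.counit (R := ℂ) (A := A)).lTensor Γ (coactR ρ)) = ρ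
  coactR_coassoc : ∀ ρ,
    TensorProduct.assoc ℂ Γ A A (coactR.rTensor A (coactR ρ)) =
      (Coalgebra.comul (R := ℂ) (A := A)).lTensor Γ (coactR ρ)
  coactR_smul_d : ∀ x y : A,
    coactR (x • d y) =
      smulTensor' A Γ (Coalgebra.comul x) (d.rTensor A (Coalgebra.comul y))

namespace BicovariantCalculus

variable {A : Type*} [Ring A] [HopfAlgebra ℂ A]
  {Γ : Type*} [AddCommGroup Γ] [Module ℂ Γ] [Module A Γ] [Module Aᵐᵒᵖ Γ]
  [SMulCommClass A Aᵐᵒᵖ Γ] [IsScalarTower ℂ A Γ] [IsScalarTower ℂ Aᵐᵒᵖ Γ]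
  (𝒞 : BicovariantCalculus A Γ)

/-- Left invariant one-forms. -/
def IsLeftInvariant (ρ : Γ) : Prop := 𝒞.coactL ρ = 1 ⊗ₜ[ℂ] ρ

/-- Right invariant one-forms. -/
def IsRightInvariant (ρ : Γ) : Prop := 𝒞.coactR ρ = ρ ⊗ₜ[ℂ] 1

/-! #### The braiding and the exterior algebra -/

/-- The subspace of `Γ ⊗_ℂ Γ` spanned by the `ρ a ⊗ ρ' - ρ ⊗ a ρ'`. -/
def balanced (A Γ : Type*) [Ring A] [AddCommGroup Γ] [Module ℂ Γ] [Module A Γ]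
    [Module Aᵐᵒᵖ Γ] : Submodule ℂ (Γ ⊗[ℂ] Γ) :=
  Submodule.span ℂ
    {z | ∃ (ρ ρ' : Γ) (a : A), z = (op a • ρ) ⊗ₜ[ℂ] ρ' - ρ ⊗ₜ[ℂ] (a • ρ')}

/-- The tensor product `Γ ⊗_A Γ` of bimodules. -/
abbrev TensorSq (A Γ : Type*) [Ring A] [AddCommGroup Γ] [Module ℂ Γ] [Module A Γ]
    [Module Aᵐᵒᵖ Γ] : Type _ :=
  (Γ ⊗[ℂ] Γ) ⧸ balanced A Γ

/-- The class of `ρ ⊗ ρ'` in `Γ ⊗_A Γ`. -/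
def tmulA (A : Type*) {Γ : Type*} [Ring A] [AddCommGroup Γ] [Module ℂ Γ] [Module A Γ]
    [Module Aᵐᵒᵖ Γ] (ρ ρ' : Γ) : TensorSq A Γ :=
  (balanced A Γ).mkQ (ρ ⊗ₜ[ℂ] ρ')

/-- `σ` is the braiding of `Γ`: the bimodule endomorphism of `Γ ⊗_A Γ` with
`σ (ω ⊗ η) = η ⊗ ω` for `ω` left invariant and `η` right invariant.  (The elements `a ω ⊗ η b`
span `Γ ⊗_A Γ`.) -/
def IsBraiding (σ : TensorSq A Γ →ₗ[ℂ] TensorSq A Γ) : Prop :=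
  ∀ (a b : A) (w e : Γ), 𝒞.IsLeftInvariant w → 𝒞.IsRightInvariant e →
    σ (tmulA A (a • w) (op b • e)) = tmulA A (a • e) (op b • w)

/-- Relations of the exterior algebra.  The first four make `a ↦ (a, 0)` an algebra map and
`ρ ↦ (0, ρ)` a bimodule map, and so present the tensor algebra `Γ^⊗` of the bimodule `Γ` over `A`;
the last one divides by the ideal generated by `ker (1 - σ) ⊆ Γ ⊗_A Γ`. -/
inductive ExtRel : TensorAlgebra ℂ (A × Γ) → TensorAlgebra ℂ (A × Γ) → Prop
  | one : ExtRel (TensorAlgebra.ι ℂ ((1 : A), (0 : Γ))) 1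
  | mul (x y : A) : ExtRel (TensorAlgebra.ι ℂ (x * y, (0 : Γ)))
      (TensorAlgebra.ι ℂ (x, (0 : Γ)) * TensorAlgebra.ι ℂ (y, (0 : Γ)))
  | smul (x : A) (ρ : Γ) : ExtRel (TensorAlgebra.ι ℂ ((0 : A), x • ρ))
      (TensorAlgebra.ι ℂ (x, (0 : Γ)) * TensorAlgebra.ι ℂ ((0 : A), ρ))
  | op_smul (x : A) (ρ : Γ) : ExtRel (TensorAlgebra.ι ℂ ((0 : A), op x • ρ))
      (TensorAlgebra.ι ℂ ((0 : A), ρ) * TensorAlgebra.ι ℂ (x, (0 : Γ)))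
  | ker (z : Γ ⊗[ℂ] Γ) (σ : TensorSq A Γ →ₗ[ℂ] TensorSq A Γ) (hσ : 𝒞.IsBraiding σ)
      (hz : σ ((balanced A Γ).mkQ z) = (balanced A Γ).mkQ z) :
      ExtRel (LinearMap.mul' ℂ (TensorAlgebra ℂ (A × Γ))
        (TensorProduct.map (TensorAlgebra.ι ℂ ∘ₗ LinearMap.inr ℂ A Γ)
          (TensorAlgebra.ι ℂ ∘ₗ LinearMap.inr ℂ A Γ) z)) 0

/-- The exterior algebra `Γ^∧ = Γ^⊗ / ⟨ker (1 - σ)⟩`. -/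
def Ext : Type _ := RingQuot 𝒞.ExtRel

instance : Semiring 𝒞.Ext := inferInstanceAs (Semiring (RingQuot 𝒞.ExtRel))

instance : Algebra ℂ 𝒞.Ext := inferInstanceAs (Algebra ℂ (RingQuot 𝒞.ExtRel))

instance : Ring 𝒞.Ext := Algebra.semiringToRing ℂ

/-- The quotient map onto the exterior algebra. -/
def emk : TensorAlgebra ℂ (A × Γ) →ₐ[ℂ] 𝒞.Ext :=
  (RingQuot.mkAlgHom ℂ 𝒞.ExtRel : TensorAlgebra ℂ (A × Γ) →ₐ[ℂ] RingQuot 𝒞.ExtRel)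

/-- The inclusion of zero-forms. -/
def ofA : A →ₗ[ℂ] 𝒞.Ext :=
  𝒞.emk.toLinearMap ∘ₗ TensorAlgebra.ι ℂ ∘ₗ LinearMap.inl ℂ A Γ

/-- The inclusion of one-forms. -/
def ofΓ : Γ →ₗ[ℂ] 𝒞.Ext :=
  𝒞.emk.toLinearMap ∘ₗ TensorAlgebra.ι ℂ ∘ₗ LinearMap.inr ℂ A Γ

/-- The forms of degree `k`: the span of the products `a ρ₁ ⋯ ρ_k`. -/
def form (k : ℕ) : Submodule ℂ 𝒞.Ext :=
  LinearMap.range 𝒞.ofA * LinearMap.range 𝒞.ofΓ ^ k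

/-- The forms whose degree is congruent to `p` modulo `2`. -/
def formParity (p : ZMod 2) : Submodule ℂ 𝒞.Ext :=
  ⨆ k : {k : ℕ // (k : ZMod 2) = p}, 𝒞.form k

/-- `D` is the extension of `d` to a degree one derivation of `Γ^∧` with square zero. -/
structure IsExteriorDifferential (D : 𝒞.Ext →ₗ[ℂ] 𝒞.Ext) : Prop where
  ofA : ∀ x : A, D (𝒞.ofA x) = 𝒞.ofΓ (𝒞.d x)
  mem_form : ∀ (k : ℕ), ∀ α ∈ 𝒞.form k, D α ∈ 𝒞.form (k + 1)
  leibniz : ∀ (k : ℕ), ∀ α ∈ 𝒞.form k, ∀ β, D (α * β) = D α * β + (-1 : ℂ) ^ k • (α * D β)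
  sq : ∀ α, D (D α) = 0

/-- `δL : Γ^∧ → A ⊗ Γ^∧` is the left coaction on `Γ^∧`: the algebra map that extends the
coproduct of `A` and the left coaction of `Γ`. -/
structure IsExteriorCoaction (δL : 𝒞.Ext →ₐ[ℂ] A ⊗[ℂ] 𝒞.Ext) : Prop where
  ofA : ∀ x : A, δL (𝒞.ofA x) = 𝒞.ofA.lTensor A (Coalgebra.comul x)
  ofΓ : ∀ ρ : Γ, δL (𝒞.ofΓ ρ) = 𝒞.ofΓ.lTensor A (𝒞.coactL ρ)

/-- The right action `α ◁ h = ⟨h, α₍₋₁₎⟩ α₍₀₎` of a functional `h` on `A`. -/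
def actR (δL : 𝒞.Ext →ₐ[ℂ] A ⊗[ℂ] 𝒞.Ext) (h : A →ₗ[ℂ] ℂ) : 𝒞.Ext →ₗ[ℂ] 𝒞.Ext :=
  (TensorProduct.lid ℂ 𝒞.Ext).toLinearMap ∘ₗ h.rTensor 𝒞.Ext ∘ₗ δL.toLinearMap

/-! #### Structure data relative to a basis of left invariant one-forms

`ω` is a basis of the left `A`-module `Γ`; in the theorem it consists of left invariant forms. -/

variable {N : ℕ} (ω : Module.Basis (Fin N) A Γ)

/-- The functional `ρ = ∑ aᵢ ωᵢ ↦ ε(aᵢ)` on `Γ`. -/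
def coordCounit (ω : Module.Basis (Fin N) A Γ) (i : Fin N) : Γ →ₗ[ℂ] ℂ :=
  (Coalgebra.counit (R := ℂ) (A := A)) ∘ₗ (ω.coord i).restrictScalars ℂ

/-- The basis `Xᵢ` of the quantum tangent space dual to `ωᵢ`: `d x = ∑ (Xᵢ ▷ x) ωᵢ`, that is,
`Xᵢ(x) = ε(i-th coordinate of d x)`. -/
def tangent (i : Fin N) : A →ₗ[ℂ] ℂ := coordCounit ω i ∘ₗ 𝒞.d

/-- The functionals `f_{ij}` with `ωᵢ x = ∑ⱼ (f_{ij} ▷ x) ωⱼ`. -/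
def fFun (_𝒞 : BicovariantCalculus A Γ) (ω : Module.Basis (Fin N) A Γ) (i j : Fin N) :
    A →ₗ[ℂ] ℂ where
  toFun x := coordCounit ω j (op x • ω i)
  map_add' x y := by simp [add_smul]
  map_smul' c x := by simp [op_smul]

/-- The elements `J_{ij}` of `A` with right coaction `ωⱼ ↦ ∑ᵢ ωᵢ ⊗ J_{ij}`. -/
def Jmat (i j : Fin N) : A :=
  TensorProduct.lid ℂ A ((coordCounit ω i).rTensor A (𝒞.coactR (ω j)))

/-- The components `σ^{ij}_{kl} = f_{kj}(J_{il})` of the braiding,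
`σ(ω_k ⊗ ω_l) = ∑ σ^{ij}_{kl} ωᵢ ⊗ ωⱼ`. -/
def braid (i j k l : Fin N) : ℂ := 𝒞.fFun ω k j (𝒞.Jmat ω i l)

/-- The structure constants `C_{ij}^k = Xⱼ(J_{ik})`. -/
def structConst (i j k : Fin N) : ℂ := 𝒞.tangent ω j (𝒞.Jmat ω i k)

/-- The right invariant forms `ηⱼ = ∑ᵢ ωᵢ S(J_{ij})`. -/
def eta (j : Fin N) : Γ :=
  ∑ i, op (HopfAlgebra.antipode ℂ (𝒞.Jmat ω i j)) • ω i

/-- The subalgebra generated by `Xᵢ` and `f_{jk}` inside the dual of `A` with its convolution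
product.  (All its elements are representative functionals, so it lies in the dual Hopf
algebra of `A`.) -/
def evenAlg : Subalgebra ℂ (WithConv (A →ₗ[ℂ] ℂ)) :=
  Algebra.adjoin ℂ
    (Set.range (fun i => toConv (𝒞.tangent ω i)) ∪
      Set.range (fun p : Fin N × Fin N => toConv (𝒞.fFun ω p.1 p.2)))

/-- `Xᵢ` as an element of the even algebra. -/
def evenX (i : Fin N) : 𝒞.evenAlg ω :=
  ⟨toConv (𝒞.tangent ω i), Algebra.subset_adjoin (Or.inl ⟨i, rfl⟩)⟩

/-- `f_{ij}` as an element of the even algebra. -/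
def evenF (i j : Fin N) : 𝒞.evenAlg ω :=
  ⟨toConv (𝒞.fFun ω i j), Algebra.subset_adjoin (Or.inr ⟨(i, j), rfl⟩)⟩

/-- `S`-compatibility: the antipode `h ↦ h ∘ S` of the dual maps each `f_{ij}` into the even
algebra. -/
def IsSCompatible : Prop :=
  ∀ i j : Fin N, toConv (𝒞.fFun ω i j ∘ₗ HopfAlgebra.antipode ℂ) ∈ 𝒞.evenAlg ω

/-! #### The quantum Cartan algebra -/

/-- Generators of the quantum Cartan algebra. -/
inductive CartanGen : Type _
  | even (h : 𝒞.evenAlg ω)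
  | xi (i : Fin N)
  | delta

/-- Even letters in the free algebra. -/
abbrev ev (h : 𝒞.evenAlg ω) : FreeAlgebra ℂ (𝒞.CartanGen ω) := FreeAlgebra.ι ℂ (.even h)

/-- The letter `ξᵢ` in the free algebra. -/
abbrev lxi (i : Fin N) : FreeAlgebra ℂ (𝒞.CartanGen ω) := FreeAlgebra.ι ℂ (.xi i)

/-- The letter `δ` in the free algebra. -/
abbrev ldelta : FreeAlgebra ℂ (𝒞.CartanGen ω) := FreeAlgebra.ι ℂ .delta

/-- Relations of the quantum Cartan algebra: those of the even algebra, and the commutation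
relations that involve `ξᵢ` and `δ`.  The quadratic relations among the `ξᵢ` are indexed by
`ker (1 - σᵗ)`, with `σᵗ(Xᵢ ⊗ Xⱼ) = ∑ σ^{ij}_{kl} X_k ⊗ X_l`. -/
inductive CartanRel : FreeAlgebra ℂ (𝒞.CartanGen ω) → FreeAlgebra ℂ (𝒞.CartanGen ω) → Prop
  | ev_add (h k : 𝒞.evenAlg ω) : CartanRel (𝒞.ev ω (h + k)) (𝒞.ev ω h + 𝒞.ev ω k)
  | ev_mul (h k : 𝒞.evenAlg ω) : CartanRel (𝒞.ev ω (h * k)) (𝒞.ev ω h * 𝒞.ev ω k)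
  | ev_algebraMap (c : ℂ) : CartanRel (𝒞.ev ω (algebraMap ℂ _ c)) (algebraMap ℂ _ c)
  | xi_xi (c : Fin N → Fin N → ℂ)
      (hc : ∀ k l, ∑ i, ∑ j, c i j * 𝒞.braid ω i j k l = c k l) :
      CartanRel (∑ i, ∑ j, c i j • (𝒞.lxi ω i * 𝒞.lxi ω j)) 0
  | xi_delta (i : Fin N) :
      CartanRel (𝒞.lxi ω i * 𝒞.ldelta ω + 𝒞.ldelta ω * 𝒞.lxi ω i) (𝒞.ev ω (𝒞.evenX ω i))
  | delta_delta : CartanRel (𝒞.ldelta ω * 𝒞.ldelta ω) 0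
  | xi_f (i k j : Fin N) :
      CartanRel (𝒞.lxi ω i * 𝒞.ev ω (𝒞.evenF ω k j))
        (∑ n, ∑ m, 𝒞.braid ω i j n m • (𝒞.ev ω (𝒞.evenF ω k n) * 𝒞.lxi ω m))
  | xi_X (i j : Fin N) :
      CartanRel (𝒞.lxi ω i * 𝒞.ev ω (𝒞.evenX ω j))
        (∑ k, ∑ l, 𝒞.braid ω i j k l • (𝒞.ev ω (𝒞.evenX ω k) * 𝒞.lxi ω l)
          + ∑ k, 𝒞.structConst ω i j k • 𝒞.lxi ω k)
  | f_delta (i j : Fin N) :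
      CartanRel (𝒞.ev ω (𝒞.evenF ω i j) * 𝒞.ldelta ω) (𝒞.ldelta ω * 𝒞.ev ω (𝒞.evenF ω i j))
  | X_delta (i : Fin N) :
      CartanRel (𝒞.ev ω (𝒞.evenX ω i) * 𝒞.ldelta ω) (𝒞.ldelta ω * 𝒞.ev ω (𝒞.evenX ω i))

/-- The quantum Cartan algebra `C_Γ`. -/
def Cartan : Type _ := RingQuot (𝒞.CartanRel ω)

instance : Semiring (𝒞.Cartan ω) := inferInstanceAs (Semiring (RingQuot (𝒞.CartanRel ω)))

instance : Algebra ℂ (𝒞.Cartan ω) := inferInstanceAs (Algebra ℂ (RingQuot (𝒞.CartanRel ω)))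

instance : Ring (𝒞.Cartan ω) := Algebra.semiringToRing ℂ

/-- The quotient map onto the quantum Cartan algebra. -/
def cmk : FreeAlgebra ℂ (𝒞.CartanGen ω) →ₐ[ℂ] 𝒞.Cartan ω :=
  (RingQuot.mkAlgHom ℂ (𝒞.CartanRel ω) :
    FreeAlgebra ℂ (𝒞.CartanGen ω) →ₐ[ℂ] RingQuot (𝒞.CartanRel ω))

theorem cmk_rel {x y : FreeAlgebra ℂ (𝒞.CartanGen ω)} (h : 𝒞.CartanRel ω x y) :
    𝒞.cmk ω x = 𝒞.cmk ω y :=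
  RingQuot.mkAlgHom_rel ℂ h

/-- `Xᵢ` in `C_Γ`. -/
def cX (i : Fin N) : 𝒞.Cartan ω := 𝒞.cmk ω (𝒞.ev ω (𝒞.evenX ω i))

/-- `f_{ij}` in `C_Γ`. -/
def cf (i j : Fin N) : 𝒞.Cartan ω := 𝒞.cmk ω (𝒞.ev ω (𝒞.evenF ω i j))

/-- `ξᵢ` in `C_Γ`. -/
def cxi (i : Fin N) : 𝒞.Cartan ω := 𝒞.cmk ω (𝒞.lxi ω i)

/-- `δ` in `C_Γ`. -/
def cdelta : 𝒞.Cartan ω := 𝒞.cmk ω (𝒞.ldelta ω)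

/-- The effect of the parity automorphism on generators. -/
def parityGen : 𝒞.CartanGen ω → 𝒞.Cartan ω
  | .even h => 𝒞.cmk ω (𝒞.ev ω h)
  | .xi i => -𝒞.cmk ω (𝒞.lxi ω i)
  | .delta => -𝒞.cmk ω (𝒞.ldelta ω)

theorem parityGen_rel ⦃x y : FreeAlgebra ℂ (𝒞.CartanGen ω)⦄ (h : 𝒞.CartanRel ω x y) :
    FreeAlgebra.lift ℂ (𝒞.parityGen ω) x = FreeAlgebra.lift ℂ (𝒞.parityGen ω) y := by
  have key := 𝒞.cmk_rel ω h
  cases h <;>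
    simp only [map_add, map_mul, map_sum, map_smul, map_zero, AlgHom.commutes,
      FreeAlgebra.lift_ι_apply, parityGen, neg_mul, mul_neg, neg_neg, smul_neg,
      Finset.sum_neg_distrib] at key ⊢ <;>
    first
      | exact key
      | rw [← neg_add, ← key]
      | rw [key]

/-- The parity automorphism of `C_Γ`: identity on even generators, `-1` on `ξᵢ` and `δ`. -/
def parity : 𝒞.Cartan ω →ₐ[ℂ] 𝒞.Cartan ω :=
  (RingQuot.liftAlgHom ℂ ⟨FreeAlgebra.lift ℂ (𝒞.parityGen ω), 𝒞.parityGen_rel ω⟩ :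
    RingQuot (𝒞.CartanRel ω) →ₐ[ℂ] 𝒞.Cartan ω)

theorem parity_cmk (x : FreeAlgebra ℂ (𝒞.CartanGen ω)) :
    𝒞.parity ω (𝒞.cmk ω x) = FreeAlgebra.lift ℂ (𝒞.parityGen ω) x :=
  RingQuot.liftAlgHom_mkAlgHom_apply ℂ _ _ _

theorem parity_parity (x : 𝒞.Cartan ω) : 𝒞.parity ω (𝒞.parity ω x) = x := by
  have : (𝒞.parity ω).comp (𝒞.parity ω) = AlgHom.id ℂ _ := by
    apply RingQuot.ringQuot_ext' ℂ
    change ((𝒞.parity ω).comp (𝒞.parity ω)).comp (𝒞.cmk ω) = (AlgHom.id ℂ _).comp (𝒞.cmk ω)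
    apply FreeAlgebra.hom_ext
    funext g
    cases g <;> simp [parity_cmk, parityGen]
  exact DFunLike.congr_fun this x

/-- The `ℤ/2`-grading of `C_Γ`, by the eigenspaces of the parity automorphism. -/
def part (p : ZMod 2) : Submodule ℂ (𝒞.Cartan ω) where
  carrier := {x | 𝒞.parity ω x = (-1 : ℂ) ^ p.val • x}
  add_mem' {x y} hx hy := by
    simp only [Set.mem_ofPred_eq] at hx hy ⊢
    rw [map_add, hx, hy, smul_add]
  zero_mem' := by simp
  smul_mem' c x hx := by
    simp only [Set.mem_ofPred_eq] at hx ⊢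
    rw [map_smul, hx, smul_comm]

theorem mem_part {p : ZMod 2} {x : 𝒞.Cartan ω} :
    x ∈ 𝒞.part ω p ↔ 𝒞.parity ω x = (-1 : ℂ) ^ p.val • x := Iff.rfl

theorem zmod_two_cases (p : ZMod 2) : p = 0 ∨ p = 1 := by
  revert p; decide

instance part_gradedMonoid : SetLike.GradedMonoid (𝒞.part ω) where
  one_mem := by simp [mem_part]
  mul_mem p q x y hx hy := by
    rw [mem_part] at hx hy ⊢
    rw [map_mul, hx, hy, smul_mul_smul_comm]
    congr 1
    have h00 : ((0 : ZMod 2) + 0).val = 0 := rfl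
    have h01 : ((0 : ZMod 2) + 1).val = 1 := rfl
    have h10 : ((1 : ZMod 2) + 0).val = 1 := rfl
    have h11 : ((1 : ZMod 2) + 1).val = 0 := rfl
    rcases zmod_two_cases p with rfl | rfl <;> rcases zmod_two_cases q with rfl | rfl <;>
      simp only [h00, h01, h10, h11, ZMod.val_zero, ZMod.val_one] <;> norm_num

/-- The component of `x` of parity `p`. -/
def proj (p : ZMod 2) : 𝒞.Cartan ω →ₗ[ℂ] 𝒞.part ω p :=
  LinearMap.codRestrict (𝒞.part ω p)
    ((2⁻¹ : ℂ) • (LinearMap.id + (-1 : ℂ) ^ p.val • (𝒞.parity ω).toLinearMap))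
    (by
      intro x
      rw [mem_part]
      have h : (-1 : ℂ) ^ p.val * (-1 : ℂ) ^ p.val = 1 := by
        rw [← mul_pow]; simp
      simp only [LinearMap.smul_apply, LinearMap.add_apply, LinearMap.id_apply,
        AlgHom.toLinearMap_apply, map_smul, map_add, parity_parity]
      rw [smul_comm ((-1 : ℂ) ^ p.val) (2⁻¹ : ℂ), smul_add ((-1 : ℂ) ^ p.val),
        smul_smul ((-1 : ℂ) ^ p.val), h, one_smul, add_comm])

instance part_gradedAlgebra : GradedAlgebra (𝒞.part ω) where
  decompose' x := ∑ p : ZMod 2, DirectSum.of (fun p => 𝒞.part ω p) p (𝒞.proj ω p x)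
  left_inv x := by
    rw [map_sum]
    simp only [DirectSum.coeAddMonoidHom_of]
    have : (Finset.univ : Finset (ZMod 2)) = {0, 1} := rfl
    rw [this, Finset.sum_pair (by decide)]
    simp only [proj, LinearMap.codRestrict_apply, LinearMap.smul_apply, LinearMap.add_apply,
      LinearMap.id_apply, AlgHom.toLinearMap_apply, ZMod.val_zero, ZMod.val_one, pow_zero, pow_one]
    module
  right_inv := by
    intro x
    induction x using DirectSum.induction_on with
    | zero => simp
    | add x y hx hy =>
      simp only [map_add, Finset.sum_add_distrib] at hx hy ⊢
      rw [hx, hy]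
    | of p x =>
      rw [DirectSum.coeAddMonoidHom_of]
      change ∑ q : ZMod 2, DirectSum.of (fun p => 𝒞.part ω p) q (𝒞.proj ω q x) = _
      rw [Finset.sum_eq_single p]
      · congr 1
        apply Subtype.ext
        have h : (-1 : ℂ) ^ p.val * (-1 : ℂ) ^ p.val = 1 := by
          rw [← mul_pow]; simp
        have hx := (𝒞.mem_part ω).1 x.2
        simp only [proj, LinearMap.codRestrict_apply, LinearMap.smul_apply, LinearMap.add_apply,
          LinearMap.id_apply, AlgHom.toLinearMap_apply]
        rw [hx, smul_smul, h]
        module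
      · intro q _ hq
        have hx := (𝒞.mem_part ω).1 x.2
        have : 𝒞.proj ω q x = 0 := by
          apply Subtype.ext
          simp only [proj, LinearMap.codRestrict_apply, LinearMap.smul_apply, LinearMap.add_apply,
            LinearMap.id_apply, AlgHom.toLinearMap_apply]
          rw [hx]
          rcases zmod_two_cases p with rfl | rfl <;> rcases zmod_two_cases q with rfl | rfl <;>
            first
              | exact absurd rfl hq
              | simp [ZMod.val_one]
        rw [this, map_zero]
      · simp

/-- `Δ` is the coproduct of `C_Γ`: the algebra map to the `ℤ/2`-graded tensor product (with
`(a ⊗ b)(a' ⊗ b') = (-1)^{|b||a'|} a a' ⊗ b b'`) with the prescribed values on generators. -/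
structure IsCartanComul (Δ : 𝒞.Cartan ω →ₐ[ℂ] 𝒞.part ω ᵍ⊗[ℂ] 𝒞.part ω) : Prop where
  X : ∀ i, Δ (𝒞.cX ω i) = 1 ᵍ⊗ₜ[ℂ] 𝒞.cX ω i + ∑ j, 𝒞.cX ω j ᵍ⊗ₜ[ℂ] 𝒞.cf ω j i
  f : ∀ i j, Δ (𝒞.cf ω i j) = ∑ k, 𝒞.cf ω i k ᵍ⊗ₜ[ℂ] 𝒞.cf ω k j
  xi : ∀ i, Δ (𝒞.cxi ω i) = 1 ᵍ⊗ₜ[ℂ] 𝒞.cxi ω i + ∑ j, 𝒞.cxi ω j ᵍ⊗ₜ[ℂ] 𝒞.cf ω j i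
  delta : Δ (𝒞.cdelta ω) = 1 ᵍ⊗ₜ[ℂ] 𝒞.cdelta ω + 𝒞.cdelta ω ᵍ⊗ₜ[ℂ] 1

/-- `ε` is the counit of `C_Γ`. -/
structure IsCartanCounit (ε : 𝒞.Cartan ω →ₐ[ℂ] ℂ) : Prop where
  X : ∀ i, ε (𝒞.cX ω i) = 0
  f : ∀ i j, ε (𝒞.cf ω i j) = if i = j then 1 else 0
  xi : ∀ i, ε (𝒞.cxi ω i) = 0
  delta : ε (𝒞.cdelta ω) = 0

/-- `φ` is a `ℤ/2`-graded algebra anti-homomorphism: `φ(x y) = (-1)^{|x||y|} φ(y) φ(x)`. -/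
structure IsGradedAntiHom {B : Type*} [Ring B] [Algebra ℂ B] (φ : 𝒞.Cartan ω → B) :
    Prop where
  one : φ 1 = 1
  mul : ∀ p q : ZMod 2, ∀ x ∈ 𝒞.part ω p, ∀ y ∈ 𝒞.part ω q,
    φ (x * y) = (-1 : ℂ) ^ (p.val * q.val) • (φ y * φ x)

/-- `T` is the (invertible) antipode `S_Γ` of `C_Γ`: the bijective graded anti-homomorphism with
`f_{ij} ↦ S(f_{ij})`, `Xᵢ ↦ -∑ Xⱼ S(f_{ji})`, `ξᵢ ↦ -∑ ξⱼ S(f_{ji})`, `δ ↦ -δ`, where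
`S(f_{ij}) = f_{ij} ∘ S` is an element of the even algebra. -/
structure IsCartanAntipode (hc : 𝒞.IsSCompatible ω) (T : 𝒞.Cartan ω ≃ₗ[ℂ] 𝒞.Cartan ω) :
    Prop where
  antiHom : 𝒞.IsGradedAntiHom ω T
  f : ∀ i j, T (𝒞.cf ω i j) = 𝒞.cmk ω (𝒞.ev ω ⟨_, hc i j⟩)
  X : ∀ i, T (𝒞.cX ω i) = -∑ j, 𝒞.cX ω j * 𝒞.cmk ω (𝒞.ev ω ⟨_, hc j i⟩)
  xi : ∀ i, T (𝒞.cxi ω i) = -∑ j, 𝒞.cxi ω j * 𝒞.cmk ω (𝒞.ev ω ⟨_, hc j i⟩)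
  delta : T (𝒞.cdelta ω) = -𝒞.cdelta ω

/-! #### Right Cartan calculus -/

/-- The right Lie derivative `α ↦ α ◁ Rᵢ`, with `Rᵢ = -S⁻¹(Xᵢ) = -Xᵢ ∘ S⁻¹`. -/
def lieR (hS : Function.Bijective (HopfAlgebra.antipode ℂ : A →ₗ[ℂ] A))
    (δL : 𝒞.Ext →ₐ[ℂ] A ⊗[ℂ] 𝒞.Ext) (i : Fin N) : 𝒞.Ext →ₗ[ℂ] 𝒞.Ext :=
  𝒞.actR δL (-(𝒞.tangent ω i ∘ₗ antipodeInv hS))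

/-- The operator `α ↦ α ◁ S⁻¹(f_{ij})`. -/
def lieRf (hS : Function.Bijective (HopfAlgebra.antipode ℂ : A →ₗ[ℂ] A))
    (δL : 𝒞.Ext →ₐ[ℂ] A ⊗[ℂ] 𝒞.Ext) (i j : Fin N) : 𝒞.Ext →ₗ[ℂ] 𝒞.Ext :=
  𝒞.actR δL (𝒞.fFun ω i j ∘ₗ antipodeInv hS)

/-- `I j` are the right inner derivatives: the operators of degree `-1` with `I j (ηᵢ) = δ_{ij}`
and `I j (α β) = I j (α) β + (-1)^{|α|} ∑ₖ (α ◁ S⁻¹(f_{kj})) I k (β)`. -/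
structure IsRightInner (hS : Function.Bijective (HopfAlgebra.antipode ℂ : A →ₗ[ℂ] A))
    (δL : 𝒞.Ext →ₐ[ℂ] A ⊗[ℂ] 𝒞.Ext) (I : Fin N → 𝒞.Ext →ₗ[ℂ] 𝒞.Ext) : Prop where
  form_zero : ∀ j, ∀ α ∈ 𝒞.form 0, I j α = 0
  form_succ : ∀ j k, ∀ α ∈ 𝒞.form (k + 1), I j α ∈ 𝒞.form k
  eta : ∀ i j, I j (𝒞.ofΓ (𝒞.eta ω i)) = if i = j then 1 else 0
  leibniz : ∀ (j : Fin N) (k : ℕ), ∀ α ∈ 𝒞.form k, ∀ β,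
    I j (α * β) = I j α * β + (-1 : ℂ) ^ k • ∑ m, 𝒞.lieRf ω hS δL m j α * I m β

/-- For `α` of degree `k`: `x₁ ⊗ x₂ ↦ (-1)^{k |x₂|} φ_{x₁}(α) φ_{x₂}(β)`. -/
def gradedProd (φ : 𝒞.Cartan ω →ₗ[ℂ] Module.End ℂ 𝒞.Ext) (k : ℕ) (α β : 𝒞.Ext) :
    𝒞.Cartan ω ⊗[ℂ] 𝒞.Cartan ω →ₗ[ℂ] 𝒞.Ext :=
  LinearMap.mul' ℂ 𝒞.Ext ∘ₗ
    TensorProduct.map (LinearMap.applyₗ α ∘ₗ φ)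
      (LinearMap.applyₗ β ∘ₗ φ ∘ₗ (𝒞.parity ω ^ k).toLinearMap)

/-- `φ` makes `Γ^∧` a right module algebra over the `ℤ/2`-graded bialgebra `(C_Γ, Δ, ε)`: `φ` is a
graded anti-homomorphism into `End(Γ^∧)`, compatible with parities, and
`φ_x(α β) = (-1)^{|x₍₂₎||α|} φ_{x₍₁₎}(α) φ_{x₍₂₎}(β)`, `φ_x(1) = ε(x) 1`. -/
structure IsRightModuleAlgebra (Δ : 𝒞.Cartan ω →ₐ[ℂ] 𝒞.part ω ᵍ⊗[ℂ] 𝒞.part ω)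
    (ε : 𝒞.Cartan ω →ₐ[ℂ] ℂ) (φ : 𝒞.Cartan ω →ₗ[ℂ] Module.End ℂ 𝒞.Ext) : Prop where
  antiHom : 𝒞.IsGradedAntiHom ω (B := Module.End ℂ 𝒞.Ext) φ
  parity : ∀ p q : ZMod 2, ∀ x ∈ 𝒞.part ω p, ∀ α ∈ 𝒞.formParity q,
    φ x α ∈ 𝒞.formParity (p + q)
  mul : ∀ (x : 𝒞.Cartan ω) (k : ℕ), ∀ α ∈ 𝒞.form k, ∀ β,
    φ x (α * β) =
      𝒞.gradedProd ω φ k α β ((GradedTensorProduct.of ℂ (𝒞.part ω) (𝒞.part ω)).symm (Δ x))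
  one : ∀ x, φ x 1 = ε x • (1 : 𝒞.Ext)

/-- The prescribed values `R_j ↦ (◁ R_j)`, `S⁻¹(f_{jk}) ↦ (◁ S⁻¹(f_{jk}))`,
`-S⁻¹(ξ_j) ↦ I j`, `S⁻¹(δ) ↦ D` of the representation, where `R_j = -S⁻¹(X_j)` and `S` is the
antipode `T` of `C_Γ`. -/
structure IsRightCartanRep (hS : Function.Bijective (HopfAlgebra.antipode ℂ : A →ₗ[ℂ] A))
    (δL : 𝒞.Ext →ₐ[ℂ] A ⊗[ℂ] 𝒞.Ext) (I : Fin N → 𝒞.Ext →ₗ[ℂ] 𝒞.Ext) (D : 𝒞.Ext →ₗ[ℂ] 𝒞.Ext)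
    (T : 𝒞.Cartan ω ≃ₗ[ℂ] 𝒞.Cartan ω) (φ : 𝒞.Cartan ω →ₗ[ℂ] Module.End ℂ 𝒞.Ext) :
    Prop where
  antiHom : 𝒞.IsGradedAntiHom ω (B := Module.End ℂ 𝒞.Ext) φ
  R : ∀ j, φ (-T.symm (𝒞.cX ω j)) = 𝒞.lieR ω hS δL j
  f : ∀ j k, φ (T.symm (𝒞.cf ω j k)) = 𝒞.lieRf ω hS δL j k
  xi : ∀ j, φ (-T.symm (𝒞.cxi ω j)) = I j
  delta : φ (T.symm (𝒞.cdelta ω)) = D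

end BicovariantCalculus

end QuantumCartan

end

/-! The calculus is encoded in the functionals `X`, `f` and the matrix `J` of elements of `A`. Write
`h ▷ x` and `x ◁ h` for the two actions of functionals on `A`. Computing the right coaction of `ω_j
x` and of `dx` in two ways gives `∑ J_{ij} (x ◁ f_{ik}) = ∑ (f_{jl} ▷ x) J_{kl}`
(`sum_Jmat_mul_ract`) and `x ◁ X_i = ∑ (X_j ▷ x) J_{ij}` (`ract_Xc`). Most later commutation rules
come from these two by evaluating functionals on them and by inverting the matrix `f` with `S(f)` or
`S⁻¹(f)`.

On the side of forms, the right invariant `η_j` form a basis of `Γ` as a right module (`rcoord`),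
and the braiding merely flips `ω_i` and `η_j` in `a ω_i ⊗ η_j b`; such tensors span, so facts about
`σ` are checked on them (`tensor_ext`). The left coaction descends to `Γ^∧` because `σ` is left
covariant. The inner derivatives exist because the twisted Leibniz rule says exactly that the block
matrix with diagonal blocks `(-1)^{|α|} α ◁ S⁻¹(f)` and `α`, and with corner `i(α)`, is
multiplicative in `α`. So the matrix extends from `A` and `Γ` to `Γ^∧` once its corner vanishes on
`ker (1 - σ)`, and there the corner is a contraction of `(1 - σ) z` (`contractSq_braiding`). The
inner derivatives then satisfy a commutation rule with the right action (`inner_eact`), Cartan's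
formula (`inner_differential_add`), and the quadratic relations of the `ξ_i` (`inner_inner`).

On the side of `C_Γ`, the algebra `U` of functionals carries the coproduct dual to the product of
`A` and is stable under translations. Translation by `J` is an algebra map from `U` to matrices over
`U`, and the relations of `ξ` with `f` and `X` become the single rule `ξ_i h = ∑ h(· J_{im}) ξ_m`
for all `h` in `U` (`cxi_mul_cev`). This gives a compact universal property (`exists_cartan_hom`),
from which the coproduct, the counit and the antipode are built. `S`-compatibility makes `U` stable
under `S`; an invertible scalar matrix that conjugates `S⁻¹(f)` into `S(f)` makes it stable under
`S⁻¹` (`gc_mem`), so the antipode is bijective.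

The two sides meet in `exists_cartanHomEnd`: the operators `◁ S⁻¹(h)`, `-i_j` and `d` satisfy the
relations of `C_Γ`, hence define a homomorphism `π`, and `ρ = π ∘ S` is the required graded
anti-homomorphism. It is unique because `ρ ∘ S⁻¹` is a homomorphism with prescribed values on
generators. The module algebra law holds for the generators of `C_Γ` and is carried to products by
induction. -/

noncomputable section

namespace QuantumCartan

/-! ### Actions of functionals on `A` and the antipode as an anti-coalgebra map. -/

section Functionals

variable {A : Type*} [Ring A] [HopfAlgebra ℂ A]

/-- The left action `h ▷ x = x₍₁₎ h(x₍₂₎)` of functionals on `A`. -/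
def lact : WithConv (A →ₗ[ℂ] ℂ) →ₗ[ℂ] A →ₗ[ℂ] A where
  toFun h := (TensorProduct.rid ℂ A).toLinearMap ∘ₗ h.ofConv.lTensor A ∘ₗ Coalgebra.comul
  map_add' h k := by ext; simp [LinearMap.lTensor_add]
  map_smul' c h := by ext; simp [LinearMap.lTensor_smul]

/-- The right action `x ◁ h = h(x₍₁₎) x₍₂₎` of functionals on `A`. -/
def ract : WithConv (A →ₗ[ℂ] ℂ) →ₗ[ℂ] A →ₗ[ℂ] A where
  toFun h := (TensorProduct.lid ℂ A).toLinearMap ∘ₗ h.ofConv.rTensor A ∘ₗ Coalgebra.comul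
  map_add' h k := by ext; simp [LinearMap.rTensor_add]
  map_smul' c h := by ext; simp [LinearMap.rTensor_smul]

theorem lact_apply (h : WithConv (A →ₗ[ℂ] ℂ)) (x : A) :
    lact h x = TensorProduct.rid ℂ A (h.ofConv.lTensor A (Coalgebra.comul x)) := rfl

theorem ract_apply (h : WithConv (A →ₗ[ℂ] ℂ)) (x : A) :
    ract h x = TensorProduct.lid ℂ A (h.ofConv.rTensor A (Coalgebra.comul x)) := rfl

theorem lact_repr (h : WithConv (A →ₗ[ℂ] ℂ)) {x : A} {ι : Type*} (r : Coalgebra.Repr ℂ x ι) :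
    lact h x = ∑ i ∈ r.index, h (r.right i) • r.left i := by
  rw [lact_apply, ← r.eq]; simp

theorem ract_repr (h : WithConv (A →ₗ[ℂ] ℂ)) {x : A} {ι : Type*} (r : Coalgebra.Repr ℂ x ι) :
    ract h x = ∑ i ∈ r.index, h (r.left i) • r.right i := by
  rw [ract_apply, ← r.eq]; simp

/-- Convolution products are unfolded through one of the two actions, so that coproducts of elements
need not be written out. -/
theorem conv_apply_lact (h k : WithConv (A →ₗ[ℂ] ℂ)) (x : A) : (h * k) x = h (lact k x) := by
  rw [(Coalgebra.Repr.arbitrary ℂ x).convMul_apply, lact_repr k (Coalgebra.Repr.arbitrary ℂ x)]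
  simp [mul_comm]

theorem conv_apply_ract (h k : WithConv (A →ₗ[ℂ] ℂ)) (x : A) : (h * k) x = k (ract h x) := by
  rw [(Coalgebra.Repr.arbitrary ℂ x).convMul_apply, ract_repr h (Coalgebra.Repr.arbitrary ℂ x)]
  simp

theorem one_conv_apply (x : A) : (1 : WithConv (A →ₗ[ℂ] ℂ)) x = Coalgebra.counit x := rfl

theorem lact_one (x : A) : lact 1 x = x := by
  rw [lact_apply]
  change TensorProduct.rid ℂ A ((Coalgebra.counit (R := ℂ) (A := A)).lTensor A _) = x
  simp

theorem ract_one (x : A) : ract 1 x = x := by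
  rw [ract_apply]
  change TensorProduct.lid ℂ A ((Coalgebra.counit (R := ℂ) (A := A)).rTensor A _) = x
  simp

/-- Compatibility of the coproduct with the left action. -/
theorem comul_lact (h : WithConv (A →ₗ[ℂ] ℂ)) (x : A) :
    Coalgebra.comul (lact h x) = (lact h).lTensor A (Coalgebra.comul (R := ℂ) x) := by
  have key : ∀ t : A ⊗[ℂ] A, Coalgebra.comul (R := ℂ)
      (TensorProduct.rid ℂ A (h.ofConv.lTensor A t)) =
      ((TensorProduct.rid ℂ A).toLinearMap ∘ₗ h.ofConv.lTensor A).lTensor A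
        (TensorProduct.assoc ℂ A A A (Coalgebra.comul.rTensor A t)) := by
    intro t
    induction t using TensorProduct.induction_on with
    | zero => simp
    | add a b ha hb => simp only [map_add, ha, hb]
    | tmul a b =>
      simp only [LinearMap.lTensor_tmul, TensorProduct.rid_tmul, map_smul, LinearMap.rTensor_tmul]
      generalize Coalgebra.comul (R := ℂ) a = s
      induction s using TensorProduct.induction_on with
      | zero => simp
      | add a b ha hb => simp only [smul_add, map_add, TensorProduct.add_tmul, ha, hb]
      | tmul c d => simp
  rw [lact_apply, key, Coalgebra.coassoc_apply, ← LinearMap.comp_apply, ← LinearMap.lTensor_comp]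
  rfl

theorem comul_ract (h : WithConv (A →ₗ[ℂ] ℂ)) (x : A) :
    Coalgebra.comul (ract h x) = (ract h).rTensor A (Coalgebra.comul (R := ℂ) x) := by
  have key : ∀ t : A ⊗[ℂ] A, Coalgebra.comul (R := ℂ)
      (TensorProduct.lid ℂ A (h.ofConv.rTensor A t)) =
      ((TensorProduct.lid ℂ A).toLinearMap ∘ₗ h.ofConv.rTensor A).rTensor A
        ((TensorProduct.assoc ℂ A A A).symm (Coalgebra.comul.lTensor A t)) := by
    intro t
    induction t using TensorProduct.induction_on with
    | zero => simp
    | add a b ha hb => simp only [map_add, ha, hb]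
    | tmul a b =>
      simp only [LinearMap.lTensor_tmul, TensorProduct.lid_tmul, map_smul, LinearMap.rTensor_tmul]
      generalize Coalgebra.comul (R := ℂ) b = s
      induction s using TensorProduct.induction_on with
      | zero => simp
      | add a b ha hb => simp only [smul_add, map_add, TensorProduct.tmul_add, ha, hb]
      | tmul c d => simp [TensorProduct.smul_tmul']
  rw [ract_apply, key, Coalgebra.coassoc_symm_apply, ← LinearMap.comp_apply,
    ← LinearMap.rTensor_comp]
  rfl

theorem lact_mul (h k : WithConv (A →ₗ[ℂ] ℂ)) (x : A) : lact (h * k) x = lact h (lact k x) := by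
  have e : (h * k).ofConv = h.ofConv ∘ₗ lact k := LinearMap.ext (conv_apply_lact h k)
  rw [lact_apply h, comul_lact, lact_apply, e, LinearMap.lTensor_comp, LinearMap.comp_apply]

theorem ract_mul (h k : WithConv (A →ₗ[ℂ] ℂ)) (x : A) : ract (h * k) x = ract k (ract h x) := by
  have e : (h * k).ofConv = k.ofConv ∘ₗ ract h := LinearMap.ext (conv_apply_ract h k)
  rw [ract_apply k, comul_ract, ract_apply, e, LinearMap.rTensor_comp, LinearMap.comp_apply]

theorem lact_ract (h k : WithConv (A →ₗ[ℂ] ℂ)) (x : A) : lact h (ract k x) = ract k (lact h x) := by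
  rw [ract_apply, ract_apply, comul_lact]
  generalize Coalgebra.comul (R := ℂ) x = s
  induction s using TensorProduct.induction_on with
  | zero => simp
  | add a b ha hb => simp only [map_add, ha, hb]
  | tmul c d => simp

theorem lact_apply_mul {ι : Type*} [Fintype ι] {h : WithConv (A →ₗ[ℂ] ℂ)}
    {a b : ι → WithConv (A →ₗ[ℂ] ℂ)} (hab : ∀ x y, h (x * y) = ∑ s, a s x * b s y) (x y : A) :
    lact h (x * y) = ∑ s, lact (a s) x * lact (b s) y := by
  simp only [lact_apply, Bialgebra.comul_mul]
  generalize Coalgebra.comul (R := ℂ) x = s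
  generalize Coalgebra.comul (R := ℂ) y = t
  induction s using TensorProduct.induction_on with
  | zero => simp
  | add p q hp hq => simp only [add_mul, map_add, hp, hq, Finset.sum_add_distrib]
  | tmul p q =>
    induction t using TensorProduct.induction_on with
    | zero => simp
    | add p q hp hq => simp only [mul_add, map_add, hp, hq, Finset.sum_add_distrib]
    | tmul u v => simp [hab, Finset.sum_smul, smul_smul, mul_comm]

theorem ract_apply_mul {ι : Type*} [Fintype ι] {h : WithConv (A →ₗ[ℂ] ℂ)}
    {a b : ι → WithConv (A →ₗ[ℂ] ℂ)} (hab : ∀ x y, h (x * y) = ∑ s, a s x * b s y) (x y : A) :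
    ract h (x * y) = ∑ s, ract (a s) x * ract (b s) y := by
  simp only [ract_apply, Bialgebra.comul_mul]
  generalize Coalgebra.comul (R := ℂ) x = s
  generalize Coalgebra.comul (R := ℂ) y = t
  induction s using TensorProduct.induction_on with
  | zero => simp
  | add p q hp hq => simp only [add_mul, map_add, hp, hq, Finset.sum_add_distrib]
  | tmul p q =>
    induction t using TensorProduct.induction_on with
    | zero => simp
    | add p q hp hq => simp only [mul_add, map_add, hp, hq, Finset.sum_add_distrib]
    | tmul u v => simp [hab, Finset.sum_smul, smul_smul, mul_comm]

/-- The functional `x ↦ h (x y)`. -/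
def rtrans : A →ₗ[ℂ] WithConv (A →ₗ[ℂ] ℂ) →ₗ[ℂ] WithConv (A →ₗ[ℂ] ℂ) :=
  LinearMap.mk₂ ℂ (fun y h => toConv (h.ofConv ∘ₗ LinearMap.mulRight ℂ y))
    (fun y z h => by ext; simp [mul_add]) (fun c y h => by ext; simp)
    (fun y h k => by ext; simp) (fun c y h => by ext; simp)

/-- The functional `x ↦ h (y x)`. -/
def ltrans : A →ₗ[ℂ] WithConv (A →ₗ[ℂ] ℂ) →ₗ[ℂ] WithConv (A →ₗ[ℂ] ℂ) :=
  LinearMap.mk₂ ℂ (fun y h => toConv (h.ofConv ∘ₗ LinearMap.mulLeft ℂ y))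
    (fun y z h => by ext; simp [add_mul]) (fun c y h => by ext; simp)
    (fun y h k => by ext; simp) (fun c y h => by ext; simp)

@[simp] theorem rtrans_apply (y : A) (h : WithConv (A →ₗ[ℂ] ℂ)) (x : A) :
    rtrans y h x = h (x * y) := rfl

@[simp] theorem ltrans_apply (y : A) (h : WithConv (A →ₗ[ℂ] ℂ)) (x : A) :
    ltrans y h x = h (y * x) := rfl

theorem conv_ext {h k : WithConv (A →ₗ[ℂ] ℂ)} (e : ∀ x, h x = k x) : h = k :=
  WithConv.ext (LinearMap.ext e)

/-! #### The antipode -/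

/-- In the convolution algebra `Hom(A, A ⊗ A)` the map `(S ⊗ S) ∘ flip ∘ Δ` is a left inverse of
`Δ`, and `Δ ∘ S` is a right inverse; so they agree. -/
theorem comul_antipode (x : A) :
    Coalgebra.comul (HopfAlgebra.antipode ℂ x) =
      TensorProduct.map (HopfAlgebra.antipode ℂ) (HopfAlgebra.antipode ℂ)
        (TensorProduct.comm ℂ A A (Coalgebra.comul (R := ℂ) x)) := by
  let Φ : A →ₗ[ℂ] A ⊗[ℂ] A :=
    TensorProduct.map (HopfAlgebra.antipode ℂ) (HopfAlgebra.antipode ℂ) ∘ₗ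
      (TensorProduct.comm ℂ A A).toLinearMap ∘ₗ Coalgebra.comul
  let S : A →ₗ[ℂ] A := HopfAlgebra.antipode ℂ
  let m (a : A) : A ⊗[ℂ] A →ₗ[ℂ] A ⊗[ℂ] A :=
    LinearMap.mul' ℂ (A ⊗[ℂ] A) ∘ₗ
      TensorProduct.map ((TensorProduct.mk ℂ A A).flip (S a) ∘ₗ S) Coalgebra.comul
  -- `M` sends `a ⊗ b ⊗ c` to `(S b ⊗ S a) Δ(c)`; the convolution product of `Φ` with `Δ` is `M`
  -- after the twofold coproduct, and coassociativity lets the last two legs be contracted first.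
  let M : A ⊗[ℂ] (A ⊗[ℂ] A) →ₗ[ℂ] A ⊗[ℂ] A := TensorProduct.lift
    { toFun := m
      map_add' := fun a b => by ext; simp [m, add_mul]
      map_smul' := fun c a => by ext; simp [m] }
  have hM (a b c : A) : M (a ⊗ₜ (b ⊗ₜ c)) = (S b ⊗ₜ S a) * Coalgebra.comul (R := ℂ) c := rfl
  have h1 (a c : A) : Φ a * Coalgebra.comul (R := ℂ) c =
      M (TensorProduct.assoc ℂ A A A (Coalgebra.comul (R := ℂ) a ⊗ₜ c)) := by
    simp only [Φ, LinearMap.comp_apply]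
    generalize Coalgebra.comul (R := ℂ) a = s
    induction s using TensorProduct.induction_on with
    | zero => simp
    | add p q hp hq => simp only [map_add, add_mul, TensorProduct.add_tmul, hp, hq]
    | tmul p q => simp [hM, S]
  let n (a : A) : A ⊗[ℂ] (A ⊗[ℂ] A) →ₗ[ℂ] A ⊗[ℂ] A :=
    TensorProduct.map (LinearMap.mul' ℂ A ∘ₗ S.rTensor A) (LinearMap.mulLeft ℂ (S a)) ∘ₗ
      (TensorProduct.assoc ℂ A A A).symm.toLinearMap
  -- Here `(S y₁ ⊗ S a) Δ(y₂) = S(y₁) y₂ ⊗ S(a) y₃`, and the first factor collapses by the antipode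
  -- axiom.
  have h2 (a y : A) : M (a ⊗ₜ Coalgebra.comul (R := ℂ) y) = 1 ⊗ₜ (S a * y) := by
    have e1 : ∀ t : A ⊗[ℂ] A, M (a ⊗ₜ t) = n a (Coalgebra.comul.lTensor A t) := by
      intro t
      induction t using TensorProduct.induction_on with
      | zero => simp
      | add p q hp hq => simp only [map_add, TensorProduct.tmul_add, hp, hq]
      | tmul p q =>
        rw [hM, LinearMap.lTensor_tmul]
        generalize Coalgebra.comul (R := ℂ) q = s
        induction s using TensorProduct.induction_on with
        | zero => simp
        | add p q hp hq => simp only [map_add, mul_add, TensorProduct.tmul_add, hp, hq]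
        | tmul u v => simp [n]
    have e2 : ∀ t : A ⊗[ℂ] A,
        n a (TensorProduct.assoc ℂ A A A (Coalgebra.comul.rTensor A t)) =
          1 ⊗ₜ (S a * TensorProduct.lid ℂ A (Coalgebra.counit.rTensor A t)) := by
      intro t
      induction t using TensorProduct.induction_on with
      | zero => simp
      | add p q hp hq => simp only [map_add, mul_add, TensorProduct.tmul_add, hp, hq]
      | tmul p q =>
        simp only [n, LinearMap.rTensor_tmul, LinearMap.comp_apply, LinearEquiv.coe_coe,
          LinearEquiv.symm_apply_apply, TensorProduct.map_tmul, S,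
          HopfAlgebra.mul_antipode_rTensor_comul_apply, TensorProduct.lid_tmul]
        simp [Algebra.algebraMap_eq_smul_one, TensorProduct.smul_tmul']
    rw [e1, ← Coalgebra.coassoc_apply, e2]
    simp
  have hl : toConv Φ * toConv (Coalgebra.comul : A →ₗ[ℂ] A ⊗[ℂ] A) = 1 := by
    refine WithConv.ext (LinearMap.ext fun y => ?_)
    have e1 : ∀ t : A ⊗[ℂ] A, LinearMap.mul' ℂ (A ⊗[ℂ] A)
        (TensorProduct.map Φ Coalgebra.comul t) =
        M (TensorProduct.assoc ℂ A A A (Coalgebra.comul.rTensor A t)) := by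
      intro t
      induction t using TensorProduct.induction_on with
      | zero => simp
      | add p q hp hq => simp only [map_add, hp, hq]
      | tmul p q => simp [h1]
    have e2 : ∀ t : A ⊗[ℂ] A, M (Coalgebra.comul.lTensor A t) =
        1 ⊗ₜ LinearMap.mul' ℂ A (S.rTensor A t) := by
      intro t
      induction t using TensorProduct.induction_on with
      | zero => simp
      | add p q hp hq => simp only [map_add, TensorProduct.tmul_add, hp, hq]
      | tmul p q => simp [h2]
    change LinearMap.mul' ℂ (A ⊗[ℂ] A) (TensorProduct.map Φ Coalgebra.comul
      (Coalgebra.comul y)) = algebraMap ℂ _ (Coalgebra.counit y)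
    rw [e1, Coalgebra.coassoc_apply, e2, HopfAlgebra.mul_antipode_rTensor_comul_apply]
    simp [Algebra.algebraMap_eq_smul_one, Algebra.TensorProduct.one_def]
  have := left_inv_eq_right_inv hl (LinearMap.comul_right_inv (R := ℂ) (C := A))
  exact (LinearMap.congr_fun (congrArg WithConv.ofConv this) x).symm

end Functionals

end QuantumCartan
end

noncomputable section

set_option linter.unusedSectionVars false

namespace QuantumCartan

/-! ### The antipode and its inverse on functionals. -/

section DualAntipode

variable {A : Type*} [Ring A] [HopfAlgebra ℂ A]

/-- An anti-coalgebra map induces an anti-homomorphism of convolution algebras. -/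
theorem conv_mul_comp_anticoalg (T : A →ₗ[ℂ] A)
    (hT : ∀ x, Coalgebra.comul (T x) =
      TensorProduct.map T T (TensorProduct.comm ℂ A A (Coalgebra.comul (R := ℂ) x)))
    (h k : WithConv (A →ₗ[ℂ] ℂ)) :
    toConv ((h * k).ofConv ∘ₗ T) = toConv (k.ofConv ∘ₗ T) * toConv (h.ofConv ∘ₗ T) := by
  refine conv_ext fun x => ?_
  change LinearMap.mul' ℂ ℂ (TensorProduct.map h.ofConv k.ofConv (Coalgebra.comul (T x))) =
    LinearMap.mul' ℂ ℂ (TensorProduct.map (k.ofConv ∘ₗ T) (h.ofConv ∘ₗ T) (Coalgebra.comul x))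
  rw [hT]
  generalize Coalgebra.comul (R := ℂ) x = s
  induction s using TensorProduct.induction_on with
  | zero => simp
  | add a b ha hb => simp only [map_add, ha, hb]
  | tmul c d => simp [mul_comm]

variable (hS : Function.Bijective (HopfAlgebra.antipode ℂ : A →ₗ[ℂ] A))

@[simp] theorem antipode_antipodeInv (x : A) : HopfAlgebra.antipode ℂ (antipodeInv hS x) = x :=
  (LinearEquiv.ofBijective (HopfAlgebra.antipode ℂ : A →ₗ[ℂ] A) hS).apply_symm_apply x

@[simp] theorem antipodeInv_antipode (x : A) : antipodeInv hS (HopfAlgebra.antipode ℂ x) = x :=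
  (LinearEquiv.ofBijective (HopfAlgebra.antipode ℂ : A →ₗ[ℂ] A) hS).symm_apply_apply x

theorem antipodeInv_mul (x y : A) :
    antipodeInv hS (x * y) = antipodeInv hS y * antipodeInv hS x := by
  apply hS.1
  rw [HopfAlgebra.antipode_mul_antidistrib]
  simp

@[simp] theorem antipodeInv_one : antipodeInv hS (1 : A) = 1 := by
  apply hS.1
  simp

@[simp] theorem counit_antipodeInv (x : A) :
    Coalgebra.counit (R := ℂ) (antipodeInv hS x) = Coalgebra.counit x := by
  rw [← HopfAlgebra.counit_antipode, antipode_antipodeInv]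

theorem comul_antipodeInv (x : A) :
    Coalgebra.comul (antipodeInv hS x) =
      TensorProduct.map (antipodeInv hS) (antipodeInv hS)
        (TensorProduct.comm ℂ A A (Coalgebra.comul (R := ℂ) x)) := by
  have key : ∀ t : A ⊗[ℂ] A, TensorProduct.map (antipodeInv hS) (antipodeInv hS)
      (TensorProduct.comm ℂ A A (TensorProduct.map (HopfAlgebra.antipode ℂ)
        (HopfAlgebra.antipode ℂ) (TensorProduct.comm ℂ A A t))) = t := by
    intro t
    induction t using TensorProduct.induction_on with
    | zero => simp
    | add a b ha hb => simp only [map_add, ha, hb]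
    | tmul c d => simp
  conv_rhs => rw [← antipode_antipodeInv hS x, comul_antipode, key]

/-- The map `h ↦ h ∘ S` on functionals. -/
def dualS : WithConv (A →ₗ[ℂ] ℂ) →ₗ[ℂ] WithConv (A →ₗ[ℂ] ℂ) where
  toFun h := toConv (h.ofConv ∘ₗ HopfAlgebra.antipode ℂ)
  map_add' _ _ := rfl
  map_smul' _ _ := rfl

/-- The map `h ↦ h ∘ S⁻¹` on functionals. -/
def dualSInv : WithConv (A →ₗ[ℂ] ℂ) →ₗ[ℂ] WithConv (A →ₗ[ℂ] ℂ) where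
  toFun h := toConv (h.ofConv ∘ₗ antipodeInv hS)
  map_add' _ _ := rfl
  map_smul' _ _ := rfl

@[simp] theorem dualS_apply (h : WithConv (A →ₗ[ℂ] ℂ)) (x : A) :
    dualS h x = h (HopfAlgebra.antipode ℂ x) := rfl

@[simp] theorem dualSInv_apply (h : WithConv (A →ₗ[ℂ] ℂ)) (x : A) :
    dualSInv hS h x = h (antipodeInv hS x) := rfl

@[simp] theorem dualSInv_dualS (h : WithConv (A →ₗ[ℂ] ℂ)) : dualSInv hS (dualS h) = h :=
  conv_ext fun x => by simp

@[simp] theorem dualS_dualSInv (h : WithConv (A →ₗ[ℂ] ℂ)) : dualS (dualSInv hS h) = h :=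
  conv_ext fun x => by simp

theorem dualS_mul (h k : WithConv (A →ₗ[ℂ] ℂ)) : dualS (h * k) = dualS k * dualS h :=
  conv_mul_comp_anticoalg _ comul_antipode h k

theorem dualSInv_mul (h k : WithConv (A →ₗ[ℂ] ℂ)) :
    dualSInv hS (h * k) = dualSInv hS k * dualSInv hS h :=
  conv_mul_comp_anticoalg _ (comul_antipodeInv hS) h k

@[simp] theorem dualS_one : dualS (1 : WithConv (A →ₗ[ℂ] ℂ)) = 1 :=
  conv_ext fun x => by simp

@[simp] theorem dualSInv_one : dualSInv hS (1 : WithConv (A →ₗ[ℂ] ℂ)) = 1 :=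
  conv_ext fun x => by simp

/-- Matrices of functionals that are multiplicative are inverted by the antipode. -/
theorem sum_mul_dualS {ι : Type*} [Fintype ι] [DecidableEq ι]
    {f : ι → ι → WithConv (A →ₗ[ℂ] ℂ)} (hf : ∀ i j x y, f i j (x * y) = ∑ k, f i k x * f k j y)
    (hf1 : ∀ i j, f i j 1 = if i = j then 1 else 0) (i j : ι) :
    ∑ k, f i k * dualS (f k j) = if i = j then 1 else 0 := by
  refine conv_ext fun x => ?_
  have : ∀ t : A ⊗[ℂ] A, ∑ k, LinearMap.mul' ℂ ℂ (TensorProduct.map (f i k).ofConv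
      ((dualS (f k j)).ofConv) t) =
      f i j (LinearMap.mul' ℂ A ((HopfAlgebra.antipode ℂ).lTensor A t)) := by
    intro t
    induction t using TensorProduct.induction_on with
    | zero => simp
    | add a b ha hb => simp only [map_add, Finset.sum_add_distrib, ha, hb]
    | tmul c d => simp [hf]
  have h2 := this (Coalgebra.comul x)
  rw [HopfAlgebra.mul_antipode_lTensor_comul_apply, Algebra.algebraMap_eq_smul_one, map_smul,
    hf1] at h2
  have h3 : (∑ k, f i k * dualS (f k j)) x = ∑ k, (f i k * dualS (f k j)) x := by
    simp
  rw [h3]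
  refine h2.trans ?_
  split_ifs <;> simp

theorem sum_dualS_mul {ι : Type*} [Fintype ι] [DecidableEq ι]
    {f : ι → ι → WithConv (A →ₗ[ℂ] ℂ)} (hf : ∀ i j x y, f i j (x * y) = ∑ k, f i k x * f k j y)
    (hf1 : ∀ i j, f i j 1 = if i = j then 1 else 0) (i j : ι) :
    ∑ k, dualS (f i k) * f k j = if i = j then 1 else 0 := by
  refine conv_ext fun x => ?_
  have : ∀ t : A ⊗[ℂ] A, ∑ k, LinearMap.mul' ℂ ℂ (TensorProduct.map (dualS (f i k)).ofConv
      ((f k j).ofConv) t) =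
      f i j (LinearMap.mul' ℂ A ((HopfAlgebra.antipode ℂ).rTensor A t)) := by
    intro t
    induction t using TensorProduct.induction_on with
    | zero => simp
    | add a b ha hb => simp only [map_add, Finset.sum_add_distrib, ha, hb]
    | tmul c d => simp [hf]
  have h2 := this (Coalgebra.comul x)
  rw [HopfAlgebra.mul_antipode_rTensor_comul_apply, Algebra.algebraMap_eq_smul_one, map_smul,
    hf1] at h2
  have h3 : (∑ k, dualS (f i k) * f k j) x = ∑ k, (dualS (f i k) * f k j) x := by
    simp
  rw [h3]
  refine h2.trans ?_
  split_ifs <;> simp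

/-- `S⁻¹` reverses products, so applying it to `∑ f_{ik} S(f_{kj}) = δ_{ij}` gives an inverse of `f`
for the matrix product with the factors in the opposite order. -/
theorem sum_mul_dualSInv {ι : Type*} [Fintype ι] [DecidableEq ι]
    {f : ι → ι → WithConv (A →ₗ[ℂ] ℂ)} (hf : ∀ i j x y, f i j (x * y) = ∑ k, f i k x * f k j y)
    (hf1 : ∀ i j, f i j 1 = if i = j then 1 else 0) (i j : ι) :
    ∑ k, f k j * dualSInv hS (f i k) = if i = j then 1 else 0 := by
  have := congrArg (dualSInv hS) (sum_mul_dualS hf hf1 i j)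
  rw [map_sum] at this
  simp only [dualSInv_mul, dualSInv_dualS] at this
  rw [this]
  split_ifs <;> simp

theorem sum_dualSInv_mul {ι : Type*} [Fintype ι] [DecidableEq ι]
    {f : ι → ι → WithConv (A →ₗ[ℂ] ℂ)} (hf : ∀ i j x y, f i j (x * y) = ∑ k, f i k x * f k j y)
    (hf1 : ∀ i j, f i j 1 = if i = j then 1 else 0) (i j : ι) :
    ∑ k, dualSInv hS (f k j) * f i k = if i = j then 1 else 0 := by
  have := congrArg (dualSInv hS) (sum_dualS_mul hf hf1 i j)
  rw [map_sum] at this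
  simp only [dualSInv_mul, dualSInv_dualS] at this
  rw [this]
  split_ifs <;> simp

end DualAntipode

/-! ### Compatibility of the two coactions with the bimodule structure. -/

namespace BicovariantCalculus

variable {A : Type*} [Ring A] [HopfAlgebra ℂ A]
  {Γ : Type*} [AddCommGroup Γ] [Module ℂ Γ] [Module A Γ] [Module Aᵐᵒᵖ Γ]
  [SMulCommClass A Aᵐᵒᵖ Γ] [IsScalarTower ℂ A Γ] [IsScalarTower ℂ Aᵐᵒᵖ Γ]

theorem smulTensor_tmul (a b c : A) (ρ : Γ) :
    smulTensor A Γ (a ⊗ₜ b) (c ⊗ₜ ρ) = (a * c) ⊗ₜ (b • ρ) := rfl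

theorem smulTensor'_tmul (a b c : A) (ρ : Γ) :
    smulTensor' A Γ (a ⊗ₜ b) (ρ ⊗ₜ c) = (a • ρ) ⊗ₜ (b * c) := rfl

theorem smulTensor_mul (s t : A ⊗[ℂ] A) (r : A ⊗[ℂ] Γ) :
    smulTensor A Γ (s * t) r = smulTensor A Γ s (smulTensor A Γ t r) := by
  induction s using TensorProduct.induction_on with
  | zero => simp
  | add p q hp hq => simp only [add_mul, map_add, LinearMap.add_apply, hp, hq]
  | tmul a b =>
    induction t using TensorProduct.induction_on with
    | zero => simp
    | add p q hp hq => simp only [mul_add, map_add, LinearMap.add_apply, hp, hq]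
    | tmul c d =>
      induction r using TensorProduct.induction_on with
      | zero => simp
      | add p q hp hq => simp only [map_add, hp, hq]
      | tmul e ρ => simp [smulTensor_tmul, mul_assoc, mul_smul]

theorem smulTensor'_mul (s t : A ⊗[ℂ] A) (r : Γ ⊗[ℂ] A) :
    smulTensor' A Γ (s * t) r = smulTensor' A Γ s (smulTensor' A Γ t r) := by
  induction s using TensorProduct.induction_on with
  | zero => simp
  | add p q hp hq => simp only [add_mul, map_add, LinearMap.add_apply, hp, hq]
  | tmul a b =>
    induction t using TensorProduct.induction_on with
    | zero => simp
    | add p q hp hq => simp only [mul_add, map_add, LinearMap.add_apply, hp, hq]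
    | tmul c d =>
      induction r using TensorProduct.induction_on with
      | zero => simp
      | add p q hp hq => simp only [map_add, hp, hq]
      | tmul e ρ => simp [smulTensor'_tmul, mul_assoc, mul_smul]

theorem smulTensor_one (r : A ⊗[ℂ] Γ) : smulTensor A Γ 1 r = r := by
  rw [Algebra.TensorProduct.one_def]
  induction r using TensorProduct.induction_on with
  | zero => simp
  | add p q hp hq => simp only [map_add, hp, hq]
  | tmul e ρ => simp [smulTensor_tmul]

theorem smulTensor'_one (r : Γ ⊗[ℂ] A) : smulTensor' A Γ 1 r = r := by
  rw [Algebra.TensorProduct.one_def]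
  induction r using TensorProduct.induction_on with
  | zero => simp
  | add p q hp hq => simp only [map_add, hp, hq]
  | tmul e ρ => simp [smulTensor'_tmul]

/-- Right multiplication by a ring element, as a map bilinear over `ℂ`. -/
def opLsmul (A Γ : Type*) [Ring A] [Algebra ℂ A] [AddCommGroup Γ] [Module ℂ Γ]
    [Module Aᵐᵒᵖ Γ] [IsScalarTower ℂ Aᵐᵒᵖ Γ] : A →ₗ[ℂ] Γ →ₗ[ℂ] Γ :=
  (Algebra.lsmul ℂ ℂ Γ).toLinearMap ∘ₗ (opLinearEquiv ℂ : A ≃ₗ[ℂ] Aᵐᵒᵖ).toLinearMap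

@[simp] theorem opLsmul_apply (a : A) (ρ : Γ) : opLsmul A Γ a ρ = op a • ρ := rfl

/-- The map `(a ⊗ b) ⊗ (c ⊗ ρ) ↦ c a ⊗ ρ b`. -/
def opTensor (A Γ : Type*) [Ring A] [Algebra ℂ A] [AddCommGroup Γ] [Module ℂ Γ]
    [Module Aᵐᵒᵖ Γ] [IsScalarTower ℂ Aᵐᵒᵖ Γ] : A ⊗[ℂ] A →ₗ[ℂ] A ⊗[ℂ] Γ →ₗ[ℂ] A ⊗[ℂ] Γ :=
  TensorProduct.map₂ (LinearMap.mul ℂ A).flip (opLsmul A Γ)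

/-- The map `(a ⊗ b) ⊗ (ρ ⊗ c) ↦ ρ a ⊗ c b`. -/
def opTensor' (A Γ : Type*) [Ring A] [Algebra ℂ A] [AddCommGroup Γ] [Module ℂ Γ]
    [Module Aᵐᵒᵖ Γ] [IsScalarTower ℂ Aᵐᵒᵖ Γ] : A ⊗[ℂ] A →ₗ[ℂ] Γ ⊗[ℂ] A →ₗ[ℂ] Γ ⊗[ℂ] A :=
  TensorProduct.map₂ (opLsmul A Γ) (LinearMap.mul ℂ A).flip

theorem opTensor_tmul (a b c : A) (ρ : Γ) :
    opTensor A Γ (a ⊗ₜ b) (c ⊗ₜ ρ) = (c * a) ⊗ₜ (op b • ρ) := rfl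

theorem opTensor'_tmul (a b c : A) (ρ : Γ) :
    opTensor' A Γ (a ⊗ₜ b) (ρ ⊗ₜ c) = (op a • ρ) ⊗ₜ (c * b) := rfl

theorem opTensor_smulTensor (s t : A ⊗[ℂ] A) (r : A ⊗[ℂ] Γ) :
    opTensor A Γ t (smulTensor A Γ s r) = smulTensor A Γ s (opTensor A Γ t r) := by
  induction s using TensorProduct.induction_on with
  | zero => simp
  | add p q hp hq => simp only [map_add, LinearMap.add_apply, hp, hq]
  | tmul a b =>
    induction t using TensorProduct.induction_on with
    | zero => simp
    | add p q hp hq => simp only [map_add, LinearMap.add_apply, hp, hq]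
    | tmul c d =>
      induction r using TensorProduct.induction_on with
      | zero => simp
      | add p q hp hq => simp only [map_add, hp, hq]
      | tmul e ρ => simp [smulTensor_tmul, opTensor_tmul, mul_assoc, smul_comm]

theorem opTensor'_smulTensor' (s t : A ⊗[ℂ] A) (r : Γ ⊗[ℂ] A) :
    opTensor' A Γ t (smulTensor' A Γ s r) = smulTensor' A Γ s (opTensor' A Γ t r) := by
  induction s using TensorProduct.induction_on with
  | zero => simp
  | add p q hp hq => simp only [map_add, LinearMap.add_apply, hp, hq]
  | tmul a b =>
    induction t using TensorProduct.induction_on with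
    | zero => simp
    | add p q hp hq => simp only [map_add, LinearMap.add_apply, hp, hq]
    | tmul c d =>
      induction r using TensorProduct.induction_on with
      | zero => simp
      | add p q hp hq => simp only [map_add, hp, hq]
      | tmul e ρ => simp [smulTensor'_tmul, opTensor'_tmul, mul_assoc, smul_comm]

variable (𝒞 : BicovariantCalculus A Γ)

/-- One-forms are sums of the forms `x dy`. -/
theorem form_induction {p : Γ → Prop} (h0 : p 0) (hadd : ∀ ρ τ, p ρ → p τ → p (ρ + τ))
    (hd : ∀ x y : A, p (x • 𝒞.d y)) (ρ : Γ) : p ρ := by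
  have hρ : ρ ∈ Submodule.span A (Set.range 𝒞.d) := by rw [𝒞.span_range_d]; trivial
  have key : ∀ x : A, p (x • ρ) := by
    induction hρ using Submodule.span_induction with
    | mem _ h => obtain ⟨y, rfl⟩ := h; exact fun x => hd x y
    | zero => simpa using h0
    | add a b _ _ ha hb => intro x; rw [smul_add]; exact hadd _ _ (ha x) (hb x)
    | smul a b _ hb => intro x; rw [smul_smul]; exact hb _
  simpa using key 1

theorem coactL_d (y : A) : 𝒞.coactL (𝒞.d y) = 𝒞.d.lTensor A (Coalgebra.comul y) := by
  have := 𝒞.coactL_smul_d 1 y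
  rwa [one_smul, Bialgebra.comul_one, smulTensor_one] at this

theorem coactR_d (y : A) : 𝒞.coactR (𝒞.d y) = 𝒞.d.rTensor A (Coalgebra.comul y) := by
  have := 𝒞.coactR_smul_d 1 y
  rwa [one_smul, Bialgebra.comul_one, smulTensor'_one] at this

theorem coactL_smul (a : A) (ρ : Γ) :
    𝒞.coactL (a • ρ) = smulTensor A Γ (Coalgebra.comul a) (𝒞.coactL ρ) := by
  induction ρ using 𝒞.form_induction with
  | h0 => simp
  | hadd ρ τ h1 h2 => simp only [smul_add, map_add, h1, h2]
  | hd x y => rw [smul_smul, coactL_smul_d, coactL_smul_d, Bialgebra.comul_mul, smulTensor_mul]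

theorem coactR_smul (a : A) (ρ : Γ) :
    𝒞.coactR (a • ρ) = smulTensor' A Γ (Coalgebra.comul a) (𝒞.coactR ρ) := by
  induction ρ using 𝒞.form_induction with
  | h0 => simp
  | hadd ρ τ h1 h2 => simp only [smul_add, map_add, h1, h2]
  | hd x y => rw [smul_smul, coactR_smul_d, coactR_smul_d, Bialgebra.comul_mul, smulTensor'_mul]

theorem lTensor_d_mul (s t : A ⊗[ℂ] A) : 𝒞.d.lTensor A (s * t) =
    opTensor A Γ t (𝒞.d.lTensor A s) + smulTensor A Γ s (𝒞.d.lTensor A t) := by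
  induction s using TensorProduct.induction_on with
  | zero => simp
  | add p q hp hq => simp only [add_mul, map_add, LinearMap.add_apply, hp, hq]; abel
  | tmul a b =>
    induction t using TensorProduct.induction_on with
    | zero => simp
    | add p q hp hq => simp only [mul_add, map_add, LinearMap.add_apply, hp, hq]; abel
    | tmul c e =>
      simp [smulTensor_tmul, opTensor_tmul, 𝒞.leibniz, TensorProduct.tmul_add]

theorem rTensor_d_mul (s t : A ⊗[ℂ] A) : 𝒞.d.rTensor A (s * t) =
    opTensor' A Γ t (𝒞.d.rTensor A s) + smulTensor' A Γ s (𝒞.d.rTensor A t) := by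
  induction s using TensorProduct.induction_on with
  | zero => simp
  | add p q hp hq => simp only [add_mul, map_add, LinearMap.add_apply, hp, hq]; abel
  | tmul a b =>
    induction t using TensorProduct.induction_on with
    | zero => simp
    | add p q hp hq => simp only [mul_add, map_add, LinearMap.add_apply, hp, hq]; abel
    | tmul c e =>
      simp [smulTensor'_tmul, opTensor'_tmul, 𝒞.leibniz, TensorProduct.add_tmul]

theorem op_smul_d (x y : A) : op y • 𝒞.d x = 𝒞.d (x * y) - x • 𝒞.d y := by
  rw [𝒞.leibniz]; abel

/-- Covariance under right multiplication is not an axiom: it follows from the rule for `x dy`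
because `(dx) y = d(xy) - x dy`. -/
theorem coactL_op_smul (a : A) (ρ : Γ) :
    𝒞.coactL (op a • ρ) = opTensor A Γ (Coalgebra.comul a) (𝒞.coactL ρ) := by
  induction ρ using 𝒞.form_induction with
  | h0 => simp
  | hadd ρ τ h1 h2 => simp only [smul_add, map_add, h1, h2]
  | hd x y =>
    rw [← smul_comm x (op a), coactL_smul, coactL_smul, opTensor_smulTensor, op_smul_d, map_sub, coactL_smul,
      coactL_d, coactL_d, coactL_d, Bialgebra.comul_mul, lTensor_d_mul, add_sub_cancel_right]

theorem coactR_op_smul (a : A) (ρ : Γ) :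
    𝒞.coactR (op a • ρ) = opTensor' A Γ (Coalgebra.comul a) (𝒞.coactR ρ) := by
  induction ρ using 𝒞.form_induction with
  | h0 => simp
  | hadd ρ τ h1 h2 => simp only [smul_add, map_add, h1, h2]
  | hd x y =>
    rw [← smul_comm x (op a), coactR_smul, coactR_smul, opTensor'_smulTensor', op_smul_d, map_sub,
      coactR_smul, coactR_d, coactR_d, coactR_d, Bialgebra.comul_mul, rTensor_d_mul,
      add_sub_cancel_right]

/-- The left and right coactions commute. -/
theorem coactL_coactR (ρ : Γ) :
    TensorProduct.assoc ℂ A Γ A (𝒞.coactL.rTensor A (𝒞.coactR ρ)) =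
      𝒞.coactR.lTensor A (𝒞.coactL ρ) := by
  -- On `x dy` both sides are the same bilinear expression `F` in the twofold coproducts of `x` and
  -- `y`, bracketed differently; what remains is coassociativity.
  let G : A ⊗[ℂ] A →ₗ[ℂ] A ⊗[ℂ] A →ₗ[ℂ] Γ ⊗[ℂ] A := (smulTensor' A Γ).compl₂ (𝒞.d.rTensor A)
  let F : A ⊗[ℂ] (A ⊗[ℂ] A) →ₗ[ℂ] A ⊗[ℂ] (A ⊗[ℂ] A) →ₗ[ℂ] A ⊗[ℂ] (Γ ⊗[ℂ] A) :=
    TensorProduct.map₂ (LinearMap.mul ℂ A) G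
  have hr : ∀ s t : A ⊗[ℂ] A, 𝒞.coactR.lTensor A (smulTensor A Γ s (𝒞.d.lTensor A t)) =
      F (Coalgebra.comul.lTensor A s) (Coalgebra.comul.lTensor A t) := by
    intro s t
    induction s using TensorProduct.induction_on with
    | zero => simp
    | add p q hp hq => simp only [map_add, LinearMap.add_apply, hp, hq]
    | tmul a b =>
      induction t using TensorProduct.induction_on with
      | zero => simp
      | add p q hp hq => simp only [map_add, hp, hq]
      | tmul c e =>
        simp [smulTensor_tmul, coactR_smul_d, F, G]
  have hl : ∀ s t : A ⊗[ℂ] A, TensorProduct.assoc ℂ A Γ A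
      (𝒞.coactL.rTensor A (smulTensor' A Γ s (𝒞.d.rTensor A t))) =
      F (TensorProduct.assoc ℂ A A A (Coalgebra.comul.rTensor A s))
        (TensorProduct.assoc ℂ A A A (Coalgebra.comul.rTensor A t)) := by
    intro s t
    induction s using TensorProduct.induction_on with
    | zero => simp
    | add p q hp hq => simp only [map_add, LinearMap.add_apply, hp, hq]
    | tmul a b =>
      induction t using TensorProduct.induction_on with
      | zero => simp
      | add p q hp hq => simp only [map_add, hp, hq]
      | tmul c e =>
        simp only [smulTensor'_tmul, coactL_smul_d, LinearMap.rTensor_tmul]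
        generalize Coalgebra.comul (R := ℂ) a = u
        generalize Coalgebra.comul (R := ℂ) c = v
        induction u using TensorProduct.induction_on with
        | zero => simp
        | add p q hp hq =>
          simp only [map_add, LinearMap.add_apply, TensorProduct.add_tmul, hp, hq]
        | tmul a1 a2 =>
          induction v using TensorProduct.induction_on with
          | zero => simp
          | add p q hp hq => simp only [map_add, TensorProduct.add_tmul, hp, hq]
          | tmul c1 c2 => simp [smulTensor_tmul, F, G, smulTensor'_tmul]
  induction ρ using 𝒞.form_induction with
  | h0 => simp
  | hadd ρ τ h1 h2 => simp only [map_add, h1, h2]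
  | hd x y =>
    rw [coactR_smul_d, coactL_smul_d, hl, hr, Coalgebra.coassoc_apply, Coalgebra.coassoc_apply]

end BicovariantCalculus

end QuantumCartan
end

/-! ### Coordinates: `X`, `f`, `J`, and the right invariant basis `η`. -/

noncomputable section

set_option linter.unusedSectionVars false

namespace QuantumCartan

namespace BicovariantCalculus

variable {A : Type*} [Ring A] [HopfAlgebra ℂ A]
  {Γ : Type*} [AddCommGroup Γ] [Module ℂ Γ] [Module A Γ] [Module Aᵐᵒᵖ Γ]
  [SMulCommClass A Aᵐᵒᵖ Γ] [IsScalarTower ℂ A Γ] [IsScalarTower ℂ Aᵐᵒᵖ Γ]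
  (𝒞 : BicovariantCalculus A Γ) {N : ℕ} (ω : Module.Basis (Fin N) A Γ)

/-- The functional `Xᵢ` in the convolution algebra. -/
def Xc (i : Fin N) : WithConv (A →ₗ[ℂ] ℂ) := toConv (𝒞.tangent ω i)

/-- The functional `f_{ij}` in the convolution algebra. -/
def fc (i j : Fin N) : WithConv (A →ₗ[ℂ] ℂ) := toConv (𝒞.fFun ω i j)

theorem coordCounit_apply (i : Fin N) (ρ : Γ) :
    coordCounit ω i ρ = Coalgebra.counit (R := ℂ) (ω.coord i ρ) := rfl

theorem Xc_apply (i : Fin N) (x : A) : 𝒞.Xc ω i x = coordCounit ω i (𝒞.d x) := rfl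

theorem fc_apply (i j : Fin N) (x : A) : 𝒞.fc ω i j x = coordCounit ω j (op x • ω i) := rfl

theorem coordCounit_smul (i : Fin N) (a : A) (ρ : Γ) :
    coordCounit ω i (a • ρ) = Coalgebra.counit (R := ℂ) a * coordCounit ω i ρ := by
  simp [coordCounit_apply, Bialgebra.counit_mul]

theorem coordCounit_basis (i j : Fin N) : coordCounit ω i (ω j) = if j = i then 1 else 0 := by
  rw [coordCounit_apply, Module.Basis.coord_apply, Module.Basis.repr_self, Finsupp.single_apply]
  split_ifs <;> simp

/-- One-forms are sums of the forms `a ωᵢ`. -/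
theorem basis_induction {p : Γ → Prop} (h0 : p 0) (hadd : ∀ ρ τ, p ρ → p τ → p (ρ + τ))
    (hb : ∀ (a : A) (i : Fin N), p (a • ω i)) (ρ : Γ) : p ρ := by
  rw [← ω.sum_repr ρ]
  exact Finset.sum_induction _ p hadd h0 fun i _ => hb _ i

variable (hω : ∀ i, 𝒞.IsLeftInvariant (ω i))

include hω in
/-- The coefficients of a one-form relative to a left invariant basis. -/
theorem coord_eq (ρ : Γ) (i : Fin N) :
    ω.coord i ρ = TensorProduct.rid ℂ A ((coordCounit ω i).lTensor A (𝒞.coactL ρ)) := by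
  induction ρ using basis_induction ω with
  | h0 => simp
  | hadd ρ τ h1 h2 => simp only [map_add, h1, h2]
  | hb a j =>
    rw [coactL_smul, hω j]
    have key : ∀ t : A ⊗[ℂ] A, TensorProduct.rid ℂ A ((coordCounit ω i).lTensor A
        (smulTensor A Γ t (1 ⊗ₜ ω j))) = (if j = i then (1 : ℂ) else 0) •
          TensorProduct.rid ℂ A (Coalgebra.counit.lTensor A t) := by
      intro t
      induction t using TensorProduct.induction_on with
      | zero => simp
      | add a b ha hb => simp only [map_add, LinearMap.add_apply, ha, hb, smul_add]
      | tmul c d =>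
        simp [smulTensor_tmul, coordCounit_smul, coordCounit_basis]
    rw [key, Coalgebra.lTensor_counit_comul, map_smul, Module.Basis.coord_apply,
      Module.Basis.repr_self, Finsupp.single_apply, TensorProduct.rid_tmul]
    split_ifs <;> simp

include hω in
theorem coord_d (x : A) (i : Fin N) : ω.coord i (𝒞.d x) = lact (𝒞.Xc ω i) x := by
  rw [𝒞.coord_eq ω hω, coactL_d, ← LinearMap.comp_apply, ← LinearMap.lTensor_comp]
  rfl

include hω in
theorem coord_op_smul (x : A) (i j : Fin N) :
    ω.coord j (op x • ω i) = lact (𝒞.fc ω i j) x := by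
  rw [𝒞.coord_eq ω hω, coactL_op_smul, hω, lact_apply]
  congr 1
  generalize Coalgebra.comul (R := ℂ) x = t
  induction t using TensorProduct.induction_on with
  | zero => simp
  | add a b ha hb => simp only [map_add, LinearMap.add_apply, ha, hb]
  | tmul c d => simp [opTensor_tmul, fc_apply]

include hω in
theorem op_smul_basis (x : A) (i : Fin N) :
    op x • ω i = ∑ j, lact (𝒞.fc ω i j) x • ω j := by
  conv_lhs => rw [← ω.sum_repr (op x • ω i)]
  exact Finset.sum_congr rfl fun j _ => by
    rw [← Module.Basis.coord_apply, 𝒞.coord_op_smul ω hω]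

include hω in
-- After the counit is applied to coordinates, right multiplication acts through the scalar matrix
-- `f(y)`. The multiplicativity of `f` and the twisted Leibniz rule of `X` are both instances.
theorem coordCounit_op_smul (ρ : Γ) (y : A) (j : Fin N) :
    coordCounit ω j (op y • ρ) = ∑ k, coordCounit ω k ρ * 𝒞.fc ω k j y := by
  induction ρ using basis_induction ω with
  | h0 => simp
  | hadd ρ τ h1 h2 => simp only [smul_add, map_add, h1, h2, add_mul, Finset.sum_add_distrib]
  | hb a i =>
    rw [← smul_comm a (op y), coordCounit_smul, ← 𝒞.fc_apply]
    simp [coordCounit_smul, coordCounit_basis]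

include hω in
theorem fc_mul (i j : Fin N) (x y : A) :
    𝒞.fc ω i j (x * y) = ∑ k, 𝒞.fc ω i k x * 𝒞.fc ω k j y := by
  rw [fc_apply, op_mul, mul_smul, 𝒞.coordCounit_op_smul ω hω]
  rfl

theorem fc_one (i j : Fin N) : 𝒞.fc ω i j 1 = if i = j then 1 else 0 := by
  rw [fc_apply, op_one, one_smul, coordCounit_basis]

include hω in
theorem Xc_mul (i : Fin N) (x y : A) :
    𝒞.Xc ω i (x * y) = Coalgebra.counit (R := ℂ) x * 𝒞.Xc ω i y +
      ∑ k, 𝒞.Xc ω k x * 𝒞.fc ω k i y := by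
  rw [Xc_apply, 𝒞.leibniz, map_add, 𝒞.coordCounit_op_smul ω hω, coordCounit_smul, add_comm]
  rfl

theorem d_one : 𝒞.d 1 = 0 := by
  have := 𝒞.leibniz 1 1
  simpa using this

theorem Xc_one (i : Fin N) : 𝒞.Xc ω i 1 = 0 := by
  rw [Xc_apply, d_one, map_zero]

/-- The map `ρ ↦ ε(k-th coordinate of ρ₍₀₎) ρ₍₁₎`. -/
def rcoef (k : Fin N) : Γ →ₗ[ℂ] A :=
  (TensorProduct.lid ℂ A).toLinearMap ∘ₗ (coordCounit ω k).rTensor A ∘ₗ 𝒞.coactR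

theorem rcoef_apply (k : Fin N) (ρ : Γ) :
    𝒞.rcoef ω k ρ = TensorProduct.lid ℂ A ((coordCounit ω k).rTensor A (𝒞.coactR ρ)) := rfl

theorem rcoef_smul (k : Fin N) (a : A) (ρ : Γ) : 𝒞.rcoef ω k (a • ρ) = a * 𝒞.rcoef ω k ρ := by
  rw [rcoef_apply, rcoef_apply, coactR_smul]
  generalize 𝒞.coactR ρ = r
  have key : ∀ t : A ⊗[ℂ] A, TensorProduct.lid ℂ A ((coordCounit ω k).rTensor A
      (smulTensor' A Γ t r)) = TensorProduct.lid ℂ A (Coalgebra.counit.rTensor A t) *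
        TensorProduct.lid ℂ A ((coordCounit ω k).rTensor A r) := by
    intro t
    induction t using TensorProduct.induction_on with
    | zero => simp
    | add a b ha hb => simp only [map_add, LinearMap.add_apply, ha, hb, add_mul]
    | tmul c d =>
      induction r using TensorProduct.induction_on with
      | zero => simp
      | add a b ha hb => simp only [map_add, ha, hb, mul_add]
      | tmul ρ b => simp [smulTensor'_tmul, coordCounit_smul, smul_smul, mul_comm]
  rw [key]
  simp

theorem rcoef_basis (k j : Fin N) : 𝒞.rcoef ω k (ω j) = 𝒞.Jmat ω k j := rfl

theorem rcoef_eq (k : Fin N) (ρ : Γ) :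
    𝒞.rcoef ω k ρ = ∑ j, ω.coord j ρ * 𝒞.Jmat ω k j := by
  conv_lhs => rw [← ω.sum_repr ρ]
  simp only [map_sum, rcoef_smul, rcoef_basis, Module.Basis.coord_apply]

theorem rcoef_d (k : Fin N) (x : A) : 𝒞.rcoef ω k (𝒞.d x) = ract (𝒞.Xc ω k) x := by
  rw [rcoef_apply, coactR_d, ← LinearMap.comp_apply, ← LinearMap.rTensor_comp]
  rfl

include hω in
-- The coactions commute, so the first leg of the right coaction of a left invariant form is again
-- left invariant. Its coordinates in the basis `ω`, which can be read off from the left coaction,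
-- are therefore scalars.
theorem coactR_basis (j : Fin N) : 𝒞.coactR (ω j) = ∑ i, ω i ⊗ₜ[ℂ] 𝒞.Jmat ω i j := by
  have h1 := 𝒞.coactL_coactR (ω j)
  rw [hω j, LinearMap.lTensor_tmul] at h1
  have key : ∀ r : Γ ⊗[ℂ] A, r = ∑ i,
      (((LinearMap.toSpanSingleton A Γ (ω i)).restrictScalars ℂ) ∘ₗ
        (TensorProduct.rid ℂ A).toLinearMap ∘ₗ (coordCounit ω i).lTensor A).rTensor A
        (𝒞.coactL.rTensor A r) := by
    intro r
    induction r using TensorProduct.induction_on with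
    | zero => simp
    | add a b ha hb =>
      conv_lhs => rw [ha, hb]
      simp only [map_add, Finset.sum_add_distrib]
    | tmul ρ a =>
      simp only [LinearMap.rTensor_tmul, LinearMap.comp_apply, LinearEquiv.coe_coe,
        ← 𝒞.coord_eq ω hω, LinearMap.restrictScalars_apply, LinearMap.toSpanSingleton_apply]
      rw [← TensorProduct.sum_tmul]
      congr 1
      exact (ω.sum_repr ρ).symm
  have h2 : 𝒞.coactL.rTensor A (𝒞.coactR (ω j)) =
      (TensorProduct.assoc ℂ A Γ A).symm (1 ⊗ₜ 𝒞.coactR (ω j)) := by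
    rw [← h1, LinearEquiv.symm_apply_apply]
  rw [key (𝒞.coactR (ω j)), h2]
  refine Finset.sum_congr rfl fun i _ => ?_
  rw [← rcoef_basis, rcoef_apply]
  generalize 𝒞.coactR (ω j) = r
  induction r using TensorProduct.induction_on with
  | zero => simp
  | add a b ha hb => simp only [map_add, TensorProduct.tmul_add, ha, hb]
  | tmul ρ a => simp [TensorProduct.smul_tmul']

include hω in
theorem rcoef_op_smul_basis (k j : Fin N) (x : A) :
    𝒞.rcoef ω k (op x • ω j) = ∑ i, 𝒞.Jmat ω i j * ract (𝒞.fc ω i k) x := by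
  rw [rcoef_apply, coactR_op_smul, 𝒞.coactR_basis ω hω]
  simp only [ract_apply]
  generalize Coalgebra.comul (R := ℂ) x = t
  induction t using TensorProduct.induction_on with
  | zero => simp
  | add a b ha hb =>
    simp only [map_add, LinearMap.add_apply, ha, hb, mul_add, Finset.sum_add_distrib]
  | tmul c d => simp [opTensor'_tmul, fc_apply]

include hω in
/-- The commutation relation between `f` and `J`. -/
theorem sum_Jmat_mul_ract (j k : Fin N) (x : A) :
    ∑ i, 𝒞.Jmat ω i j * ract (𝒞.fc ω i k) x = ∑ l, lact (𝒞.fc ω j l) x * 𝒞.Jmat ω k l := by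
  -- Both sides are `rcoef k` of `ω_j x`: computed from the right coaction on the left, and from the
  -- expansion of `ω_j x` in the left basis on the right.
  rw [← 𝒞.rcoef_op_smul_basis ω hω, rcoef_eq]
  exact Finset.sum_congr rfl fun l _ => by rw [𝒞.coord_op_smul ω hω]

include hω in
-- Both sides are `rcoef i` of `dx`, computed from the right coaction and from the expansion of `dx`
-- in the left basis.
theorem ract_Xc (i : Fin N) (x : A) :
    ract (𝒞.Xc ω i) x = ∑ j, lact (𝒞.Xc ω j) x * 𝒞.Jmat ω i j := by
  rw [← rcoef_d, rcoef_eq]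
  exact Finset.sum_congr rfl fun l _ => by rw [𝒞.coord_d ω hω]

include hω in
theorem comul_Jmat (i j : Fin N) :
    Coalgebra.comul (𝒞.Jmat ω i j) = ∑ k, 𝒞.Jmat ω i k ⊗ₜ[ℂ] 𝒞.Jmat ω k j := by
  have h := 𝒞.coactR_coassoc (ω j)
  rw [𝒞.coactR_basis ω hω] at h
  simp only [map_sum, LinearMap.rTensor_tmul, LinearMap.lTensor_tmul, 𝒞.coactR_basis ω hω,
    TensorProduct.sum_tmul, TensorProduct.assoc_tmul] at h
  have h2 := congrArg (fun z => TensorProduct.lid ℂ _ ((coordCounit ω i).rTensor (A ⊗[ℂ] A) z)) h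
  simp only [map_sum, LinearMap.rTensor_tmul, coordCounit_basis, TensorProduct.lid_tmul, ite_smul,
    one_smul, zero_smul, Finset.sum_ite_eq', Finset.mem_univ, if_true] at h2
  exact h2.symm

include hω in
theorem counit_Jmat (i j : Fin N) :
    Coalgebra.counit (R := ℂ) (𝒞.Jmat ω i j) = if i = j then 1 else 0 := by
  have h := 𝒞.coactR_counit (ω j)
  rw [𝒞.coactR_basis ω hω] at h
  have h2 := congrArg (coordCounit ω i) h
  simpa [coordCounit_basis, eq_comm] using h2

include hω in
theorem sum_Jmat_mul_antipode (i j : Fin N) :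
    ∑ k, 𝒞.Jmat ω i k * HopfAlgebra.antipode ℂ (𝒞.Jmat ω k j) = if i = j then 1 else 0 := by
  have h := HopfAlgebra.mul_antipode_lTensor_comul_apply (R := ℂ) (𝒞.Jmat ω i j)
  rw [𝒞.comul_Jmat ω hω, 𝒞.counit_Jmat ω hω] at h
  simp only [map_sum, LinearMap.lTensor_tmul, LinearMap.mul'_apply] at h
  rw [h]; split_ifs <;> simp

include hω in
theorem sum_antipode_mul_Jmat (i j : Fin N) :
    ∑ k, HopfAlgebra.antipode ℂ (𝒞.Jmat ω i k) * 𝒞.Jmat ω k j = if i = j then 1 else 0 := by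
  have h := HopfAlgebra.mul_antipode_rTensor_comul_apply (R := ℂ) (𝒞.Jmat ω i j)
  rw [𝒞.comul_Jmat ω hω, 𝒞.counit_Jmat ω hω] at h
  simp only [map_sum, LinearMap.rTensor_tmul, LinearMap.mul'_apply] at h
  rw [h]; split_ifs <;> simp

include hω in
theorem comul_antipode_Jmat (i j : Fin N) :
    Coalgebra.comul (HopfAlgebra.antipode ℂ (𝒞.Jmat ω i j)) =
      ∑ k, HopfAlgebra.antipode ℂ (𝒞.Jmat ω k j) ⊗ₜ[ℂ] HopfAlgebra.antipode ℂ (𝒞.Jmat ω i k) := by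
  rw [comul_antipode, 𝒞.comul_Jmat ω hω]
  simp

/-! #### Right invariant forms -/

theorem eta_def (j : Fin N) :
    𝒞.eta ω j = ∑ i, op (HopfAlgebra.antipode ℂ (𝒞.Jmat ω i j)) • ω i := rfl

include hω in
theorem sum_op_Jmat_smul_eta (k : Fin N) : ∑ j, op (𝒞.Jmat ω j k) • 𝒞.eta ω j = ω k := by
  simp only [eta_def, Finset.smul_sum, smul_smul, ← op_mul]
  rw [Finset.sum_comm]
  simp_rw [← Finset.sum_smul, ← Finset.op_sum]
  simp [𝒞.sum_antipode_mul_Jmat ω hω, apply_ite op, ite_smul]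

include hω in
theorem coactL_eta (j : Fin N) :
    𝒞.coactL (𝒞.eta ω j) = ∑ k, HopfAlgebra.antipode ℂ (𝒞.Jmat ω k j) ⊗ₜ[ℂ] 𝒞.eta ω k := by
  simp only [eta_def, map_sum, coactL_op_smul, hω _ , 𝒞.comul_antipode_Jmat ω hω,
    LinearMap.sum_apply, TensorProduct.tmul_sum]
  rw [Finset.sum_comm]
  refine Finset.sum_congr rfl fun k _ => Finset.sum_congr rfl fun i _ => ?_
  rw [hω i, opTensor_tmul, one_mul]

include hω in
theorem isRightInvariant_eta (j : Fin N) : 𝒞.IsRightInvariant (𝒞.eta ω j) := by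
  unfold IsRightInvariant
  simp only [eta_def, map_sum, coactR_op_smul, 𝒞.coactR_basis ω hω, 𝒞.comul_antipode_Jmat ω hω,
    LinearMap.sum_apply, opTensor'_tmul, TensorProduct.sum_tmul]
  rw [Finset.sum_comm]
  refine Finset.sum_congr rfl fun i _ => ?_
  rw [Finset.sum_comm]
  simp_rw [← TensorProduct.tmul_sum, 𝒞.sum_Jmat_mul_antipode ω hω]
  rw [Finset.sum_eq_single i]
  · simp
  · intro k _ hk
    simp [Ne.symm hk]
  · simp

/-! #### Coordinates relative to the right invariant basis -/

variable (hS : Function.Bijective (HopfAlgebra.antipode ℂ : A →ₗ[ℂ] A))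

/-- The functional `S⁻¹(f_{ij})`. -/
def gc (i j : Fin N) : WithConv (A →ₗ[ℂ] ℂ) := dualSInv hS (𝒞.fc ω i j)

include hω in
theorem gc_mul (i j : Fin N) (x y : A) :
    𝒞.gc ω hS i j (x * y) = ∑ k, 𝒞.gc ω hS k j x * 𝒞.gc ω hS i k y := by
  simp only [gc, dualSInv_apply, antipodeInv_mul, 𝒞.fc_mul ω hω]
  exact Finset.sum_congr rfl fun k _ => mul_comm _ _

theorem gc_one (i j : Fin N) : 𝒞.gc ω hS i j 1 = if i = j then 1 else 0 := by
  rw [gc, dualSInv_apply, antipodeInv_one, fc_one]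

include hω in
theorem sum_fc_mul_gc (i j : Fin N) :
    ∑ k, 𝒞.fc ω k j * 𝒞.gc ω hS i k = if i = j then 1 else 0 :=
  sum_mul_dualSInv hS (𝒞.fc_mul ω hω) (𝒞.fc_one ω) i j

include hω in
theorem sum_gc_mul_fc (i j : Fin N) :
    ∑ k, 𝒞.gc ω hS k j * 𝒞.fc ω i k = if i = j then 1 else 0 :=
  sum_dualSInv_mul hS (𝒞.fc_mul ω hω) (𝒞.fc_one ω) i j

include hω in
theorem ract_gc_mul (i j : Fin N) (x y : A) :
    ract (𝒞.gc ω hS i j) (x * y) = ∑ k, ract (𝒞.gc ω hS k j) x * ract (𝒞.gc ω hS i k) y :=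
  ract_apply_mul (𝒞.gc_mul ω hω hS i j) x y

include hω in
/-- The commutation relation between `S⁻¹(f)` and `J`. -/
theorem sum_Jmat_mul_lact_gc (a b : Fin N) (x : A) :
    ∑ j, 𝒞.Jmat ω a j * lact (𝒞.gc ω hS b j) x =
      ∑ k, ract (𝒞.gc ω hS k a) x * 𝒞.Jmat ω k b := by
  -- The relation between `f` and `J` is used at `x` acted on by `S⁻¹(f)` from both sides; on each
  -- side of the equation one factor `S⁻¹(f)` cancels against `f`.
  have h := Finset.sum_congr rfl fun j (_ : j ∈ Finset.univ) =>
    Finset.sum_congr rfl fun k (_ : k ∈ Finset.univ) =>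
      𝒞.sum_Jmat_mul_ract ω hω j k (ract (𝒞.gc ω hS k a) (lact (𝒞.gc ω hS b j) x))
  have hl : ∀ j i, ∑ k, ract (𝒞.fc ω i k) (ract (𝒞.gc ω hS k a) (lact (𝒞.gc ω hS b j) x)) =
      if i = a then lact (𝒞.gc ω hS b j) x else 0 := by
    intro j i
    simp_rw [← ract_mul]
    rw [← LinearMap.sum_apply, ← map_sum, 𝒞.sum_gc_mul_fc ω hω hS]
    split_ifs <;> simp [ract_one]
  have hr : ∀ k l, ∑ j, lact (𝒞.fc ω j l) (ract (𝒞.gc ω hS k a) (lact (𝒞.gc ω hS b j) x)) =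
      if b = l then ract (𝒞.gc ω hS k a) x else 0 := by
    intro k l
    simp_rw [← lact_ract, ← lact_mul]
    rw [← LinearMap.sum_apply, ← map_sum, 𝒞.sum_fc_mul_gc ω hω hS]
    split_ifs <;> simp [lact_one]
  calc _ = ∑ j, ∑ k, ∑ i, 𝒞.Jmat ω i j *
        ract (𝒞.fc ω i k) (ract (𝒞.gc ω hS k a) (lact (𝒞.gc ω hS b j) x)) := by
        refine Finset.sum_congr rfl fun j _ => ?_
        rw [Finset.sum_comm]
        simp_rw [← Finset.mul_sum, hl]
        simp
    _ = _ := h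
    _ = _ := by
        rw [Finset.sum_comm]
        refine Finset.sum_congr rfl fun k _ => ?_
        rw [Finset.sum_comm]
        simp_rw [← Finset.sum_mul, hr]
        simp

/-- The coordinates of a one-form relative to the right `A`-module basis `η`. -/
def rcoord (j : Fin N) : Γ →ₗ[ℂ] A :=
  -- The formula comes from `a ω_k = ∑ a η_m J_{mk}` and `a η_m = ∑ η_j (a ◁ S⁻¹(f_{mj}))`.
  ∑ k, ∑ m, LinearMap.mulRight ℂ (𝒞.Jmat ω m k) ∘ₗ ract (𝒞.gc ω hS m j) ∘ₗ
    (ω.coord k).restrictScalars ℂ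

theorem rcoord_apply (j : Fin N) (ρ : Γ) : 𝒞.rcoord ω hS j ρ =
    ∑ k, ∑ m, ract (𝒞.gc ω hS m j) (ω.coord k ρ) * 𝒞.Jmat ω m k := by
  simp [rcoord]

theorem rcoord_smul_basis (j k : Fin N) (a : A) : 𝒞.rcoord ω hS j (a • ω k) =
    ∑ m, ract (𝒞.gc ω hS m j) a * 𝒞.Jmat ω m k := by
  rw [rcoord_apply, Finset.sum_eq_single k]
  · simp
  · intro l _ hl
    simp [Finsupp.single_apply, Ne.symm hl]
  · simp

theorem ract_apply_one (h : WithConv (A →ₗ[ℂ] ℂ)) : ract h 1 = h 1 • (1 : A) := by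
  rw [ract_apply, Bialgebra.comul_one, Algebra.TensorProduct.one_def]; simp

theorem rcoord_basis (j k : Fin N) : 𝒞.rcoord ω hS j (ω k) = 𝒞.Jmat ω j k := by
  have := 𝒞.rcoord_smul_basis ω hS j k 1
  rw [one_smul] at this
  rw [this]
  simp [ract_apply_one, gc_one]

include hω in
theorem rcoord_smul (j : Fin N) (x : A) (ρ : Γ) : 𝒞.rcoord ω hS j (x • ρ) =
    ∑ m, ract (𝒞.gc ω hS m j) x * 𝒞.rcoord ω hS m ρ := by
  induction ρ using basis_induction ω with
  | h0 => simp
  | hadd ρ τ h1 h2 => simp only [smul_add, map_add, h1, h2, mul_add, Finset.sum_add_distrib]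
  | hb a i =>
    rw [smul_smul]
    simp only [rcoord_smul_basis, 𝒞.ract_gc_mul ω hω, Finset.mul_sum, Finset.sum_mul]
    rw [Finset.sum_comm]
    simp only [mul_assoc]

include hω in
-- It suffices to treat `ω_k x`. There the relation between `f` and `J` turns the left action of `f`
-- into a right action, which `S⁻¹(f)` cancels.
theorem rcoord_op_smul (j : Fin N) (x : A) (ρ : Γ) :
    𝒞.rcoord ω hS j (op x • ρ) = 𝒞.rcoord ω hS j ρ * x := by
  induction ρ using basis_induction ω with
  | h0 => simp
  | hadd ρ τ h1 h2 => simp only [smul_add, map_add, h1, h2, add_mul]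
  | hb a k =>
    have key : ∀ j, 𝒞.rcoord ω hS j (op x • ω k) = 𝒞.Jmat ω j k * x := by
      intro j
      rw [𝒞.op_smul_basis ω hω, map_sum]
      simp only [rcoord_smul_basis, ← lact_ract]
      rw [Finset.sum_comm]
      simp_rw [← 𝒞.sum_Jmat_mul_ract ω hω, ← ract_mul]
      rw [Finset.sum_comm]
      simp_rw [← Finset.mul_sum, ← LinearMap.sum_apply, ← map_sum, 𝒞.sum_gc_mul_fc ω hω hS]
      rw [Finset.sum_eq_single j]
      · simp [ract_one]
      · intro b _ hb
        simp [hb]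
      · simp
    rw [← smul_comm a (op x), 𝒞.rcoord_smul ω hω, rcoord_smul_basis, Finset.sum_mul]
    simp only [key, mul_assoc]

include hω in
-- The rule `ω_i x = ∑ (f_{ij} ▷ x) ω_j` is inverted by `S⁻¹(f)`; thus the `ω_l` also generate `Γ`
-- as a right module.
theorem smul_basis_eq (a : A) (i : Fin N) :
    a • ω i = ∑ l, op (lact (𝒞.gc ω hS i l) a) • ω l := by
  simp_rw [𝒞.op_smul_basis ω hω]
  rw [Finset.sum_comm]
  simp_rw [← Finset.sum_smul, ← lact_mul, ← LinearMap.sum_apply, ← map_sum,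
    𝒞.sum_fc_mul_gc ω hω hS]
  rw [Finset.sum_eq_single i]
  · simp [lact_one]
  · intro b _ hb
    simp [Ne.symm hb]
  · simp

include hω in
theorem sum_op_rcoord_smul_eta (ρ : Γ) : ∑ j, op (𝒞.rcoord ω hS j ρ) • 𝒞.eta ω j = ρ := by
  have key : ∀ (x : A) (k : Fin N),
      ∑ j, op (𝒞.rcoord ω hS j (op x • ω k)) • 𝒞.eta ω j = op x • ω k := by
    intro x k
    simp only [𝒞.rcoord_op_smul ω hω, op_mul, mul_smul, rcoord_basis]
    rw [← Finset.smul_sum, 𝒞.sum_op_Jmat_smul_eta ω hω]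
  induction ρ using basis_induction ω with
  | h0 => simp
  | hadd ρ τ h1 h2 => simp only [map_add, op_add, add_smul, Finset.sum_add_distrib, h1, h2]
  | hb a k =>
    rw [𝒞.smul_basis_eq ω hω hS]
    simp only [map_sum, Finset.op_sum, Finset.sum_smul]
    rw [Finset.sum_comm]
    simp only [key]

include hω hS in
/-- One-forms are sums of the forms `ηⱼ a`. -/
theorem eta_induction {p : Γ → Prop} (hadd : ∀ ρ τ, p ρ → p τ → p (ρ + τ)) (h0 : p 0)
    (hb : ∀ (a : A) (i : Fin N), p (op a • 𝒞.eta ω i)) (ρ : Γ) : p ρ := by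
  rw [← 𝒞.sum_op_rcoord_smul_eta ω hω hS ρ]
  exact Finset.sum_induction _ p hadd h0 fun i _ => hb _ i

include hω in
theorem rcoord_eta (i j : Fin N) : 𝒞.rcoord ω hS j (𝒞.eta ω i) = if j = i then 1 else 0 := by
  rw [eta_def, map_sum]
  simp only [𝒞.rcoord_op_smul ω hω, rcoord_basis, 𝒞.sum_Jmat_mul_antipode ω hω]

end BicovariantCalculus

end QuantumCartan
end

/-! ### The exterior algebra: universal property, degree, left coaction. -/

noncomputable section

set_option linter.unusedSectionVars false

namespace QuantumCartan

/-- The induced map on the range of `f` extends to all of `W` because the scalars form a field. With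
`f = 1 - σ` it writes the product of one-forms as `r ∘ (1 - σ)`, a factorization that can be
tensored with `A`. -/
theorem exists_comp_eq_of_ker_le {V W Z : Type*} [AddCommGroup V] [Module ℂ V] [AddCommGroup W]
    [Module ℂ W] [AddCommGroup Z] [Module ℂ Z] (f : V →ₗ[ℂ] W) (q : V →ₗ[ℂ] Z)
    (h : ∀ v, f v = 0 → q v = 0) : ∃ r : W →ₗ[ℂ] Z, r ∘ₗ f = q := by
  obtain ⟨r, hr⟩ := LinearMap.exists_extend
    ((LinearMap.ker f).liftQ q (fun v hv => LinearMap.mem_ker.2 (h v (LinearMap.mem_ker.1 hv))) ∘ₗ f.quotKerEquivRange.symm.toLinearMap)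
  refine ⟨r, LinearMap.ext fun v => ?_⟩
  have h1 := LinearMap.congr_fun hr ⟨f v, LinearMap.mem_range_self f v⟩
  have h2 : f.quotKerEquivRange.symm ⟨f v, LinearMap.mem_range_self f v⟩ =
      (LinearMap.ker f).mkQ v := f.quotKerEquivRange_symm_apply_image v _
  simp only [LinearMap.comp_apply, Submodule.subtype_apply, LinearEquiv.coe_coe] at h1
  rw [h2] at h1
  exact h1

namespace BicovariantCalculus

variable {A : Type*} [Ring A] [HopfAlgebra ℂ A]
  {Γ : Type*} [AddCommGroup Γ] [Module ℂ Γ] [Module A Γ] [Module Aᵐᵒᵖ Γ]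
  [SMulCommClass A Aᵐᵒᵖ Γ] [IsScalarTower ℂ A Γ] [IsScalarTower ℂ Aᵐᵒᵖ Γ]
  (𝒞 : BicovariantCalculus A Γ) {N : ℕ} (ω : Module.Basis (Fin N) A Γ)

/-! #### The exterior algebra -/

theorem emk_rel {x y : TensorAlgebra ℂ (A × Γ)} (h : 𝒞.ExtRel x y) : 𝒞.emk x = 𝒞.emk y :=
  RingQuot.mkAlgHom_rel ℂ h

theorem ofA_apply (x : A) : 𝒞.ofA x = 𝒞.emk (TensorAlgebra.ι ℂ (x, (0 : Γ))) := rfl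

theorem ofΓ_apply (ρ : Γ) : 𝒞.ofΓ ρ = 𝒞.emk (TensorAlgebra.ι ℂ ((0 : A), ρ)) := rfl

theorem ofA_one : 𝒞.ofA 1 = 1 := by
  rw [ofA_apply, 𝒞.emk_rel .one, map_one]

theorem ofA_mul (x y : A) : 𝒞.ofA (x * y) = 𝒞.ofA x * 𝒞.ofA y := by
  rw [ofA_apply, 𝒞.emk_rel (.mul x y), map_mul]; rfl

theorem ofΓ_smul (x : A) (ρ : Γ) : 𝒞.ofΓ (x • ρ) = 𝒞.ofA x * 𝒞.ofΓ ρ := by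
  rw [ofΓ_apply, 𝒞.emk_rel (.smul x ρ), map_mul]; rfl

theorem ofΓ_op_smul (x : A) (ρ : Γ) : 𝒞.ofΓ (op x • ρ) = 𝒞.ofΓ ρ * 𝒞.ofA x := by
  rw [ofΓ_apply, 𝒞.emk_rel (.op_smul x ρ), map_mul]; rfl

/-- The inclusion of zero-forms as an algebra map. -/
def ofAHom : A →ₐ[ℂ] 𝒞.Ext := AlgHom.ofLinearMap 𝒞.ofA 𝒞.ofA_one 𝒞.ofA_mul

/-- The product of two one-forms. -/
def ofΓΓ : Γ ⊗[ℂ] Γ →ₗ[ℂ] 𝒞.Ext := LinearMap.mul' ℂ 𝒞.Ext ∘ₗ TensorProduct.map 𝒞.ofΓ 𝒞.ofΓ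

theorem ofΓΓ_tmul (ρ τ : Γ) : 𝒞.ofΓΓ (ρ ⊗ₜ τ) = 𝒞.ofΓ ρ * 𝒞.ofΓ τ := rfl

theorem ofΓΓ_ker (z : Γ ⊗[ℂ] Γ) (σ : TensorSq A Γ →ₗ[ℂ] TensorSq A Γ) (hσ : 𝒞.IsBraiding σ)
    (hz : σ ((balanced A Γ).mkQ z) = (balanced A Γ).mkQ z) : 𝒞.ofΓΓ z = 0 := by
  have h := 𝒞.emk_rel (.ker z σ hσ hz)
  rw [map_zero] at h
  rw [← h]
  induction z using TensorProduct.induction_on with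
  | zero => simp
  | tmul x y => simp [ofΓΓ_tmul, ofΓ]
  | add x y hx hy =>
    clear h hz
    have key : 𝒞.ofΓΓ = 𝒞.emk.toLinearMap ∘ₗ LinearMap.mul' ℂ (TensorAlgebra ℂ (A × Γ)) ∘ₗ
        (TensorProduct.map (TensorAlgebra.ι ℂ ∘ₗ LinearMap.inr ℂ A Γ)
          (TensorAlgebra.ι ℂ ∘ₗ LinearMap.inr ℂ A Γ)) := by
      ext a b
      simp [ofΓΓ_tmul, ofΓ]
    exact LinearMap.congr_fun key (x + y)

/-- The product of two one-forms as a map on the tensor product over `A`. -/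
def ofTensorSq : TensorSq A Γ →ₗ[ℂ] 𝒞.Ext :=
  (balanced A Γ).liftQ 𝒞.ofΓΓ (by
    rw [balanced, Submodule.span_le]
    rintro _ ⟨ρ, τ, a, rfl⟩
    simp [ofΓΓ_tmul, ofΓ_smul, ofΓ_op_smul, mul_assoc])

@[simp] theorem ofTensorSq_mkQ (z : Γ ⊗[ℂ] Γ) :
    𝒞.ofTensorSq ((balanced A Γ).mkQ z) = 𝒞.ofΓΓ z := rfl

section Lift

variable {B : Type*} [Ring B] [Algebra ℂ B] (a : A →ₐ[ℂ] B) (g : Γ →ₗ[ℂ] B)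
  (h1 : ∀ x ρ, g (x • ρ) = a x * g ρ) (h2 : ∀ (x : A) ρ, g (op x • ρ) = g ρ * a x)
  (h3 : ∀ (z : Γ ⊗[ℂ] Γ) (σ : TensorSq A Γ →ₗ[ℂ] TensorSq A Γ), 𝒞.IsBraiding σ →
    σ ((balanced A Γ).mkQ z) = (balanced A Γ).mkQ z →
    LinearMap.mul' ℂ B (TensorProduct.map g g z) = 0)

/-- The universal property of the exterior algebra. -/
def extLift : 𝒞.Ext →ₐ[ℂ] B :=
  RingQuot.liftAlgHom ℂ ⟨TensorAlgebra.lift ℂ (a.toLinearMap.coprod g), by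
    intro x y hxy
    induction hxy with
    | one => simp
    | mul x y => simp
    | smul x ρ => simp [h1]
    | op_smul x ρ => simp [h2]
    | ker z σ hσ hz =>
      rw [map_zero, ← h3 z σ hσ hz]
      have key : (TensorAlgebra.lift ℂ (a.toLinearMap.coprod g)).toLinearMap ∘ₗ
          LinearMap.mul' ℂ (TensorAlgebra ℂ (A × Γ)) ∘ₗ
          (TensorProduct.map (TensorAlgebra.ι ℂ ∘ₗ LinearMap.inr ℂ A Γ)
          (TensorAlgebra.ι ℂ ∘ₗ LinearMap.inr ℂ A Γ)) =
          LinearMap.mul' ℂ B ∘ₗ TensorProduct.map g g := by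
        ext u v
        simp
      exact LinearMap.congr_fun key z⟩

theorem extLift_emk (x) : 𝒞.extLift a g h1 h2 h3 (𝒞.emk x) =
    TensorAlgebra.lift ℂ (a.toLinearMap.coprod g) x :=
  RingQuot.liftAlgHom_mkAlgHom_apply ℂ _ _ _

@[simp] theorem extLift_ofA (x : A) : 𝒞.extLift a g h1 h2 h3 (𝒞.ofA x) = a x := by
  simp [ofA_apply, extLift_emk]

@[simp] theorem extLift_ofΓ (ρ : Γ) : 𝒞.extLift a g h1 h2 h3 (𝒞.ofΓ ρ) = g ρ := by
  simp [ofΓ_apply, extLift_emk]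

end Lift

theorem emk_surjective : Function.Surjective 𝒞.emk := RingQuot.mkAlgHom_surjective ℂ 𝒞.ExtRel

/-- The exterior algebra is generated by zero-forms and one-forms. -/
theorem ext_induction {p : 𝒞.Ext → Prop} (hA : ∀ x, p (𝒞.ofA x)) (hΓ : ∀ ρ, p (𝒞.ofΓ ρ))
    (hadd : ∀ α β, p α → p β → p (α + β)) (hmul : ∀ α β, p α → p β → p (α * β)) (α : 𝒞.Ext) :
    p α := by
  obtain ⟨x, rfl⟩ := 𝒞.emk_surjective α
  induction x using TensorAlgebra.induction with
  | algebraMap r =>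
    have : 𝒞.emk (algebraMap ℂ _ r) = 𝒞.ofA (r • 1) := by
      rw [map_smul, ofA_one, AlgHom.commutes, Algebra.algebraMap_eq_smul_one]
    rw [this]; exact hA _
  | ι x =>
    obtain ⟨x, ρ⟩ := x
    have : 𝒞.emk (TensorAlgebra.ι ℂ (x, ρ)) = 𝒞.ofA x + 𝒞.ofΓ ρ := by
      rw [ofA_apply, ofΓ_apply, ← map_add, ← map_add]; simp
    rw [this]; exact hadd _ _ (hA _) (hΓ _)
  | mul a b ha hb => rw [map_mul]; exact hmul _ _ ha hb
  | add a b ha hb => rw [map_add]; exact hadd _ _ ha hb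

/-- The exterior algebra is generated by zero-forms and exact one-forms. -/
theorem ext_induction_d {p : 𝒞.Ext → Prop} (hA : ∀ x, p (𝒞.ofA x))
    (hd : ∀ x, p (𝒞.ofΓ (𝒞.d x)))
    (hadd : ∀ α β, p α → p β → p (α + β)) (hmul : ∀ α β, p α → p β → p (α * β)) (α : 𝒞.Ext) :
    p α := by
  refine 𝒞.ext_induction hA (fun ρ => ?_) hadd hmul α
  induction ρ using 𝒞.form_induction with
  | h0 => simpa using hA 0
  | hadd ρ τ h1 h2 => rw [map_add]; exact hadd _ _ h1 h2
  | hd x y => rw [ofΓ_smul]; exact hmul _ _ (hA _) (hd _)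

/-- The grading automorphism `α ↦ (-1)^{|α|} α` of the exterior algebra. -/
def extParity : 𝒞.Ext →ₐ[ℂ] 𝒞.Ext :=
  𝒞.extLift 𝒞.ofAHom (-𝒞.ofΓ)
    (fun x ρ => by simp [ofΓ_smul, ofAHom]) (fun x ρ => by simp [ofΓ_op_smul, ofAHom])
    (fun z σ hσ hz => by
      have key : LinearMap.mul' ℂ 𝒞.Ext ∘ₗ TensorProduct.map (-𝒞.ofΓ) (-𝒞.ofΓ) = 𝒞.ofΓΓ := by
        ext a b; simp [ofΓΓ_tmul]
      exact (LinearMap.congr_fun key z).trans (𝒞.ofΓΓ_ker z σ hσ hz))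

@[simp] theorem extParity_ofA (x : A) : 𝒞.extParity (𝒞.ofA x) = 𝒞.ofA x := by
  simp [extParity, ofAHom]

@[simp] theorem extParity_ofΓ (ρ : Γ) : 𝒞.extParity (𝒞.ofΓ ρ) = -𝒞.ofΓ ρ := by
  simp [extParity]

@[simp] theorem extParity_extParity (α : 𝒞.Ext) : 𝒞.extParity (𝒞.extParity α) = α := by
  induction α using 𝒞.ext_induction with
  | hA x => simp
  | hΓ ρ => simp
  | hadd α β h1 h2 => simp [h1, h2]
  | hmul α β h1 h2 => simp [h1, h2]

/-! #### The grading by degree -/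

theorem form_zero : 𝒞.form 0 = LinearMap.range 𝒞.ofA := by
  rw [form, pow_zero, mul_one]

theorem form_succ (k : ℕ) : 𝒞.form (k + 1) = 𝒞.form k * LinearMap.range 𝒞.ofΓ := by
  rw [form, form, pow_succ, mul_assoc]

theorem ofA_mem_form (x : A) : 𝒞.ofA x ∈ 𝒞.form 0 := by
  rw [form_zero]; exact ⟨x, rfl⟩

theorem ofΓ_mem_form (ρ : Γ) : 𝒞.ofΓ ρ ∈ 𝒞.form 1 := by
  rw [form_succ, ← one_mul (𝒞.ofΓ ρ), ← ofA_one]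
  exact Submodule.mul_mem_mul (𝒞.ofA_mem_form 1) ⟨ρ, rfl⟩

theorem form_one : 𝒞.form 1 = LinearMap.range 𝒞.ofΓ := by
  refine le_antisymm ?_ ?_
  · rw [form_succ, form_zero, Submodule.mul_le]
    rintro _ ⟨x, rfl⟩ _ ⟨ρ, rfl⟩
    exact ⟨x • ρ, 𝒞.ofΓ_smul x ρ⟩
  · rintro _ ⟨ρ, rfl⟩
    exact 𝒞.ofΓ_mem_form ρ

theorem form_mul_range_ofA (k : ℕ) : 𝒞.form k * LinearMap.range 𝒞.ofA ≤ 𝒞.form k := by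
  cases k with
  | zero =>
    rw [form_zero, Submodule.mul_le]
    rintro _ ⟨x, rfl⟩ _ ⟨y, rfl⟩
    exact ⟨x * y, 𝒞.ofA_mul x y⟩
  | succ k =>
    rw [form_succ, mul_assoc]
    refine mul_le_mul' le_rfl ?_
    rw [Submodule.mul_le]
    rintro _ ⟨ρ, rfl⟩ _ ⟨y, rfl⟩
    exact ⟨op y • ρ, 𝒞.ofΓ_op_smul y ρ⟩

theorem form_mul_form (j k : ℕ) : 𝒞.form j * 𝒞.form k ≤ 𝒞.form (j + k) := by
  induction k with
  | zero => rw [form_zero]; exact 𝒞.form_mul_range_ofA j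
  | succ k ih =>
    rw [form_succ, ← mul_assoc, ← add_assoc, form_succ]
    exact mul_le_mul' ih le_rfl

theorem mul_mem_form {j k : ℕ} {α β : 𝒞.Ext} (hα : α ∈ 𝒞.form j) (hβ : β ∈ 𝒞.form k) :
    α * β ∈ 𝒞.form (j + k) :=
  𝒞.form_mul_form j k (Submodule.mul_mem_mul hα hβ)

theorem form_succ_induction {k : ℕ} {p : 𝒞.Ext → Prop}
    (hmul : ∀ α ∈ 𝒞.form k, ∀ ρ, p (α * 𝒞.ofΓ ρ))
    (hadd : ∀ α β, p α → p β → p (α + β)) {α : 𝒞.Ext} (hα : α ∈ 𝒞.form (k + 1)) : p α := by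
  rw [form_succ] at hα
  refine Submodule.mul_induction_on hα ?_ hadd
  rintro α hα _ ⟨ρ, rfl⟩
  exact hmul α hα ρ

theorem iSup_form : ⨆ k, 𝒞.form k = ⊤ := by
  rw [eq_top_iff]
  rintro α -
  induction α using 𝒞.ext_induction with
  | hA x => exact Submodule.mem_iSup_of_mem 0 (𝒞.ofA_mem_form x)
  | hΓ ρ => exact Submodule.mem_iSup_of_mem 1 (𝒞.ofΓ_mem_form ρ)
  | hadd α β h1 h2 => exact add_mem h1 h2
  | hmul α β h1 h2 =>
    have h := Submodule.mul_mem_mul h1 h2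
    rw [Submodule.iSup_mul] at h
    simp_rw [Submodule.mul_iSup] at h
    refine (iSup_le fun j => iSup_le fun k => ?_ : _ ≤ ⨆ k, 𝒞.form k) h
    exact (𝒞.form_mul_form j k).trans (le_iSup 𝒞.form (j + k))

/-- Elements of the exterior algebra are sums of homogeneous ones. -/
theorem homogeneous_induction {p : 𝒞.Ext → Prop} (h : ∀ k, ∀ α ∈ 𝒞.form k, p α)
    (h0 : p 0) (hadd : ∀ α β, p α → p β → p (α + β)) (α : 𝒞.Ext) : p α :=
  Submodule.iSup_induction 𝒞.form (motive := p) (by rw [𝒞.iSup_form]; trivial : α ∈ ⨆ k, 𝒞.form k) h h0 hadd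

theorem extParity_of_mem {k : ℕ} {α : 𝒞.Ext} (hα : α ∈ 𝒞.form k) :
    𝒞.extParity α = (-1 : ℂ) ^ k • α := by
  induction k generalizing α with
  | zero =>
    rw [form_zero] at hα
    obtain ⟨x, rfl⟩ := hα
    simp
  | succ k ih =>
    refine 𝒞.form_succ_induction (p := fun α => 𝒞.extParity α = (-1 : ℂ) ^ (k + 1) • α)
      (fun α hα ρ => ?_) (fun α β h1 h2 => ?_) hα
    · rw [map_mul, ih hα, extParity_ofΓ, pow_succ]; simp
    · rw [map_add, h1, h2, smul_add]

/-! #### The left coaction -/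

variable (hω : ∀ i, 𝒞.IsLeftInvariant (ω i))
  (hS : Function.Bijective (HopfAlgebra.antipode ℂ : A →ₗ[ℂ] A))

include hω hS in
-- The forms `a ω_i` span `Γ` and so do the forms `η_j b`. These are the tensors on which the
-- braiding is known explicitly, so identities that involve it are tested here.
theorem tensor_ext {M : Type*} [AddCommMonoid M] [Module ℂ M] {φ ψ : Γ ⊗[ℂ] Γ →ₗ[ℂ] M}
    (h : ∀ (a b : A) (i j : Fin N),
      φ ((a • ω i) ⊗ₜ (op b • 𝒞.eta ω j)) = ψ ((a • ω i) ⊗ₜ (op b • 𝒞.eta ω j))) : φ = ψ := by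
  ext ρ τ
  induction ρ using basis_induction ω with
  | h0 => simp
  | hadd ρ ρ' h1 h2 => simpa [TensorProduct.add_tmul] using congrArg₂ (· + ·) h1 h2
  | hb a i =>
    induction τ using 𝒞.eta_induction ω hω hS with
    | h0 => simp
    | hadd ρ ρ' h1 h2 => simpa [TensorProduct.tmul_add] using congrArg₂ (· + ·) h1 h2
    | hb b j => exact h a b i j

/-- The left coaction on `Γ ⊗_ℂ Γ`. -/
def coactLSq : Γ ⊗[ℂ] Γ →ₗ[ℂ] A ⊗[ℂ] (Γ ⊗[ℂ] Γ) :=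
  TensorProduct.lift ((TensorProduct.map₂ (LinearMap.mul ℂ A)
    (TensorProduct.mk ℂ Γ Γ)).compl₁₂ 𝒞.coactL 𝒞.coactL)

theorem coactLSq_tmul (ρ τ : Γ) : 𝒞.coactLSq (ρ ⊗ₜ τ) =
    TensorProduct.map₂ (LinearMap.mul ℂ A) (TensorProduct.mk ℂ Γ Γ) (𝒞.coactL ρ) (𝒞.coactL τ) :=
  rfl

/-- The left coaction on `Γ ⊗_A Γ`. -/
def coactLTensorSq : TensorSq A Γ →ₗ[ℂ] A ⊗[ℂ] TensorSq A Γ :=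
  (balanced A Γ).liftQ ((balanced A Γ).mkQ.lTensor A ∘ₗ 𝒞.coactLSq) (by
    refine Submodule.span_le.2 ?_
    rintro _ ⟨ρ, τ, a, rfl⟩
    simp only [SetLike.mem_coe, LinearMap.mem_ker, map_sub, LinearMap.comp_apply, coactLSq_tmul,
      coactL_op_smul, coactL_smul]
    rw [sub_eq_zero]
    generalize 𝒞.coactL ρ = r
    generalize 𝒞.coactL τ = t
    generalize Coalgebra.comul (R := ℂ) a = s
    induction s using TensorProduct.induction_on with
    | zero => simp
    | add p q hp hq => simp only [map_add, LinearMap.add_apply, hp, hq]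
    | tmul u v =>
      induction r using TensorProduct.induction_on with
      | zero => simp
      | add p q hp hq => simp only [map_add, LinearMap.add_apply, hp, hq]
      | tmul b ρ =>
        induction t using TensorProduct.induction_on with
        | zero => simp
        | add p q hp hq => simp only [map_add, hp, hq]
        | tmul c τ =>
          simp only [opTensor_tmul, smulTensor_tmul, TensorProduct.map₂_apply_tmul, TensorProduct.map_tmul,
            LinearMap.mul_apply', TensorProduct.mk_apply, LinearMap.lTensor_tmul, mul_assoc]
          exact congrArg (TensorProduct.mk ℂ A (TensorSq A Γ) _)
            ((Submodule.Quotient.eq (balanced A Γ)).2 (Submodule.subset_span ⟨ρ, τ, v, rfl⟩)))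

theorem coactLTensorSq_mkQ (z : Γ ⊗[ℂ] Γ) : 𝒞.coactLTensorSq ((balanced A Γ).mkQ z) =
    (balanced A Γ).mkQ.lTensor A (𝒞.coactLSq z) := rfl

include hω hS in
/-- The braiding is left covariant. -/
theorem coactLTensorSq_braiding (σ : TensorSq A Γ →ₗ[ℂ] TensorSq A Γ) (hσ : 𝒞.IsBraiding σ)
    (y : TensorSq A Γ) : 𝒞.coactLTensorSq (σ y) = σ.lTensor A (𝒞.coactLTensorSq y) := by
  obtain ⟨z, rfl⟩ := (balanced A Γ).mkQ_surjective y
  revert z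
  refine LinearMap.congr_fun (f := 𝒞.coactLTensorSq ∘ₗ σ ∘ₗ (balanced A Γ).mkQ)
    (g := σ.lTensor A ∘ₗ 𝒞.coactLTensorSq ∘ₗ (balanced A Γ).mkQ) ?_
  refine 𝒞.tensor_ext ω hω hS fun a b i j => ?_
  have h := hσ a b (ω i) (𝒞.eta ω j) (hω i) (𝒞.isRightInvariant_eta ω hω j)
  simp only [LinearMap.comp_apply]
  rw [tmulA] at h
  rw [h, tmulA, coactLTensorSq_mkQ, coactLTensorSq_mkQ, coactLSq_tmul, coactLSq_tmul, coactL_smul,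
    coactL_smul, coactL_op_smul, coactL_op_smul, 𝒞.coactL_eta ω hω, hω i]
  generalize Coalgebra.comul (R := ℂ) a = s
  generalize Coalgebra.comul (R := ℂ) b = t
  induction s using TensorProduct.induction_on with
  | zero => simp
  | add p q hp hq => simp only [map_add, LinearMap.add_apply, hp, hq]
  | tmul a1 a2 =>
    induction t using TensorProduct.induction_on with
    | zero => simp
    | add p q hp hq => simp only [map_add, LinearMap.add_apply, hp, hq]
    | tmul b1 b2 =>
      simp only [map_sum, LinearMap.sum_apply, opTensor_tmul, smulTensor_tmul,
        TensorProduct.map₂_apply_tmul, TensorProduct.map_tmul, LinearMap.mul_apply', TensorProduct.mk_apply,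
        LinearMap.lTensor_tmul, mul_assoc, one_mul, mul_one]
      -- The left coaction sends `η_j` to a combination of the `η_k`, which are again right
      -- invariant, so the defining property of `σ` applies to the second leg.
      refine Finset.sum_congr rfl fun k _ => ?_
      exact congrArg (TensorProduct.mk ℂ A (TensorSq A Γ) _)
        (hσ a2 b2 (ω i) (𝒞.eta ω k) (hω i) (𝒞.isRightInvariant_eta ω hω k)).symm

/-- The left coaction of the exterior algebra. -/
def extCoact : 𝒞.Ext →ₐ[ℂ] A ⊗[ℂ] 𝒞.Ext :=
  𝒞.extLift
    ((Algebra.TensorProduct.map (AlgHom.id ℂ A) 𝒞.ofAHom).comp (Bialgebra.comulAlgHom ℂ A))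
    (𝒞.ofΓ.lTensor A ∘ₗ 𝒞.coactL)
    (fun x ρ => by
      simp only [LinearMap.comp_apply, coactL_smul, AlgHom.comp_apply,
        Bialgebra.comulAlgHom_apply]
      generalize 𝒞.coactL ρ = r
      generalize Coalgebra.comul (R := ℂ) x = s
      induction s using TensorProduct.induction_on with
      | zero => simp
      | add p q hp hq => simp only [map_add, LinearMap.add_apply, hp, hq, add_mul]
      | tmul u v =>
        induction r using TensorProduct.induction_on with
        | zero => simp
        | add p q hp hq => simp only [map_add, hp, hq, mul_add]
        | tmul b ρ => simp [smulTensor_tmul, ofΓ_smul, ofAHom])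
    (fun x ρ => by
      simp only [LinearMap.comp_apply, coactL_op_smul, AlgHom.comp_apply,
        Bialgebra.comulAlgHom_apply]
      generalize 𝒞.coactL ρ = r
      generalize Coalgebra.comul (R := ℂ) x = s
      induction s using TensorProduct.induction_on with
      | zero => simp
      | add p q hp hq => simp only [map_add, LinearMap.add_apply, hp, hq, mul_add]
      | tmul u v =>
        induction r using TensorProduct.induction_on with
        | zero => simp
        | add p q hp hq => simp only [map_add, hp, hq, add_mul]
        | tmul b ρ => simp [opTensor_tmul, ofΓ_op_smul, ofAHom])
    (fun z σ hσ hz => by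
      have key : LinearMap.mul' ℂ (A ⊗[ℂ] 𝒞.Ext) ∘ₗ
          TensorProduct.map (𝒞.ofΓ.lTensor A ∘ₗ 𝒞.coactL) (𝒞.ofΓ.lTensor A ∘ₗ 𝒞.coactL) =
          𝒞.ofTensorSq.lTensor A ∘ₗ 𝒞.coactLTensorSq ∘ₗ (balanced A Γ).mkQ := by
        ext ρ τ
        simp only [TensorProduct.AlgebraTensorModule.curry_apply, LinearMap.restrictScalars_self,
          TensorProduct.curry_apply, LinearMap.comp_apply, TensorProduct.map_tmul,
          LinearMap.mul'_apply, coactLTensorSq_mkQ, coactLSq_tmul]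
        generalize 𝒞.coactL ρ = r
        generalize 𝒞.coactL τ = t
        induction r using TensorProduct.induction_on with
        | zero => simp
        | add p q hp hq => simp only [map_add, LinearMap.add_apply, hp, hq, add_mul]
        | tmul b ρ =>
          induction t using TensorProduct.induction_on with
          | zero => simp
          | add p q hp hq => simp only [map_add, hp, hq, mul_add]
          | tmul c τ => simp only [Algebra.TensorProduct.tmul_mul_tmul, LinearMap.lTensor_tmul]; rfl
      -- The product factors as `r ∘ (1 - σ)`. By covariance, `id ⊗ (1 - σ)` applied to the coaction
      -- of `z` is the coaction of `(1 - σ) z`, which is zero.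
      obtain ⟨r, hr⟩ := exists_comp_eq_of_ker_le (LinearMap.id - σ) 𝒞.ofTensorSq (by
        intro y hy
        obtain ⟨z, rfl⟩ := (balanced A Γ).mkQ_surjective y
        rw [LinearMap.sub_apply, LinearMap.id_apply, sub_eq_zero] at hy
        rw [ofTensorSq_mkQ]
        exact 𝒞.ofΓΓ_ker z σ hσ hy.symm)
      refine (LinearMap.congr_fun key z).trans ?_
      rw [LinearMap.comp_apply, LinearMap.comp_apply, ← hr, LinearMap.lTensor_comp,
        LinearMap.comp_apply, LinearMap.lTensor_sub, LinearMap.sub_apply,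
        ← 𝒞.coactLTensorSq_braiding ω hω hS σ hσ, hz, LinearMap.lTensor_id, LinearMap.id_apply,
        sub_self, map_zero])

theorem isExteriorCoaction_extCoact : 𝒞.IsExteriorCoaction (𝒞.extCoact ω hω hS) where
  ofA x := by
    rw [extCoact, extLift_ofA]
    rfl
  ofΓ ρ := by
    rw [extCoact, extLift_ofΓ]
    rfl

end BicovariantCalculus

end QuantumCartan
end

/-! ### The right action of functionals on forms and the inner derivatives. -/

noncomputable section

set_option linter.unusedSectionVars false

namespace QuantumCartan

namespace BicovariantCalculus

variable {A : Type*} [Ring A] [HopfAlgebra ℂ A]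
  {Γ : Type*} [AddCommGroup Γ] [Module ℂ Γ] [Module A Γ] [Module Aᵐᵒᵖ Γ]
  [SMulCommClass A Aᵐᵒᵖ Γ] [IsScalarTower ℂ A Γ] [IsScalarTower ℂ Aᵐᵒᵖ Γ]
  (𝒞 : BicovariantCalculus A Γ) {N : ℕ} (ω : Module.Basis (Fin N) A Γ)

/-! #### The right action of functionals on the exterior algebra -/

section Action

variable {𝒞} {δL : 𝒞.Ext →ₐ[ℂ] A ⊗[ℂ] 𝒞.Ext} (hδ : 𝒞.IsExteriorCoaction δL)

include hδ in
-- Both sides are algebra maps in `α`, so it is enough to compare them on `A` and on `Γ`, where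
-- coassociativity is given.
theorem coact_coassoc (α : 𝒞.Ext) :
    TensorProduct.assoc ℂ A A 𝒞.Ext (Coalgebra.comul.rTensor 𝒞.Ext (δL α)) =
      δL.toLinearMap.lTensor A (δL α) := by
  let Φ : 𝒞.Ext →ₐ[ℂ] A ⊗[ℂ] (A ⊗[ℂ] 𝒞.Ext) :=
    (Algebra.TensorProduct.assoc ℂ ℂ ℂ A A 𝒞.Ext).toAlgHom.comp
      ((Algebra.TensorProduct.map (Bialgebra.comulAlgHom ℂ A) (AlgHom.id ℂ 𝒞.Ext)).comp δL)
  let Ψ : 𝒞.Ext →ₐ[ℂ] A ⊗[ℂ] (A ⊗[ℂ] 𝒞.Ext) :=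
    (Algebra.TensorProduct.map (AlgHom.id ℂ A) δL).comp δL
  change Φ α = Ψ α
  induction α using 𝒞.ext_induction with
  | hadd α β h1 h2 => rw [map_add, map_add, h1, h2]
  | hmul α β h1 h2 => rw [map_mul, map_mul, h1, h2]
  | hA x =>
    change TensorProduct.assoc ℂ A A 𝒞.Ext (Coalgebra.comul.rTensor 𝒞.Ext (δL (𝒞.ofA x))) =
      δL.toLinearMap.lTensor A (δL (𝒞.ofA x))
    have e1 : ∀ t : A ⊗[ℂ] A, TensorProduct.assoc ℂ A A 𝒞.Ext
        (Coalgebra.comul.rTensor 𝒞.Ext (𝒞.ofA.lTensor A t)) =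
        (𝒞.ofA.lTensor A).lTensor A (TensorProduct.assoc ℂ A A A (Coalgebra.comul.rTensor A t)) := by
      intro t
      induction t using TensorProduct.induction_on with
      | zero => simp
      | add p q hp hq => simp only [map_add, hp, hq]
      | tmul u v =>
        simp only [LinearMap.lTensor_tmul, LinearMap.rTensor_tmul]
        generalize Coalgebra.comul (R := ℂ) u = s
        induction s using TensorProduct.induction_on with
        | zero => simp
        | add p q hp hq => simp only [map_add, TensorProduct.add_tmul, hp, hq]
        | tmul u v => simp
    rw [hδ.ofA, e1, Coalgebra.coassoc_apply, ← LinearMap.lTensor_comp_apply, ← LinearMap.lTensor_comp_apply]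
    exact LinearMap.congr_fun (congrArg (LinearMap.lTensor A)
      (LinearMap.ext fun x => (hδ.ofA x).symm)) _
  | hΓ ρ =>
    change TensorProduct.assoc ℂ A A 𝒞.Ext (Coalgebra.comul.rTensor 𝒞.Ext (δL (𝒞.ofΓ ρ))) =
      δL.toLinearMap.lTensor A (δL (𝒞.ofΓ ρ))
    have e1 : ∀ t : A ⊗[ℂ] Γ, TensorProduct.assoc ℂ A A 𝒞.Ext
        (Coalgebra.comul.rTensor 𝒞.Ext (𝒞.ofΓ.lTensor A t)) =
        (𝒞.ofΓ.lTensor A).lTensor A (TensorProduct.assoc ℂ A A Γ (Coalgebra.comul.rTensor Γ t)) := by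
      intro t
      induction t using TensorProduct.induction_on with
      | zero => simp
      | add p q hp hq => simp only [map_add, hp, hq]
      | tmul u v =>
        simp only [LinearMap.lTensor_tmul, LinearMap.rTensor_tmul]
        generalize Coalgebra.comul (R := ℂ) u = s
        induction s using TensorProduct.induction_on with
        | zero => simp
        | add p q hp hq => simp only [map_add, TensorProduct.add_tmul, hp, hq]
        | tmul u v => simp
    rw [hδ.ofΓ, e1, 𝒞.coactL_coassoc, ← LinearMap.lTensor_comp_apply, ← LinearMap.lTensor_comp_apply]
    exact LinearMap.congr_fun (congrArg (LinearMap.lTensor A)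
      (LinearMap.ext fun x => (hδ.ofΓ x).symm)) _

include hδ in
theorem coact_counit (α : 𝒞.Ext) :
    TensorProduct.lid ℂ 𝒞.Ext ((Coalgebra.counit (R := ℂ) (A := A)).rTensor 𝒞.Ext (δL α)) = α := by
  let Φ : 𝒞.Ext →ₐ[ℂ] 𝒞.Ext := (Algebra.TensorProduct.lid ℂ 𝒞.Ext).toAlgHom.comp
    ((Algebra.TensorProduct.map (Bialgebra.counitAlgHom ℂ A) (AlgHom.id ℂ 𝒞.Ext)).comp δL)
  change Φ α = α
  induction α using 𝒞.ext_induction with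
  | hadd α β h1 h2 => rw [map_add, h1, h2]
  | hmul α β h1 h2 => rw [map_mul, h1, h2]
  | hA x =>
    change TensorProduct.lid ℂ 𝒞.Ext
      ((Coalgebra.counit (R := ℂ) (A := A)).rTensor 𝒞.Ext (δL (𝒞.ofA x))) = 𝒞.ofA x
    rw [hδ.ofA, ← LinearMap.comp_apply, LinearMap.rTensor_comp_lTensor,
      ← LinearMap.lTensor_comp_rTensor, LinearMap.comp_apply, Coalgebra.rTensor_counit_comul]
    simp
  | hΓ ρ =>
    change TensorProduct.lid ℂ 𝒞.Ext
      ((Coalgebra.counit (R := ℂ) (A := A)).rTensor 𝒞.Ext (δL (𝒞.ofΓ ρ))) = 𝒞.ofΓ ρ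
    rw [hδ.ofΓ]
    conv_rhs => rw [← 𝒞.coactL_counit ρ]
    generalize 𝒞.coactL ρ = r
    induction r using TensorProduct.induction_on with
    | zero => simp
    | add p q hp hq => simp only [map_add, hp, hq]
    | tmul u v => simp

/-- The right action `α ◁ h` as a map that is linear in the functional `h`. -/
def eact (δL : 𝒞.Ext →ₐ[ℂ] A ⊗[ℂ] 𝒞.Ext) :
    WithConv (A →ₗ[ℂ] ℂ) →ₗ[ℂ] 𝒞.Ext →ₗ[ℂ] 𝒞.Ext where
  toFun h := 𝒞.actR δL h.ofConv
  map_add' h k := by ext; simp [actR, LinearMap.rTensor_add]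
  map_smul' c h := by ext; simp [actR, LinearMap.rTensor_smul]

theorem eact_apply (h : WithConv (A →ₗ[ℂ] ℂ)) (α : 𝒞.Ext) : eact δL h α =
    TensorProduct.lid ℂ 𝒞.Ext (h.ofConv.rTensor 𝒞.Ext (δL α)) := rfl

include hδ in
theorem coact_eact (h : WithConv (A →ₗ[ℂ] ℂ)) (α : 𝒞.Ext) :
    δL (eact δL h α) = (ract h).rTensor 𝒞.Ext (δL α) := by
  have key : ∀ t : A ⊗[ℂ] 𝒞.Ext, δL (TensorProduct.lid ℂ 𝒞.Ext (h.ofConv.rTensor 𝒞.Ext t)) =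
      TensorProduct.lid ℂ _ (h.ofConv.rTensor _ (δL.toLinearMap.lTensor A t)) := by
    intro t
    induction t using TensorProduct.induction_on with
    | zero => simp
    | add p q hp hq => simp only [map_add, hp, hq]
    | tmul u v => simp
  have key2 : ∀ t : A ⊗[ℂ] 𝒞.Ext, TensorProduct.lid ℂ _ (h.ofConv.rTensor _
      (TensorProduct.assoc ℂ A A 𝒞.Ext (Coalgebra.comul.rTensor 𝒞.Ext t))) =
      (ract h).rTensor 𝒞.Ext t := by
    intro t
    induction t using TensorProduct.induction_on with
    | zero => simp
    | add p q hp hq => simp only [map_add, hp, hq]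
    | tmul u v =>
      simp only [LinearMap.rTensor_tmul, ract_apply]
      generalize Coalgebra.comul (R := ℂ) u = s
      induction s using TensorProduct.induction_on with
      | zero => simp
      | add p q hp hq => simp only [map_add, TensorProduct.add_tmul, hp, hq]
      | tmul u v => simp [TensorProduct.smul_tmul']
  rw [eact_apply, key, ← coact_coassoc hδ, key2]

include hδ in
theorem lTensor_eact_coact (h : WithConv (A →ₗ[ℂ] ℂ)) (α : 𝒞.Ext) :
    (eact δL h).lTensor A (δL α) = (lact h).rTensor 𝒞.Ext (δL α) := by
  have key : ∀ t : A ⊗[ℂ] 𝒞.Ext, (eact δL h).lTensor A t =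
      ((TensorProduct.lid ℂ 𝒞.Ext).toLinearMap ∘ₗ h.ofConv.rTensor 𝒞.Ext).lTensor A
        (δL.toLinearMap.lTensor A t) := by
    intro t
    induction t using TensorProduct.induction_on with
    | zero => simp
    | add p q hp hq => simp only [map_add, hp, hq]
    | tmul u v => simp [eact_apply]
  have key2 : ∀ t : A ⊗[ℂ] 𝒞.Ext,
      ((TensorProduct.lid ℂ 𝒞.Ext).toLinearMap ∘ₗ h.ofConv.rTensor 𝒞.Ext).lTensor A
      (TensorProduct.assoc ℂ A A 𝒞.Ext (Coalgebra.comul.rTensor 𝒞.Ext t)) =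
      (lact h).rTensor 𝒞.Ext t := by
    intro t
    induction t using TensorProduct.induction_on with
    | zero => simp
    | add p q hp hq => simp only [map_add, hp, hq]
    | tmul u v =>
      simp only [LinearMap.rTensor_tmul, lact_apply]
      generalize Coalgebra.comul (R := ℂ) u = s
      induction s using TensorProduct.induction_on with
      | zero => simp
      | add p q hp hq => simp only [map_add, TensorProduct.add_tmul, hp, hq]
      | tmul u v => simp [TensorProduct.smul_tmul']
  rw [key, ← coact_coassoc hδ, key2]

include hδ in
theorem eact_mul (h k : WithConv (A →ₗ[ℂ] ℂ)) (α : 𝒞.Ext) :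
    eact δL (h * k) α = eact δL k (eact δL h α) := by
  have e : (h * k).ofConv = k.ofConv ∘ₗ ract h := LinearMap.ext (conv_apply_ract h k)
  rw [eact_apply k, coact_eact hδ, eact_apply, e, LinearMap.rTensor_comp, LinearMap.comp_apply]

include hδ in
theorem eact_one (α : 𝒞.Ext) : eact δL 1 α = α := by
  have := coact_counit hδ α
  rwa [eact_apply]

theorem eact_apply_mul {ι : Type*} [Fintype ι] {h : WithConv (A →ₗ[ℂ] ℂ)}
    {a b : ι → WithConv (A →ₗ[ℂ] ℂ)} (hab : ∀ x y, h (x * y) = ∑ s, a s x * b s y)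
    (α β : 𝒞.Ext) : eact δL h (α * β) = ∑ s, eact δL (a s) α * eact δL (b s) β := by
  simp only [eact_apply, map_mul]
  generalize δL α = s
  generalize δL β = t
  induction s using TensorProduct.induction_on with
  | zero => simp
  | add p q hp hq => simp only [add_mul, map_add, hp, hq, Finset.sum_add_distrib]
  | tmul p q =>
    induction t using TensorProduct.induction_on with
    | zero => simp
    | add p q hp hq => simp only [mul_add, map_add, hp, hq, Finset.sum_add_distrib]
    | tmul u v => simp [hab, Finset.sum_smul, smul_smul, mul_comm]

include hδ in
theorem eact_ofA (h : WithConv (A →ₗ[ℂ] ℂ)) (x : A) :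
    eact δL h (𝒞.ofA x) = 𝒞.ofA (ract h x) := by
  rw [eact_apply, hδ.ofA, ract_apply]
  generalize Coalgebra.comul (R := ℂ) x = s
  induction s using TensorProduct.induction_on with
  | zero => simp
  | add p q hp hq => simp only [map_add, hp, hq]
  | tmul p q => simp

include hδ in
theorem eact_ofΓ (h : WithConv (A →ₗ[ℂ] ℂ)) (ρ : Γ) :
    eact δL h (𝒞.ofΓ ρ) = 𝒞.ofΓ (TensorProduct.lid ℂ Γ (h.ofConv.rTensor Γ (𝒞.coactL ρ))) := by
  rw [eact_apply, hδ.ofΓ]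
  generalize 𝒞.coactL ρ = s
  induction s using TensorProduct.induction_on with
  | zero => simp
  | add p q hp hq => simp only [map_add, hp, hq]
  | tmul p q => simp

include hδ in
theorem eact_ofΓ_leftInvariant (h : WithConv (A →ₗ[ℂ] ℂ)) {ρ : Γ} (hρ : 𝒞.IsLeftInvariant ρ) :
    eact δL h (𝒞.ofΓ ρ) = h 1 • 𝒞.ofΓ ρ := by
  rw [eact_ofΓ hδ, hρ]; simp

include hδ in
theorem coact_extParity (α : 𝒞.Ext) :
    δL (𝒞.extParity α) = 𝒞.extParity.toLinearMap.lTensor A (δL α) := by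
  change (δL.comp 𝒞.extParity) α =
    ((Algebra.TensorProduct.map (AlgHom.id ℂ A) 𝒞.extParity).comp δL) α
  induction α using 𝒞.ext_induction with
  | hadd α β h1 h2 => rw [map_add, map_add, h1, h2]
  | hmul α β h1 h2 => rw [map_mul, map_mul, h1, h2]
  | hA x =>
    change δL (𝒞.extParity (𝒞.ofA x)) = 𝒞.extParity.toLinearMap.lTensor A (δL (𝒞.ofA x))
    have : 𝒞.extParity.toLinearMap ∘ₗ 𝒞.ofA = 𝒞.ofA := by
      ext y; simp
    rw [extParity_ofA, hδ.ofA, ← LinearMap.lTensor_comp_apply, this]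
  | hΓ ρ =>
    change δL (𝒞.extParity (𝒞.ofΓ ρ)) = 𝒞.extParity.toLinearMap.lTensor A (δL (𝒞.ofΓ ρ))
    rw [extParity_ofΓ, map_neg, hδ.ofΓ, ← LinearMap.lTensor_comp_apply]
    have : 𝒞.extParity.toLinearMap ∘ₗ 𝒞.ofΓ = -𝒞.ofΓ := by
      ext y; simp
    rw [this, LinearMap.lTensor_neg, LinearMap.neg_apply]

include hδ in
theorem extParity_eact (h : WithConv (A →ₗ[ℂ] ℂ)) (α : 𝒞.Ext) :
    𝒞.extParity (eact δL h α) = eact δL h (𝒞.extParity α) := by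
  rw [eact_apply, eact_apply, coact_extParity hδ]
  generalize δL α = s
  induction s using TensorProduct.induction_on with
  | zero => simp
  | add p q hp hq => simp only [map_add, hp, hq]
  | tmul p q => simp

end Action

/-! #### The right inner derivatives -/

section Inner

/-- The block matrix with blocks `P`, `v`, `0`, `α`. -/
def block {R : Type*} [Ring R] (P : Matrix (Fin N) (Fin N) R) (v : Fin N → R) (α : R) :
    Matrix (Option (Fin N)) (Option (Fin N)) R
  | some j, some m => P j m
  | some j, none => v j
  | none, some _ => 0
  | none, none => α

theorem block_mul {R : Type*} [Ring R] (P Q : Matrix (Fin N) (Fin N) R) (v w : Fin N → R)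
    (α β : R) : block P v α * block Q w β =
      block (P * Q) (fun j => v j * β + ∑ m, P j m * w m) (α * β) := by
  ext i j
  rcases i with _ | i <;> rcases j with _ | j <;>
    simp [Matrix.mul_apply, Fintype.sum_option, block]

theorem block_one {R : Type*} [Ring R] :
    block (1 : Matrix (Fin N) (Fin N) R) (0 : Fin N → R) 1 = 1 := by
  ext i j
  rcases i with _ | i <;> rcases j with _ | j <;> simp [Matrix.one_apply, block]

/-- The block matrix map with linear entries. -/
def blockₗ {W R : Type*} [AddCommGroup W] [Module ℂ W] [Ring R] [Algebra ℂ R]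
    (P : W →ₗ[ℂ] Matrix (Fin N) (Fin N) R) (v : W →ₗ[ℂ] Fin N → R) (a : W →ₗ[ℂ] R) :
    W →ₗ[ℂ] Matrix (Option (Fin N)) (Option (Fin N)) R where
  toFun w := block (P w) (v w) (a w)
  map_add' x y := by
    ext i j
    rcases i with _ | i <;> rcases j with _ | j <;> simp [block]
  map_smul' c x := by
    ext i j
    rcases i with _ | i <;> rcases j with _ | j <;> simp [block]

variable (hω : ∀ i, 𝒞.IsLeftInvariant (ω i))
  (hS : Function.Bijective (HopfAlgebra.antipode ℂ : A →ₗ[ℂ] A))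
  {δL : 𝒞.Ext →ₐ[ℂ] A ⊗[ℂ] 𝒞.Ext} (hδ : 𝒞.IsExteriorCoaction δL)

/-- The matrix of the operators `α ↦ (-1)^{|α|} α ◁ S⁻¹(f_{mj})`. -/
def signedMat (δL : 𝒞.Ext →ₐ[ℂ] A ⊗[ℂ] 𝒞.Ext) :
    𝒞.Ext →ₗ[ℂ] Matrix (Fin N) (Fin N) 𝒞.Ext where
  toFun α := fun j m => 𝒞.extParity (eact δL (𝒞.gc ω hS m j) α)
  map_add' α β := by ext j m; simp; rfl
  map_smul' c α := by ext j m; simp; rfl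

theorem signedMat_apply (α : 𝒞.Ext) (j m : Fin N) :
    𝒞.signedMat ω hS δL α j m = 𝒞.extParity (eact δL (𝒞.gc ω hS m j) α) := rfl

include hω in
theorem eact_gc_mul (i j : Fin N) (α β : 𝒞.Ext) : eact δL (𝒞.gc ω hS i j) (α * β) =
    ∑ k, eact δL (𝒞.gc ω hS k j) α * eact δL (𝒞.gc ω hS i k) β :=
  eact_apply_mul (𝒞.gc_mul ω hω hS i j) α β

include hω in
theorem signedMat_mul (α β : 𝒞.Ext) : 𝒞.signedMat ω hS δL (α * β) =
    𝒞.signedMat ω hS δL α * 𝒞.signedMat ω hS δL β := by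
  ext j m
  simp [Matrix.mul_apply, signedMat_apply, 𝒞.eact_gc_mul ω hω]

include hδ in
theorem signedMat_one : 𝒞.signedMat ω hS δL 1 = 1 := by
  ext j m
  rw [signedMat_apply, ← ofA_one, eact_ofA hδ, extParity_ofA, ract_apply_one, gc_one,
    Matrix.one_apply]
  rcases eq_or_ne j m with rfl | h
  · simp [ofA_one]
  · simp [h, Ne.symm h]

/-- Zero-forms in the block matrix representation. -/
def blockA : A →ₐ[ℂ] Matrix (Option (Fin N)) (Option (Fin N)) 𝒞.Ext :=
  AlgHom.ofLinearMap (blockₗ (𝒞.signedMat ω hS δL ∘ₗ 𝒞.ofA) 0 𝒞.ofA)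
    (by
      change block (𝒞.signedMat ω hS δL (𝒞.ofA 1)) 0 (𝒞.ofA 1) = 1
      rw [ofA_one, 𝒞.signedMat_one ω hS hδ, block_one])
    (fun x y => by
      change block (𝒞.signedMat ω hS δL (𝒞.ofA (x * y))) 0 (𝒞.ofA (x * y)) =
        block (𝒞.signedMat ω hS δL (𝒞.ofA x)) 0 (𝒞.ofA x) *
        block (𝒞.signedMat ω hS δL (𝒞.ofA y)) 0 (𝒞.ofA y)
      rw [block_mul, ofA_mul, 𝒞.signedMat_mul ω hω hS]
      congr 1
      ext j
      simp)

/-- One-forms in the block matrix representation. -/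
def blockΓ (δL : 𝒞.Ext →ₐ[ℂ] A ⊗[ℂ] 𝒞.Ext) :
    Γ →ₗ[ℂ] Matrix (Option (Fin N)) (Option (Fin N)) 𝒞.Ext :=
  blockₗ (𝒞.signedMat ω hS δL ∘ₗ 𝒞.ofΓ) (LinearMap.pi fun j => 𝒞.ofA ∘ₗ 𝒞.rcoord ω hS j) 𝒞.ofΓ

theorem blockA_apply (x : A) : 𝒞.blockA ω hω hS hδ x =
    block (𝒞.signedMat ω hS δL (𝒞.ofA x)) 0 (𝒞.ofA x) := rfl

theorem blockΓ_apply (ρ : Γ) : 𝒞.blockΓ ω hS δL ρ =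
    block (𝒞.signedMat ω hS δL (𝒞.ofΓ ρ)) (fun j => 𝒞.ofA (𝒞.rcoord ω hS j ρ)) (𝒞.ofΓ ρ) := rfl

/-- The map `ρ ⊗ τ ↦ (j-th right coordinate of ρ) τ` on `Γ ⊗_A Γ`. -/
def contractSq (j : Fin N) : TensorSq A Γ →ₗ[ℂ] 𝒞.Ext :=
  (balanced A Γ).liftQ (LinearMap.mul' ℂ 𝒞.Ext ∘ₗ
    TensorProduct.map (𝒞.ofA ∘ₗ 𝒞.rcoord ω hS j) 𝒞.ofΓ) (by
    refine Submodule.span_le.2 ?_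
    rintro _ ⟨ρ, τ, a, rfl⟩
    simp [𝒞.rcoord_op_smul ω hω, ofΓ_smul, ofA_mul, mul_assoc])

theorem contractSq_mkQ (j : Fin N) (ρ τ : Γ) :
    𝒞.contractSq ω hω hS j ((balanced A Γ).mkQ (ρ ⊗ₜ τ)) = 𝒞.ofA (𝒞.rcoord ω hS j ρ) * 𝒞.ofΓ τ :=
  rfl

theorem contractSq_tmulA (j : Fin N) (ρ τ : Γ) :
    𝒞.contractSq ω hω hS j (tmulA A ρ τ) = 𝒞.ofA (𝒞.rcoord ω hS j ρ) * 𝒞.ofΓ τ :=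
  rfl

/-- The map `ρ ⊗ τ ↦ ∑ (ρ ◁ S⁻¹(f_{mj})) (m-th right coordinate of τ)`. -/
def twistedContract (δL : 𝒞.Ext →ₐ[ℂ] A ⊗[ℂ] 𝒞.Ext) (j : Fin N) : Γ ⊗[ℂ] Γ →ₗ[ℂ] 𝒞.Ext :=
  ∑ m, LinearMap.mul' ℂ 𝒞.Ext ∘ₗ
    TensorProduct.map (eact δL (𝒞.gc ω hS m j) ∘ₗ 𝒞.ofΓ) (𝒞.ofA ∘ₗ 𝒞.rcoord ω hS m)

theorem twistedContract_tmul (j : Fin N) (ρ τ : Γ) : 𝒞.twistedContract ω hS δL j (ρ ⊗ₜ τ) =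
    ∑ m, eact δL (𝒞.gc ω hS m j) (𝒞.ofΓ ρ) * 𝒞.ofA (𝒞.rcoord ω hS m τ) := by
  simp [twistedContract]

include hω hδ in
theorem eact_gc_ofΓ_smul_basis (m j k : Fin N) (a : A) :
    eact δL (𝒞.gc ω hS m j) (𝒞.ofΓ (a • ω k)) =
      𝒞.ofA (ract (𝒞.gc ω hS m j) a) * 𝒞.ofΓ (ω k) := by
  rw [ofΓ_smul, 𝒞.eact_gc_mul ω hω]
  simp only [eact_ofΓ_leftInvariant hδ _ (hω k), gc_one, eact_ofA hδ]
  rw [Finset.sum_eq_single m]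
  · simp
  · intro q _ hq
    simp [Ne.symm hq]
  · simp

include hδ in
-- On `a ω_k ⊗ η_l b` the braiding gives `a η_l ⊗ ω_k b`, whose contraction is `(a ◁ S⁻¹(f_{lj}))
-- ω_k b`. This is also what one gets by contracting the second factor of the original tensor past
-- the first, as `S⁻¹(f)` only touches the coefficient of the left invariant `ω_k`. The inner
-- derivatives are well defined because of this identity.
theorem contractSq_braiding (σ : TensorSq A Γ →ₗ[ℂ] TensorSq A Γ) (hσ : 𝒞.IsBraiding σ)
    (j : Fin N) (z : Γ ⊗[ℂ] Γ) : 𝒞.contractSq ω hω hS j (σ ((balanced A Γ).mkQ z)) =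
      𝒞.twistedContract ω hS δL j z := by
  revert z
  refine LinearMap.congr_fun (f := 𝒞.contractSq ω hω hS j ∘ₗ σ ∘ₗ (balanced A Γ).mkQ) ?_
  refine 𝒞.tensor_ext ω hω hS fun a b k l => ?_
  have h := hσ a b (ω k) (𝒞.eta ω l) (hω k) (𝒞.isRightInvariant_eta ω hω l)
  simp only [LinearMap.comp_apply]
  rw [tmulA] at h
  rw [h, contractSq_tmulA, twistedContract_tmul, 𝒞.rcoord_smul ω hω]
  simp only [𝒞.eact_gc_ofΓ_smul_basis ω hω hS hδ, 𝒞.rcoord_op_smul ω hω, 𝒞.rcoord_eta ω hω,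
    ofΓ_op_smul]
  rw [Finset.sum_eq_single l, Finset.sum_eq_single l]
  · simp [mul_assoc]
  · intro q _ hq; simp [hq]
  · simp
  · intro q _ hq; simp [hq]
  · simp

/-- The block matrix representation of the exterior algebra. -/
def blockRep : 𝒞.Ext →ₐ[ℂ] Matrix (Option (Fin N)) (Option (Fin N)) 𝒞.Ext :=
  𝒞.extLift (𝒞.blockA ω hω hS hδ) (𝒞.blockΓ ω hS δL)
    (fun x ρ => by
      rw [blockA_apply, blockΓ_apply, blockΓ_apply, block_mul, ofΓ_smul, 𝒞.signedMat_mul ω hω]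
      congr 1
      ext j
      simp [𝒞.rcoord_smul ω hω, signedMat_apply, eact_ofA hδ, ofA_mul])
    (fun x ρ => by
      rw [blockA_apply, blockΓ_apply, blockΓ_apply, block_mul, ofΓ_op_smul, 𝒞.signedMat_mul ω hω]
      congr 1
      ext j
      simp [𝒞.rcoord_op_smul ω hω, ofA_mul])
    (fun z σ hσ hz => by
      have key : LinearMap.mul' ℂ (Matrix (Option (Fin N)) (Option (Fin N)) 𝒞.Ext) ∘ₗ
          TensorProduct.map (𝒞.blockΓ ω hS δL) (𝒞.blockΓ ω hS δL) =
          blockₗ (𝒞.signedMat ω hS δL ∘ₗ 𝒞.ofΓΓ)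
            (LinearMap.pi fun j => 𝒞.contractSq ω hω hS j ∘ₗ (balanced A Γ).mkQ -
              𝒞.twistedContract ω hS δL j) 𝒞.ofΓΓ := by
        ext1
        refine LinearMap.ext fun ρ => LinearMap.ext fun τ => ?_
        change 𝒞.blockΓ ω hS δL ρ * 𝒞.blockΓ ω hS δL τ =
          block (𝒞.signedMat ω hS δL (𝒞.ofΓΓ (ρ ⊗ₜ τ)))
            (fun j => 𝒞.contractSq ω hω hS j ((balanced A Γ).mkQ (ρ ⊗ₜ τ)) -
              𝒞.twistedContract ω hS δL j (ρ ⊗ₜ τ)) (𝒞.ofΓΓ (ρ ⊗ₜ τ))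
        rw [blockΓ_apply, blockΓ_apply, block_mul, ofΓΓ_tmul, 𝒞.signedMat_mul ω hω]
        congr 1
        ext j
        rw [contractSq_mkQ, twistedContract_tmul]
        simp [signedMat_apply, extParity_eact hδ, sub_eq_add_neg]
      refine (LinearMap.congr_fun key z).trans ?_
      change block (𝒞.signedMat ω hS δL (𝒞.ofΓΓ z))
            (fun j => 𝒞.contractSq ω hω hS j ((balanced A Γ).mkQ z) -
              𝒞.twistedContract ω hS δL j z) (𝒞.ofΓΓ z) = 0
      rw [𝒞.ofΓΓ_ker z σ hσ hz, map_zero]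
      ext i j
      rcases i with _ | i <;> rcases j with _ | j
      · rfl
      · rfl
      · change 𝒞.contractSq ω hω hS i ((balanced A Γ).mkQ z) - 𝒞.twistedContract ω hS δL i z = 0
        -- The corner entry is the contraction of `z - σ z`.
        rw [← 𝒞.contractSq_braiding ω hω hS hδ σ hσ, hz, sub_self]
      · rfl)

/-- The right inner derivatives. -/
def inner (j : Fin N) : 𝒞.Ext →ₗ[ℂ] 𝒞.Ext where
  toFun α := 𝒞.blockRep ω hω hS hδ α (some j) none
  map_add' α β := by simp
  map_smul' c α := by simp

/-- Once the diagonal blocks are identified, multiplicativity of the block matrix, read in its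
corner, is the twisted Leibniz rule of the inner derivatives. -/
theorem blockRep_eq (α : 𝒞.Ext) : 𝒞.blockRep ω hω hS hδ α =
    block (𝒞.signedMat ω hS δL α) (fun j => 𝒞.inner ω hω hS hδ j α) α := by
  induction α using 𝒞.ext_induction with
  | hA x =>
    have h : 𝒞.blockRep ω hω hS hδ (𝒞.ofA x) = _ := 𝒞.extLift_ofA _ _ _ _ _ x
    have h2 : ∀ j, 𝒞.inner ω hω hS hδ j (𝒞.ofA x) = 0 := fun j => by
      change 𝒞.blockRep ω hω hS hδ (𝒞.ofA x) (some j) none = 0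
      rw [h]; rfl
    simp only [h2]
    exact h
  | hΓ ρ =>
    have h : 𝒞.blockRep ω hω hS hδ (𝒞.ofΓ ρ) = _ := 𝒞.extLift_ofΓ _ _ _ _ _ ρ
    have h2 : ∀ j, 𝒞.inner ω hω hS hδ j (𝒞.ofΓ ρ) = 𝒞.ofA (𝒞.rcoord ω hS j ρ) := fun j => by
      change 𝒞.blockRep ω hω hS hδ (𝒞.ofΓ ρ) (some j) none = _
      rw [h]; rfl
    simp only [h2]
    exact h
  | hadd α β h1 h2 =>
    rw [map_add, h1, h2]
    ext i j
    rcases i with _ | i <;> rcases j with _ | j <;> simp [block]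
  | hmul α β h1 h2 =>
    have h := map_mul (𝒞.blockRep ω hω hS hδ) α β
    rw [h1, h2, block_mul] at h
    have h3 : ∀ j, 𝒞.inner ω hω hS hδ j (α * β) = _ := fun j => congrFun (congrFun h (some j)) none
    simp only [h3]
    rw [h, 𝒞.signedMat_mul ω hω]
    rfl

theorem inner_ofA (j : Fin N) (x : A) : 𝒞.inner ω hω hS hδ j (𝒞.ofA x) = 0 := by
  have h : 𝒞.blockRep ω hω hS hδ (𝒞.ofA x) = _ := 𝒞.extLift_ofA _ _ _ _ _ x
  exact congrFun (congrFun h (some j)) none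

theorem inner_ofΓ (j : Fin N) (ρ : Γ) :
    𝒞.inner ω hω hS hδ j (𝒞.ofΓ ρ) = 𝒞.ofA (𝒞.rcoord ω hS j ρ) := by
  have h : 𝒞.blockRep ω hω hS hδ (𝒞.ofΓ ρ) = _ := 𝒞.extLift_ofΓ _ _ _ _ _ ρ
  exact congrFun (congrFun h (some j)) none

theorem inner_mul (j : Fin N) (α β : 𝒞.Ext) : 𝒞.inner ω hω hS hδ j (α * β) =
    𝒞.inner ω hω hS hδ j α * β +
      ∑ m, 𝒞.extParity (eact δL (𝒞.gc ω hS m j) α) * 𝒞.inner ω hω hS hδ m β := by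
  have h := map_mul (𝒞.blockRep ω hω hS hδ) α β
  rw [𝒞.blockRep_eq ω hω hS hδ α, 𝒞.blockRep_eq ω hω hS hδ β, block_mul] at h
  exact congrFun (congrFun h (some j)) none

include hω hδ in
theorem eact_gc_mem_form (k : ℕ) (i j : Fin N) {α : 𝒞.Ext} (hα : α ∈ 𝒞.form k) :
    eact δL (𝒞.gc ω hS i j) α ∈ 𝒞.form k := by
  induction k generalizing α i j with
  | zero =>
    rw [form_zero] at hα
    obtain ⟨x, rfl⟩ := hα
    rw [eact_ofA hδ]
    exact 𝒞.ofA_mem_form _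
  | succ k ih =>
    refine 𝒞.form_succ_induction (p := fun α => eact δL (𝒞.gc ω hS i j) α ∈ 𝒞.form (k + 1))
      (fun α hα ρ => ?_) (fun α β h1 h2 => ?_) hα
    · rw [𝒞.eact_gc_mul ω hω]
      refine Submodule.sum_mem _ fun m _ => 𝒞.mul_mem_form (ih _ _ hα) ?_
      rw [eact_ofΓ hδ]
      exact 𝒞.ofΓ_mem_form _
    · rw [map_add]; exact add_mem h1 h2

theorem extParity_mem_form (k : ℕ) {α : 𝒞.Ext} (hα : α ∈ 𝒞.form k) :
    𝒞.extParity α ∈ 𝒞.form k := by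
  rw [𝒞.extParity_of_mem hα]
  exact Submodule.smul_mem _ _ hα

theorem inner_mem_form (k : ℕ) (j : Fin N) {α : 𝒞.Ext} (hα : α ∈ 𝒞.form (k + 1)) :
    𝒞.inner ω hω hS hδ j α ∈ 𝒞.form k := by
  induction k generalizing α j with
  | zero =>
    rw [zero_add, form_one] at hα
    obtain ⟨ρ, rfl⟩ := hα
    rw [inner_ofΓ]
    exact 𝒞.ofA_mem_form _
  | succ k ih =>
    refine 𝒞.form_succ_induction (p := fun α => 𝒞.inner ω hω hS hδ j α ∈ 𝒞.form (k + 1))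
      (fun α hα ρ => ?_) (fun α β h1 h2 => ?_) hα
    · rw [inner_mul]
      refine add_mem (𝒞.mul_mem_form (ih _ hα) (𝒞.ofΓ_mem_form ρ)) ?_
      refine Submodule.sum_mem _ fun m _ => ?_
      rw [← add_zero (k + 1)]
      refine 𝒞.mul_mem_form (𝒞.extParity_mem_form _ (𝒞.eact_gc_mem_form ω hω hS hδ _ _ _ hα)) ?_
      rw [inner_ofΓ]
      exact 𝒞.ofA_mem_form _
    · rw [map_add]; exact add_mem h1 h2

theorem lieRf_eq (i j : Fin N) : 𝒞.lieRf ω hS δL i j = eact δL (𝒞.gc ω hS i j) := rfl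

theorem isRightInner_inner : 𝒞.IsRightInner ω hS δL (𝒞.inner ω hω hS hδ) where
  form_zero j α hα := by
    rw [form_zero] at hα
    obtain ⟨x, rfl⟩ := hα
    exact 𝒞.inner_ofA ω hω hS hδ j x
  form_succ j k α hα := 𝒞.inner_mem_form ω hω hS hδ k j hα
  eta i j := by
    rw [inner_ofΓ, 𝒞.rcoord_eta ω hω]
    rcases eq_or_ne i j with rfl | h
    · simp [ofA_one]
    · simp [h, Ne.symm h]
  leibniz j k α hα β := by
    rw [inner_mul, Finset.smul_sum]
    congr 1
    refine Finset.sum_congr rfl fun m _ => ?_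
    rw [𝒞.extParity_of_mem (𝒞.eact_gc_mem_form ω hω hS hδ k m j hα), smul_mul_assoc, lieRf_eq]

end Inner

end BicovariantCalculus

end QuantumCartan
end

/-! ### Covariance, Cartan's formula and quadratic relations of the inner derivatives. -/

noncomputable section

set_option linter.unusedSectionVars false

namespace QuantumCartan

namespace BicovariantCalculus

variable {A : Type*} [Ring A] [HopfAlgebra ℂ A]
  {Γ : Type*} [AddCommGroup Γ] [Module ℂ Γ] [Module A Γ] [Module Aᵐᵒᵖ Γ]
  [SMulCommClass A Aᵐᵒᵖ Γ] [IsScalarTower ℂ A Γ] [IsScalarTower ℂ Aᵐᵒᵖ Γ]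
  (𝒞 : BicovariantCalculus A Γ) {N : ℕ} (ω : Module.Basis (Fin N) A Γ)

/-! #### The matrix coefficients `(1, X; 0, f)` -/

/-- The functional matrix with entries `1`, `Xⱼ`, `0`, `f_{ij}`. -/
def augf : Option (Fin N) → Option (Fin N) → WithConv (A →ₗ[ℂ] ℂ)
  | none, none => 1
  | none, some j => 𝒞.Xc ω j
  | some _, none => 0
  | some i, some j => 𝒞.fc ω i j

theorem augf_one (i j : Option (Fin N)) : 𝒞.augf ω i j 1 = if i = j then 1 else 0 := by
  rcases i with _ | i <;> rcases j with _ | j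
  · simp [augf, one_conv_apply]
  · simp [augf, 𝒞.Xc_one ω]
  · simp [augf]
  · simp [augf, 𝒞.fc_one ω]

/-- The Leibniz rule of `X` and the multiplicativity of `f` become one statement about a
multiplicative matrix. The general inversion by the antipode then yields the formulas for `S(X)` and
`S⁻¹(X)`. -/
theorem augf_mul (hω : ∀ i, 𝒞.IsLeftInvariant (ω i)) (i j : Option (Fin N)) (x y : A) :
    𝒞.augf ω i j (x * y) = ∑ k, 𝒞.augf ω i k x * 𝒞.augf ω k j y := by
  rcases i with _ | i <;> rcases j with _ | j <;>
    simp [augf, Fintype.sum_option, one_conv_apply, 𝒞.Xc_mul ω hω, 𝒞.fc_mul ω hω]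

theorem sum_gc_mul_Xc (hω : ∀ i, 𝒞.IsLeftInvariant (ω i))
    (hS : Function.Bijective (HopfAlgebra.antipode ℂ : A →ₗ[ℂ] A)) (j : Fin N) :
    ∑ k, 𝒞.gc ω hS k j * 𝒞.Xc ω k = -dualSInv hS (𝒞.Xc ω j) := by
  have h := sum_dualSInv_mul hS (𝒞.augf_mul ω hω) (𝒞.augf_one ω) none (some j)
  simp only [Fintype.sum_option, augf, mul_one] at h
  exact eq_neg_of_add_eq_zero_right (by simpa [gc] using h)

theorem fc_Jmat (i j k l : Fin N) : 𝒞.fc ω k j (𝒞.Jmat ω i l) = 𝒞.braid ω i j k l := rfl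

/-- The braid relation between the matrices `f` and `σ`. -/
theorem sum_braid_smul_fc_mul (hω : ∀ i, 𝒞.IsLeftInvariant (ω i)) (i j k l : Fin N) :
    ∑ n, ∑ m, 𝒞.braid ω n m k l • (𝒞.fc ω n i * 𝒞.fc ω m j) =
      ∑ a, ∑ b, 𝒞.braid ω i j a b • (𝒞.fc ω k a * 𝒞.fc ω l b) := by
  refine conv_ext fun x => ?_
  -- Evaluating `f_{kj}` on the relation between `f` and `J` produces the braiding coefficients,
  -- since they are the values `f(J)`.
  have h := congrArg (𝒞.fc ω k j) (𝒞.sum_Jmat_mul_ract ω hω l i x)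
  simp only [map_sum, 𝒞.fc_mul ω hω, ← conv_apply_ract, ← conv_apply_lact, fc_Jmat] at h
  rw [Finset.sum_comm (s := Finset.univ) (t := Finset.univ)
    (f := fun p c => (𝒞.fc ω k c * 𝒞.fc ω l p) x * 𝒞.braid ω i j c p)] at h
  simpa [mul_comm] using h

/-! #### Compatibility of the inner derivatives with the coaction -/

section Covariance

variable (hω : ∀ i, 𝒞.IsLeftInvariant (ω i))
  (hS : Function.Bijective (HopfAlgebra.antipode ℂ : A →ₗ[ℂ] A))
  {δL : 𝒞.Ext →ₐ[ℂ] A ⊗[ℂ] 𝒞.Ext} (hδ : 𝒞.IsExteriorCoaction δL)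

include hω hδ in
-- This is `sum_Jmat_mul_lact_gc` applied to the `A`-leg of the coaction of `α`. It handles the
-- twisted term when the covariance of the inner derivatives is checked on products.
theorem sum_coact_eact_gc (i j : Fin N) (α : 𝒞.Ext) :
    ∑ m, δL (eact δL (𝒞.gc ω hS m j) α) * 𝒞.Jmat ω m i ⊗ₜ[ℂ] 1 =
      ∑ m, 𝒞.Jmat ω j m ⊗ₜ[ℂ] 1 * (eact δL (𝒞.gc ω hS i m)).lTensor A (δL α) := by
  simp only [coact_eact hδ, lTensor_eact_coact hδ]
  generalize δL α = s
  induction s using TensorProduct.induction_on with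
  | zero => simp
  | add p q hp hq => simp only [map_add, add_mul, mul_add, Finset.sum_add_distrib, hp, hq]
  | tmul p q =>
    simp only [LinearMap.rTensor_tmul, Algebra.TensorProduct.tmul_mul_tmul, one_mul, mul_one,
      ← TensorProduct.sum_tmul, 𝒞.sum_Jmat_mul_lact_gc ω hω]

theorem lTensor_inner_mul (i : Fin N) (s t : A ⊗[ℂ] 𝒞.Ext) :
    (𝒞.inner ω hω hS hδ i).lTensor A (s * t) =
      (𝒞.inner ω hω hS hδ i).lTensor A s * t +
        ∑ m, 𝒞.extParity.toLinearMap.lTensor A ((eact δL (𝒞.gc ω hS m i)).lTensor A s) *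
          (𝒞.inner ω hω hS hδ m).lTensor A t := by
  induction s using TensorProduct.induction_on with
  | zero => simp
  | add p q hp hq =>
    simp only [map_add, add_mul, Finset.sum_add_distrib, hp, hq]; abel
  | tmul p q =>
    induction t using TensorProduct.induction_on with
    | zero => simp
    | add p q hp hq =>
      simp only [map_add, mul_add, Finset.sum_add_distrib, hp, hq]; abel
    | tmul u v =>
      simp [𝒞.inner_mul ω hω hS hδ, TensorProduct.tmul_add, TensorProduct.tmul_sum]

/-- The rule passes to products by the twisted Leibniz rule together with `sum_coact_eact_gc`. It is
trivial on `A`, and on `η_l` it reduces to `J S(J) = 1`. -/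
theorem coact_inner (j : Fin N) (α : 𝒞.Ext) : δL (𝒞.inner ω hω hS hδ j α) =
    ∑ i, 𝒞.Jmat ω j i ⊗ₜ[ℂ] 1 * (𝒞.inner ω hω hS hδ i).lTensor A (δL α) := by
  have hA : ∀ j x, δL (𝒞.inner ω hω hS hδ j (𝒞.ofA x)) =
      ∑ i, 𝒞.Jmat ω j i ⊗ₜ[ℂ] 1 * (𝒞.inner ω hω hS hδ i).lTensor A (δL (𝒞.ofA x)) := by
    intro j x
    have : ∀ i, 𝒞.inner ω hω hS hδ i ∘ₗ 𝒞.ofA = 0 := fun i =>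
      LinearMap.ext fun x => 𝒞.inner_ofA ω hω hS hδ i x
    simp [inner_ofA, hδ.ofA, ← LinearMap.lTensor_comp_apply, this]
  have hmul : ∀ α β,
      (∀ j, δL (𝒞.inner ω hω hS hδ j α) =
        ∑ i, 𝒞.Jmat ω j i ⊗ₜ[ℂ] 1 * (𝒞.inner ω hω hS hδ i).lTensor A (δL α)) →
      (∀ j, δL (𝒞.inner ω hω hS hδ j β) =
        ∑ i, 𝒞.Jmat ω j i ⊗ₜ[ℂ] 1 * (𝒞.inner ω hω hS hδ i).lTensor A (δL β)) →
      ∀ j, δL (𝒞.inner ω hω hS hδ j (α * β)) =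
        ∑ i, 𝒞.Jmat ω j i ⊗ₜ[ℂ] 1 * (𝒞.inner ω hω hS hδ i).lTensor A (δL (α * β)) := by
    intro α β h1 h2 j
    rw [inner_mul, map_add, map_mul, h1, map_sum]
    simp only [map_mul, h2, lTensor_inner_mul, mul_add, Finset.sum_add_distrib, Finset.mul_sum,
      Finset.sum_mul, mul_assoc]
    congr 1
    rw [Finset.sum_comm]
    conv_rhs => rw [Finset.sum_comm]
    refine Finset.sum_congr rfl fun m _ => ?_
    simp only [← mul_assoc, ← Finset.sum_mul]
    congr 1
    have h := 𝒞.sum_coact_eact_gc ω hω hS hδ m j (𝒞.extParity α)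
    simp only [← extParity_eact hδ] at h
    rw [h, coact_extParity hδ]
    refine Finset.sum_congr rfl fun i _ => ?_
    congr 1
    rw [← LinearMap.lTensor_comp_apply, ← LinearMap.lTensor_comp_apply]
    congr 2
    ext γ
    simp [extParity_eact hδ]
  induction α using 𝒞.ext_induction generalizing j with
  | hadd α β h1 h2 => simp only [map_add, mul_add, h1, h2, Finset.sum_add_distrib]
  | hmul α β h1 h2 => exact hmul α β h1 h2 j
  | hA x => exact hA j x
  | hΓ ρ =>
    induction ρ using 𝒞.eta_induction ω hω hS with
    | h0 => simp
    | hadd ρ τ h1 h2 => simp only [map_add, mul_add, h1, h2, Finset.sum_add_distrib]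
    | hb a l =>
      rw [ofΓ_op_smul]
      refine hmul _ _ (fun j => ?_) (fun j => hA j a) j
      simp only [inner_ofΓ, 𝒞.rcoord_eta ω hω, hδ.ofΓ, 𝒞.coactL_eta ω hω, map_sum,
        LinearMap.lTensor_tmul, Finset.mul_sum, Algebra.TensorProduct.tmul_mul_tmul, one_mul]
      have : ∀ i k, (𝒞.Jmat ω j i * HopfAlgebra.antipode ℂ (𝒞.Jmat ω k l)) ⊗ₜ[ℂ]
          𝒞.ofA (if i = k then (1 : A) else 0) = if i = k then
          (𝒞.Jmat ω j i * HopfAlgebra.antipode ℂ (𝒞.Jmat ω k l)) ⊗ₜ[ℂ] (1 : 𝒞.Ext) else 0 := by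
        intro i k
        split_ifs <;> simp [ofA_one]
      simp only [this, Finset.sum_ite_eq, Finset.mem_univ, if_true, ← TensorProduct.sum_tmul,
        𝒞.sum_Jmat_mul_antipode ω hω]
      split_ifs <;> simp [ofA_one, Algebra.TensorProduct.one_def]

include hω in
theorem sum_antipodeInv_Jmat_mul (i j : Fin N) :
    ∑ m, antipodeInv hS (𝒞.Jmat ω m j) * 𝒞.Jmat ω i m = if i = j then 1 else 0 := by
  apply hS.1
  simp only [map_sum, HopfAlgebra.antipode_mul_antidistrib, antipode_antipodeInv,
    𝒞.sum_antipode_mul_Jmat ω hω]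
  split_ifs <;> simp

/-- The commutation rule of the inner derivatives with the right action. -/
theorem inner_eact (i : Fin N) (h : WithConv (A →ₗ[ℂ] ℂ)) (α : 𝒞.Ext) :
    𝒞.inner ω hω hS hδ i (eact δL (dualSInv hS h) α) =
      ∑ m, eact δL (dualSInv hS (rtrans (𝒞.Jmat ω i m) h)) (𝒞.inner ω hω hS hδ m α) := by
  simp only [eact_apply _ (𝒞.inner ω hω hS hδ _ _), coact_inner, eact_apply _ α]
  generalize δL α = s
  induction s using TensorProduct.induction_on with
  | zero => simp
  | add p q hp hq => simp only [map_add, mul_add, Finset.sum_add_distrib, hp, hq]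
  | tmul p q =>
    simp only [LinearMap.lTensor_tmul, Algebra.TensorProduct.tmul_mul_tmul, one_mul, map_sum,
      LinearMap.rTensor_tmul, TensorProduct.lid_tmul, map_smul]
    rw [Finset.sum_comm]
    simp only [← Finset.sum_smul]
    -- Translation places `J_{im}` to the right of `S⁻¹(J_{mj} p) = S⁻¹(p) S⁻¹(J_{mj})`, so the
    -- matrix `J` introduced by `coact_inner` is cancelled.
    have key : ∀ j, ∑ m, (dualSInv hS (rtrans (𝒞.Jmat ω i m) h)) (𝒞.Jmat ω m j * p) =
        if i = j then dualSInv hS h p else 0 := by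
      intro j
      simp only [dualSInv_apply, rtrans_apply, antipodeInv_mul, mul_assoc, ← map_sum,
        ← Finset.mul_sum, 𝒞.sum_antipodeInv_Jmat_mul ω hω]
      split_ifs <;> simp
    refine Eq.trans ?_ (Finset.sum_congr rfl fun j _ => congrArg (· • _) (key j).symm)
    simp

end Covariance

/-! #### The exterior differential -/

section Differential

variable {𝒞} {D : 𝒞.Ext →ₗ[ℂ] 𝒞.Ext} (hD : 𝒞.IsExteriorDifferential D)
  {δL : 𝒞.Ext →ₐ[ℂ] A ⊗[ℂ] 𝒞.Ext} (hδ : 𝒞.IsExteriorCoaction δL)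

include hD in
theorem differential_mul (α β : 𝒞.Ext) : D (α * β) = D α * β + 𝒞.extParity α * D β := by
  induction α using 𝒞.homogeneous_induction with
  | h k α hα => rw [hD.leibniz k α hα, 𝒞.extParity_of_mem hα, smul_mul_assoc]
  | h0 => simp
  | hadd α₁ α₂ h1 h2 => simp only [add_mul, map_add, h1, h2]; abel

include hD in
theorem extParity_differential (α : 𝒞.Ext) : 𝒞.extParity (D α) = -D (𝒞.extParity α) := by
  induction α using 𝒞.homogeneous_induction with
  | h k α hα =>
    rw [𝒞.extParity_of_mem hα, 𝒞.extParity_of_mem (hD.mem_form k α hα), map_smul, pow_succ]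
    simp
  | h0 => simp
  | hadd α₁ α₂ h1 h2 => simp only [map_add, h1, h2]; abel

include hD in
theorem lTensor_differential_mul (s t : A ⊗[ℂ] 𝒞.Ext) :
    D.lTensor A (s * t) =
      D.lTensor A s * t + 𝒞.extParity.toLinearMap.lTensor A s * D.lTensor A t := by
  induction s using TensorProduct.induction_on with
  | zero => simp
  | add p q hp hq => simp only [map_add, add_mul, hp, hq]; abel
  | tmul p q =>
    induction t using TensorProduct.induction_on with
    | zero => simp
    | add p q hp hq => simp only [map_add, mul_add, hp, hq]; abel
    | tmul u v => simp [differential_mul hD, TensorProduct.tmul_add]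

include hD hδ in
-- Both sides satisfy the same graded Leibniz rule, so zero-forms and exact one-forms suffice; on
-- the latter both sides vanish because `D² = 0`.
theorem coact_differential (α : 𝒞.Ext) : δL (D α) = D.lTensor A (δL α) := by
  have e1 : D ∘ₗ 𝒞.ofA = 𝒞.ofΓ ∘ₗ 𝒞.d := LinearMap.ext hD.ofA
  have e2 : D ∘ₗ 𝒞.ofΓ ∘ₗ 𝒞.d = 0 := by
    rw [← e1]; exact LinearMap.ext fun x => hD.sq _
  induction α using 𝒞.ext_induction_d with
  | hadd α β h1 h2 => simp only [map_add, h1, h2]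
  | hmul α β h1 h2 =>
    rw [differential_mul hD, map_add, map_mul, map_mul, map_mul, lTensor_differential_mul hD, h1,
      h2, coact_extParity hδ]
  | hA x =>
    rw [hD.ofA, hδ.ofA, hδ.ofΓ, coactL_d, ← LinearMap.lTensor_comp_apply,
      ← LinearMap.lTensor_comp_apply, e1]
  | hd x =>
    rw [← hD.ofA, hD.sq, hD.ofA, hδ.ofΓ, coactL_d, ← LinearMap.lTensor_comp_apply,
      ← LinearMap.lTensor_comp_apply, LinearMap.comp_assoc, e2]
    simp

include hD hδ in
theorem eact_differential (h : WithConv (A →ₗ[ℂ] ℂ)) (α : 𝒞.Ext) :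
    eact δL h (D α) = D (eact δL h α) := by
  rw [eact_apply, eact_apply, coact_differential hD hδ]
  generalize δL α = s
  induction s using TensorProduct.induction_on with
  | zero => simp
  | add p q hp hq => simp only [map_add, hp, hq]
  | tmul p q => simp

end Differential

section CartanFormula

variable {D : 𝒞.Ext →ₗ[ℂ] 𝒞.Ext} (hD : 𝒞.IsExteriorDifferential D)
  (hω : ∀ i, 𝒞.IsLeftInvariant (ω i))
  (hS : Function.Bijective (HopfAlgebra.antipode ℂ : A →ₗ[ℂ] A))
  {δL : 𝒞.Ext →ₐ[ℂ] A ⊗[ℂ] 𝒞.Ext} (hδ : 𝒞.IsExteriorCoaction δL)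

theorem extParity_inner (j : Fin N) (α : 𝒞.Ext) :
    𝒞.extParity (𝒞.inner ω hω hS hδ j α) = -𝒞.inner ω hω hS hδ j (𝒞.extParity α) := by
  induction α using 𝒞.homogeneous_induction with
  | h k α hα =>
    rw [𝒞.extParity_of_mem hα, map_smul]
    rcases k with _ | k
    · rw [form_zero] at hα
      obtain ⟨x, rfl⟩ := hα
      simp [inner_ofA]
    · rw [𝒞.extParity_of_mem (𝒞.inner_mem_form ω hω hS hδ k j hα), pow_succ]
      simp
  | h0 => simp
  | hadd α₁ α₂ h1 h2 => simp only [map_add, h1, h2]; abel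

include hω in
-- In other words `dx = ∑ η_j (x ◁ R_j)`: the functionals `R_j` play for the right basis `η` the
-- role of `X_j` for `ω`. The reason is `ract_Xc` combined with `∑ S⁻¹(f_{kj}) X_k = -S⁻¹(X_j)`.
theorem rcoord_d (j : Fin N) (x : A) :
    𝒞.rcoord ω hS j (𝒞.d x) = -ract (dualSInv hS (𝒞.Xc ω j)) x := by
  rw [rcoord_apply, Finset.sum_comm]
  simp only [𝒞.coord_d ω hω, ← lact_ract, ← 𝒞.ract_Xc ω hω, ← ract_mul]
  rw [← LinearMap.sum_apply, ← map_sum, 𝒞.sum_gc_mul_Xc ω hω, map_neg, LinearMap.neg_apply]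

include hω in
theorem dualSInv_Xc_mul (j : Fin N) (x y : A) : dualSInv hS (𝒞.Xc ω j) (x * y) =
    ∑ k : Option (Fin N), (k.elim (dualSInv hS (𝒞.Xc ω j)) fun k => 𝒞.gc ω hS k j) x *
      (k.elim (1 : WithConv (A →ₗ[ℂ] ℂ)) fun k => dualSInv hS (𝒞.Xc ω k)) y := by
  simp only [Fintype.sum_option, Option.elim, dualSInv_apply, antipodeInv_mul, 𝒞.Xc_mul ω hω, gc,
    one_conv_apply, counit_antipodeInv]
  congr 1
  · exact mul_comm _ _
  · exact Finset.sum_congr rfl fun _ _ => mul_comm _ _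

include hω hδ in
theorem eact_dualSInv_Xc_mul (j : Fin N) (α β : 𝒞.Ext) :
    eact δL (dualSInv hS (𝒞.Xc ω j)) (α * β) = eact δL (dualSInv hS (𝒞.Xc ω j)) α * β +
      ∑ k, eact δL (𝒞.gc ω hS k j) α * eact δL (dualSInv hS (𝒞.Xc ω k)) β := by
  rw [eact_apply_mul (𝒞.dualSInv_Xc_mul ω hω hS j)]
  simp [Fintype.sum_option, eact_one hδ]

include hD in
/-- Cartan's formula. -/
theorem inner_differential_add (j : Fin N) (α : 𝒞.Ext) :
    𝒞.inner ω hω hS hδ j (D α) + D (𝒞.inner ω hω hS hδ j α) =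
      -eact δL (dualSInv hS (𝒞.Xc ω j)) α := by
  have hA : ∀ j x, 𝒞.inner ω hω hS hδ j (D (𝒞.ofA x)) =
      -eact δL (dualSInv hS (𝒞.Xc ω j)) (𝒞.ofA x) := by
    intro j x
    rw [hD.ofA, inner_ofΓ, 𝒞.rcoord_d ω hω, eact_ofA hδ, map_neg]
  -- Both sides obey the same twisted Leibniz rule, since the mixed terms on the left cancel in
  -- pairs. On zero-forms this is `rcoord_d`; on exact one-forms it follows because `D` commutes
  -- with the right action.
  induction α using 𝒞.ext_induction_d generalizing j with
  | hadd α β h1 h2 => rw [map_add, map_add, map_add, map_add, map_add, neg_add, ← h1, ← h2]; abel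
  | hA x => rw [hA, inner_ofA, map_zero, add_zero]
  | hd x =>
    rw [← hD.ofA, hD.sq, map_zero, zero_add, hA, map_neg, eact_differential hD hδ]
  | hmul α β h1 h2 =>
    rw [𝒞.eact_dualSInv_Xc_mul ω hω hS hδ, neg_add, ← Finset.sum_neg_distrib]
    rw [← neg_mul, ← h1]
    simp only [← mul_neg, ← h2]
    rw [ differential_mul hD, map_add, inner_mul, inner_mul, inner_mul, map_add,
      map_sum, differential_mul hD]
    simp only [differential_mul hD, mul_add, add_mul, Finset.sum_add_distrib,
      eact_differential hD hδ, extParity_differential hD, extParity_inner, extParity_eact hδ,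
      extParity_extParity, neg_mul, Finset.sum_neg_distrib]
    abel

end CartanFormula

/-! #### Quadratic relations of the inner derivatives -/

section Quadratic

theorem sum_comm_three {M ι : Type*} [Fintype ι] [AddCommMonoid M] (f : ι → ι → ι → M) :
    ∑ i, ∑ j, ∑ k, f i j k = ∑ k, ∑ i, ∑ j, f i j k := by
  rw [Finset.sum_comm' (t' := Finset.univ) (s' := fun _ => Finset.univ) (by simp)]
  rw [Finset.sum_congr rfl fun j _ => Finset.sum_comm, Finset.sum_comm]
  exact Finset.sum_congr rfl fun k _ => Finset.sum_comm

theorem sum_comm_four {M ι : Type*} [Fintype ι] [AddCommMonoid M] (f : ι → ι → ι → ι → M) :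
    ∑ i, ∑ j, ∑ k, ∑ l, f i j k l = ∑ l, ∑ k, ∑ i, ∑ j, f i j k l := by
  rw [sum_comm_three fun i j k => ∑ l, f i j k l,
    Finset.sum_congr rfl fun k _ => sum_comm_three (f · · k ·), Finset.sum_comm]

/-- The `w i` are only known to satisfy relations with scalar coefficients. Expanding the `u i` in a
basis of `V` reduces to that case: each family of coordinates is again fixed by `s`. -/
theorem sum_bilin_eq_zero_of_forall {ι V W R : Type*} [Fintype ι] [AddCommGroup V] [Module ℂ V]
    [AddCommGroup W] [Module ℂ W] [AddCommGroup R] [Module ℂ R] (B : V →ₗ[ℂ] W →ₗ[ℂ] R)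
    (s : ι → ι → ℂ) (u : ι → V) (w : ι → W) (hu : ∀ k, ∑ i, s i k • u i = u k)
    (hw : ∀ c : ι → ℂ, (∀ k, ∑ i, c i * s i k = c k) → ∑ i, c i • w i = 0) :
    ∑ i, B (u i) (w i) = 0 := by
  classical
  let e := Module.Basis.ofVectorSpace ℂ V
  let F := Finset.univ.biUnion fun i => (e.repr (u i)).support
  have h1 : ∀ i, u i = ∑ x ∈ F, e.repr (u i) x • e x := by
    intro i
    conv_lhs => rw [← e.linearCombination_repr (u i)]
    rw [Finsupp.linearCombination_apply, Finsupp.sum]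
    refine Finset.sum_subset
      (Finset.subset_biUnion_of_mem (fun i => (e.repr (u i)).support) (Finset.mem_univ i)) ?_
    intro x _ hx
    rw [Finsupp.notMem_support_iff.1 hx, zero_smul]
  have h2 : ∀ i, B (u i) (w i) = ∑ x ∈ F, B (e x) (e.repr (u i) x • w i) := by
    intro i
    conv_lhs => rw [h1 i]
    rw [map_sum, LinearMap.sum_apply]
    exact Finset.sum_congr rfl fun x _ => by rw [map_smul, map_smul, LinearMap.smul_apply]
  simp only [h2]
  rw [Finset.sum_comm]
  refine Finset.sum_eq_zero fun x _ => ?_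
  rw [← map_sum, hw, map_zero]
  intro k
  conv_rhs => rw [← hu k]
  simp [mul_comm]

variable (hω : ∀ i, 𝒞.IsLeftInvariant (ω i))
  (hS : Function.Bijective (HopfAlgebra.antipode ℂ : A →ₗ[ℂ] A))
  {δL : 𝒞.Ext →ₐ[ℂ] A ⊗[ℂ] 𝒞.Ext} (hδ : 𝒞.IsExteriorCoaction δL)

include hω in
theorem rtrans_Jmat_fc (i m k j : Fin N) :
    rtrans (𝒞.Jmat ω i m) (𝒞.fc ω k j) = ∑ n, 𝒞.braid ω i j n m • 𝒞.fc ω k n :=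
  conv_ext fun x => by
    simp [𝒞.fc_mul ω hω, mul_comm, fc_Jmat]

/-- On a product four groups of terms arise. The first is the relation for the left factor. The two
mixed groups cancel up to the sign of moving an odd operator past the parity. The last is the
relation for the right factor with functionals as coefficients. -/
theorem inner_inner (c : Fin N → Fin N → ℂ)
    (hc : ∀ k l, ∑ i, ∑ j, c i j * 𝒞.braid ω i j k l = c k l) (α : 𝒞.Ext) :
    ∑ i, ∑ j, c i j • 𝒞.inner ω hω hS hδ i (𝒞.inner ω hω hS hδ j α) = 0 := by
  induction α using 𝒞.ext_induction generalizing c with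
  | hadd α β h1 h2 => simp only [map_add, smul_add, Finset.sum_add_distrib, h1 c hc, h2 c hc, add_zero]
  | hA x => simp [inner_ofA]
  | hΓ ρ => simp [inner_ofΓ, inner_ofA]
  | hmul α β h1 h2 =>
    -- Moving an inner derivative past `◁ S⁻¹(f)` produces a factor `σ`, which is absorbed because
    -- `c` is fixed by `σ`.
    have mid : ∀ m, ∑ i, ∑ j, c i j • eact δL (𝒞.gc ω hS m i) (𝒞.inner ω hω hS hδ j α) =
        ∑ i, ∑ j, c i j • 𝒞.inner ω hω hS hδ i (eact δL (𝒞.gc ω hS m j) α) := by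
      intro m
      simp only [gc, 𝒞.inner_eact ω hω hS hδ, 𝒞.rtrans_Jmat_fc ω hω, map_sum, map_smul,
        LinearMap.sum_apply, LinearMap.smul_apply, Finset.smul_sum, smul_smul]
      rw [sum_comm_four]
      simp only [← Finset.sum_smul, hc]
    -- The functionals `∑ c_{ij} f_{ki} f_{lj}` are fixed by `σ` by the braid relation for `f`, so
    -- the relation for `β` holds with them as coefficients.
    have last : ∑ n, ∑ m, (∑ i, ∑ j, c i j •
        𝒞.extParity (eact δL (𝒞.gc ω hS n i) (𝒞.extParity (eact δL (𝒞.gc ω hS m j) α)))) *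
          𝒞.inner ω hω hS hδ n (𝒞.inner ω hω hS hδ m β) = 0 := by
      have h := sum_bilin_eq_zero_of_forall
        (LinearMap.mul ℂ 𝒞.Ext ∘ₗ (eact δL).flip α ∘ₗ dualSInv hS)
        (fun p q : Fin N × Fin N => 𝒞.braid ω p.1 p.2 q.1 q.2)
        (fun p => ∑ i, ∑ j, c i j • (𝒞.fc ω p.1 i * 𝒞.fc ω p.2 j))
        (fun p => 𝒞.inner ω hω hS hδ p.1 (𝒞.inner ω hω hS hδ p.2 β)) ?_ ?_
      · rw [Fintype.sum_prod_type] at h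
        simpa [extParity_eact hδ, dualSInv_mul, eact_mul hδ, gc, Finset.sum_mul] using h
      · rintro ⟨k, l⟩
        rw [Fintype.sum_prod_type]
        simp only [Finset.smul_sum, smul_smul]
        rw [sum_comm_four (f := fun n m i j => (𝒞.braid ω n m k l * c i j) •
          (𝒞.fc ω n i * 𝒞.fc ω m j)), Finset.sum_comm]
        simp only [mul_comm _ (c _ _), ← smul_smul, ← Finset.smul_sum,
          𝒞.sum_braid_smul_fc_mul ω hω]
        simp only [Finset.smul_sum, smul_smul]
        rw [sum_comm_four, Finset.sum_comm]
        simp only [← Finset.sum_smul, hc]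
      · intro c' hc'
        rw [Fintype.sum_prod_type]
        refine h2 (fun i j => c' (i, j)) fun k l => ?_
        have := hc' (k, l)
        rwa [Fintype.sum_prod_type] at this
    have t1 : ∑ i, ∑ j, c i j •
        (𝒞.inner ω hω hS hδ i (𝒞.inner ω hω hS hδ j α) * β) = 0 := by
      simp only [← smul_mul_assoc, ← Finset.sum_mul, h1 c hc, zero_mul]
    have t2 : ∑ i, ∑ j, ∑ m, c i j •
        (𝒞.extParity (eact δL (𝒞.gc ω hS m i) (𝒞.inner ω hω hS hδ j α)) *
          𝒞.inner ω hω hS hδ m β) = ∑ m, 𝒞.extParity (∑ i, ∑ j, c i j •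
            eact δL (𝒞.gc ω hS m i) (𝒞.inner ω hω hS hδ j α)) * 𝒞.inner ω hω hS hδ m β := by
      rw [sum_comm_three]
      simp only [map_sum, map_smul, Finset.sum_mul, smul_mul_assoc]
    have t3 : ∑ i, ∑ j, ∑ m, c i j •
        (𝒞.inner ω hω hS hδ i (𝒞.extParity (eact δL (𝒞.gc ω hS m j) α)) *
          𝒞.inner ω hω hS hδ m β) = -∑ m, 𝒞.extParity (∑ i, ∑ j, c i j •
            𝒞.inner ω hω hS hδ i (eact δL (𝒞.gc ω hS m j) α)) * 𝒞.inner ω hω hS hδ m β := by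
      rw [sum_comm_three]
      simp only [map_sum, map_smul, Finset.sum_mul, smul_mul_assoc, extParity_inner, smul_neg,
        Finset.sum_neg_distrib, neg_neg, neg_mul]
    have t4 : ∑ i, ∑ j, ∑ m, ∑ n, c i j •
        (𝒞.extParity (eact δL (𝒞.gc ω hS n i) (𝒞.extParity (eact δL (𝒞.gc ω hS m j) α))) *
          𝒞.inner ω hω hS hδ n (𝒞.inner ω hω hS hδ m β)) = 0 := by
      rw [sum_comm_four, ← last]
      simp only [Finset.sum_mul, smul_mul_assoc]
    simp only [inner_mul, map_add, map_sum, smul_add, Finset.smul_sum, Finset.sum_add_distrib]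
    rw [t1, t2, t3, t4, Finset.sum_congr rfl fun m _ => by rw [mid m]]
    abel

end Quadratic

end BicovariantCalculus

end QuantumCartan
end

/-! ### The even algebra `U`: coproduct, translations and antipode. -/

noncomputable section

set_option linter.unusedSectionVars false

namespace QuantumCartan

namespace BicovariantCalculus

variable {A : Type*} [Ring A] [HopfAlgebra ℂ A]
  {Γ : Type*} [AddCommGroup Γ] [Module ℂ Γ] [Module A Γ] [Module Aᵐᵒᵖ Γ]
  [SMulCommClass A Aᵐᵒᵖ Γ] [IsScalarTower ℂ A Γ] [IsScalarTower ℂ Aᵐᵒᵖ Γ]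
  (𝒞 : BicovariantCalculus A Γ) {N : ℕ} (ω : Module.Basis (Fin N) A Γ)

/-! #### The even algebra as a Hopf algebra of functionals -/

section Pairing

variable (U : Subalgebra ℂ (WithConv (A →ₗ[ℂ] ℂ)))

/-- The pairing of `U ⊗ U` with `A × A`. -/
def pairing : U ⊗[ℂ] U →ₗ[ℂ] A →ₗ[ℂ] A →ₗ[ℂ] ℂ :=
  TensorProduct.lift (LinearMap.mk₂ ℂ
    (fun h k : U => LinearMap.mk₂ ℂ (fun x y => h.1 x * k.1 y)
      (fun x y z => by simp [add_mul]) (fun c x y => by simp [mul_assoc])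
      (fun x y z => by simp [mul_add]) (fun c x y => by simp; ring))
    (fun h h' k => by ext; simp [add_mul]) (fun c h k => by ext; simp [mul_assoc])
    (fun h k k' => by ext; simp [mul_add]) (fun c h k => by ext; simp; ring))

@[simp] theorem pairing_tmul (h k : U) (x y : A) : pairing U (h ⊗ₜ k) x y = h.1 x * k.1 y := rfl

/-- Expand the second factor in a basis of `U`: evaluation at `x` and then at `y` separates the
coefficients. The coproduct of `U` is thereby unique, and identities in `U ⊗ U` can be checked on
values. -/
theorem pairing_injective {t t' : U ⊗[ℂ] U} (ht : ∀ x y, pairing U t x y = pairing U t' x y) :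
    t = t' := by
  classical
  let e := Module.Basis.ofVectorSpace ℂ U
  let Φ := TensorProduct.equivFinsuppOfBasisRight (M := U) e
  obtain ⟨b, rfl⟩ := Φ.symm.surjective t
  obtain ⟨c, rfl⟩ := Φ.symm.surjective t'
  let ev : A → U →ₗ[ℂ] ℂ := fun x =>
    { toFun := fun h => h.1 x, map_add' := fun _ _ => rfl, map_smul' := fun _ _ => rfl }
  have key : ∀ t x y, pairing U t x y =
      (Finsupp.linearCombination ℂ e (Finsupp.mapRange.linearMap (ev x) (Φ t))).1 y := by
    intro t x y
    induction t using TensorProduct.induction_on with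
    | zero =>
      rw [LinearMap.map_zero, LinearEquiv.map_zero, LinearMap.map_zero, LinearMap.map_zero]
      rfl
    | add p q hp hq =>
      rw [LinearMap.map_add, LinearEquiv.map_add, LinearMap.map_add, LinearMap.map_add,
        LinearMap.add_apply, LinearMap.add_apply, hp, hq]
      rfl
    | tmul h k =>
      have : Finsupp.mapRange.linearMap (ev x) (Φ (h ⊗ₜ k)) = h.1 x • e.repr k := by
        ext i
        simp only [Φ, ev, Finsupp.mapRange.linearMap_apply, Finsupp.mapRange_apply,
          TensorProduct.equivFinsuppOfBasisRight_apply_tmul_apply, map_smul, Finsupp.smul_apply,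
          smul_eq_mul, mul_comm]
        rfl
      rw [this, map_smul, e.linearCombination_repr]
      rfl
  congr 1
  ext1 i
  refine Subtype.ext (conv_ext fun x => ?_)
  have h : Finsupp.linearCombination ℂ e (Finsupp.mapRange.linearMap (ev x) b) =
      Finsupp.linearCombination ℂ e (Finsupp.mapRange.linearMap (ev x) c) := by
    refine Subtype.ext (conv_ext fun y => ?_)
    have := ht x y
    rwa [key, key, Φ.apply_symm_apply, Φ.apply_symm_apply] at this
  have h2 := DFunLike.congr_fun (congrArg e.repr h) i
  rw [e.repr_linearCombination, e.repr_linearCombination] at h2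
  exact h2

end Pairing

section EvenAlg

variable (hω : ∀ i, 𝒞.IsLeftInvariant (ω i))

theorem Xc_mem (i : Fin N) : 𝒞.Xc ω i ∈ 𝒞.evenAlg ω := (𝒞.evenX ω i).2

theorem fc_mem (i j : Fin N) : 𝒞.fc ω i j ∈ 𝒞.evenAlg ω := (𝒞.evenF ω i j).2

theorem augf_mem (i j : Option (Fin N)) : 𝒞.augf ω i j ∈ 𝒞.evenAlg ω := by
  rcases i with _ | i <;> rcases j with _ | j
  · exact one_mem _
  · exact 𝒞.Xc_mem ω j
  · exact zero_mem _
  · exact 𝒞.fc_mem ω i j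

/-- The entries of the matrix `(1, X; 0, f)` in the even algebra. -/
def evenAug (i j : Option (Fin N)) : 𝒞.evenAlg ω := ⟨𝒞.augf ω i j, 𝒞.augf_mem ω i j⟩

theorem evenAlg_induction {p : 𝒞.evenAlg ω → Prop} (hX : ∀ i, p (𝒞.evenX ω i))
    (hf : ∀ i j, p (𝒞.evenF ω i j)) (h1 : p 1) (hsmul : ∀ (c : ℂ) h, p h → p (c • h))
    (hadd : ∀ h k, p h → p k → p (h + k)) (hmul : ∀ h k, p h → p k → p (h * k))
    (h : 𝒞.evenAlg ω) : p h := by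
  have key : ∀ h (hh : h ∈ 𝒞.evenAlg ω), p ⟨h, hh⟩ := by
    intro h hh
    induction hh using Algebra.adjoin_induction with
    | mem h hh =>
      rcases hh with ⟨i, rfl⟩ | ⟨⟨i, j⟩, rfl⟩
      · exact hX i
      · exact hf i j
    | algebraMap r =>
      have e : ∀ h : 𝒞.evenAlg ω, h.1 = algebraMap ℂ (WithConv (A →ₗ[ℂ] ℂ)) r → p h := by
        intro h hh
        have : h = r • 1 := Subtype.ext (by
          rw [hh, Algebra.algebraMap_eq_smul_one, SetLike.val_smul, OneMemClass.coe_one])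
        rw [this]
        exact hsmul r 1 h1
      exact e _ rfl
    | add h k hh hk h1 h2 => exact hadd ⟨h, hh⟩ ⟨k, hk⟩ h1 h2
    | mul h k hh hk h1 h2 => exact hmul ⟨h, hh⟩ ⟨k, hk⟩ h1 h2
  exact key h.1 h.2

theorem lact_mul_of_split {ι : Type*} [Fintype ι] {h k : WithConv (A →ₗ[ℂ] ℂ)}
    {B : A →ₗ[ℂ] A →ₗ[ℂ] ℂ} (hB : ∀ x y, h (x * y) = B x y)
    {a b : ι → WithConv (A →ₗ[ℂ] ℂ)} (hab : ∀ x y, k (x * y) = ∑ s, a s x * b s y) (x y : A) :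
    (h * k) (x * y) = ∑ s, B (lact (a s) x) (lact (b s) y) := by
  rw [conv_apply_lact, lact_apply_mul hab, map_sum]
  simp only [hB]

/-- The coproduct of `A` is multiplicative, so if two functionals split on products through tensors
`s` and `t`, their convolution splits through `s * t`. This is both the closure step of
`exists_pairing_eq` and the multiplicativity of the coproduct of `U`. -/
theorem pairing_mul (U : Subalgebra ℂ (WithConv (A →ₗ[ℂ] ℂ))) (s t : U ⊗[ℂ] U)
    {h k : WithConv (A →ₗ[ℂ] ℂ)} (hs : ∀ x y, h (x * y) = pairing U s x y)
    (ht : ∀ x y, k (x * y) = pairing U t x y) (x y : A) :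
    (h * k) (x * y) = pairing U (s * t) x y := by
  obtain ⟨n, a, b, rfl⟩ := TensorProduct.exists_sum_tmul_eq t
  rw [lact_mul_of_split hs (a := fun i => (a i).1) (b := fun i => (b i).1)
    (fun x y => by simp [ht])]
  simp only [Finset.mul_sum, map_sum, LinearMap.sum_apply]
  refine Finset.sum_congr rfl fun i _ => ?_
  clear hs
  induction s using TensorProduct.induction_on with
  | zero => simp
  | add p q hp hq => simp only [map_add, add_mul, LinearMap.add_apply, hp, hq]
  | tmul c d =>
    rw [Algebra.TensorProduct.tmul_mul_tmul, pairing_tmul, pairing_tmul, MulMemClass.coe_mul,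
      MulMemClass.coe_mul, conv_apply_lact, conv_apply_lact]

include hω in
-- The generators split on products through the entries of the matrix `(1, X; 0, f)`, and splitting
-- is preserved by the algebra operations.
theorem exists_pairing_eq (h : 𝒞.evenAlg ω) :
    ∃ t : 𝒞.evenAlg ω ⊗[ℂ] 𝒞.evenAlg ω, ∀ x y, h.1 (x * y) = pairing _ t x y := by
  have haug : ∀ i j, ∃ t : 𝒞.evenAlg ω ⊗[ℂ] 𝒞.evenAlg ω,
      ∀ x y, (𝒞.augf ω i j) (x * y) = pairing _ t x y := fun i j =>
    ⟨∑ k, 𝒞.evenAug ω i k ⊗ₜ 𝒞.evenAug ω k j, fun x y => by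
      rw [𝒞.augf_mul ω hω]
      simp only [map_sum, LinearMap.sum_apply, pairing_tmul]
      rfl⟩
  induction h using 𝒞.evenAlg_induction ω with
  | hX i => exact haug none (some i)
  | hf i j => exact haug (some i) (some j)
  | h1 => exact haug none none
  | hsmul c h ih =>
    obtain ⟨t, ht⟩ := ih
    exact ⟨c • t, fun x y => by simp [ht]⟩
  | hadd h k ih1 ih2 =>
    obtain ⟨t, ht⟩ := ih1
    obtain ⟨s, hs⟩ := ih2
    exact ⟨t + s, fun x y => by simp [ht, hs]⟩
  | hmul h k ih1 ih2 =>
    obtain ⟨t, ht⟩ := ih1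
    obtain ⟨s, hs⟩ := ih2
    exact ⟨t * s, pairing_mul _ t s ht hs⟩

/-- The coproduct of the even algebra as a function. -/
def comulFun (h : 𝒞.evenAlg ω) : 𝒞.evenAlg ω ⊗[ℂ] 𝒞.evenAlg ω :=
  (𝒞.exists_pairing_eq ω hω h).choose

theorem pairing_comulFun (h : 𝒞.evenAlg ω) (x y : A) :
    pairing _ (𝒞.comulFun ω hω h) x y = h.1 (x * y) :=
  ((𝒞.exists_pairing_eq ω hω h).choose_spec x y).symm

/-- The coproduct of the even algebra. -/
def comulU : 𝒞.evenAlg ω →ₐ[ℂ] 𝒞.evenAlg ω ⊗[ℂ] 𝒞.evenAlg ω :=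
  AlgHom.ofLinearMap
    { toFun := 𝒞.comulFun ω hω
      map_add' := fun h k => pairing_injective _ fun x y => by simp [pairing_comulFun]
      map_smul' := fun c h => pairing_injective _ fun x y => by simp [pairing_comulFun] }
    (pairing_injective _ fun x y => by
      change pairing _ (𝒞.comulFun ω hω 1) x y = _
      rw [pairing_comulFun, Algebra.TensorProduct.one_def, pairing_tmul]
      simp [one_conv_apply])
    (fun h k => pairing_injective _ fun x y => by
      change pairing _ (𝒞.comulFun ω hω (h * k)) x y = _
      rw [pairing_comulFun]
      exact pairing_mul _ _ _ (fun x y => (𝒞.pairing_comulFun ω hω h x y).symm)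
        (fun x y => (𝒞.pairing_comulFun ω hω k x y).symm) x y)

theorem pairing_comulU (h : 𝒞.evenAlg ω) (x y : A) :
    pairing _ (𝒞.comulU ω hω h) x y = h.1 (x * y) :=
  𝒞.pairing_comulFun ω hω h x y

theorem comulU_evenAug (i j : Option (Fin N)) :
    𝒞.comulU ω hω (𝒞.evenAug ω i j) = ∑ k, 𝒞.evenAug ω i k ⊗ₜ 𝒞.evenAug ω k j :=
  pairing_injective _ fun x y => by
    rw [pairing_comulU, map_sum]
    simp only [LinearMap.sum_apply, pairing_tmul]
    exact 𝒞.augf_mul ω hω i j x y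

theorem comulU_evenF (i j : Fin N) :
    𝒞.comulU ω hω (𝒞.evenF ω i j) = ∑ k, 𝒞.evenF ω i k ⊗ₜ 𝒞.evenF ω k j := by
  refine (𝒞.comulU_evenAug ω hω (some i) (some j)).trans ?_
  have : 𝒞.evenAug ω (some i) none = 0 := rfl
  rw [Fintype.sum_option, this, TensorProduct.zero_tmul, zero_add]
  rfl

theorem comulU_evenX (j : Fin N) :
    𝒞.comulU ω hω (𝒞.evenX ω j) = 1 ⊗ₜ 𝒞.evenX ω j + ∑ k, 𝒞.evenX ω k ⊗ₜ 𝒞.evenF ω k j := by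
  refine (𝒞.comulU_evenAug ω hω none (some j)).trans ?_
  rw [Fintype.sum_option]
  rfl

include hω in
-- A translate of `h` is its coproduct with one leg evaluated at `y`. Stability under translation is
-- what allows the relations of `C_Γ` to be written for all of `U` at once.
theorem rtrans_mem (y : A) (h : 𝒞.evenAlg ω) : rtrans y h.1 ∈ 𝒞.evenAlg ω := by
  obtain ⟨n, a, b, ht⟩ := TensorProduct.exists_sum_tmul_eq (𝒞.comulU ω hω h)
  have : rtrans y h.1 = ∑ i, ((b i).1 y) • (a i).1 := conv_ext fun x => by
    rw [rtrans_apply, ← 𝒞.pairing_comulU ω hω, ht]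
    simp [mul_comm]
  rw [this]
  exact sum_mem fun i _ => Subalgebra.smul_mem _ (a i).2 _

include hω in
theorem ltrans_mem (y : A) (h : 𝒞.evenAlg ω) : ltrans y h.1 ∈ 𝒞.evenAlg ω := by
  obtain ⟨n, a, b, ht⟩ := TensorProduct.exists_sum_tmul_eq (𝒞.comulU ω hω h)
  have : ltrans y h.1 = ∑ i, ((a i).1 y) • (b i).1 := conv_ext fun x => by
    rw [ltrans_apply, ← 𝒞.pairing_comulU ω hω, ht]
    simp
  rw [this]
  exact sum_mem fun i _ => Subalgebra.smul_mem _ (b i).2 _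

/-- Right translation on the even algebra. -/
def evenR (y : A) : 𝒞.evenAlg ω →ₗ[ℂ] 𝒞.evenAlg ω where
  toFun h := ⟨rtrans y h.1, 𝒞.rtrans_mem ω hω y h⟩
  map_add' h k := Subtype.ext (map_add (rtrans y) h.1 k.1)
  map_smul' c h := Subtype.ext (map_smul (rtrans y) c h.1)

/-- Left translation on the even algebra. -/
def evenL (y : A) : 𝒞.evenAlg ω →ₗ[ℂ] 𝒞.evenAlg ω where
  toFun h := ⟨ltrans y h.1, 𝒞.ltrans_mem ω hω y h⟩
  map_add' h k := Subtype.ext (map_add (ltrans y) h.1 k.1)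
  map_smul' c h := Subtype.ext (map_smul (ltrans y) c h.1)

@[simp] theorem coe_evenR (y : A) (h : 𝒞.evenAlg ω) : (𝒞.evenR ω hω y h).1 = rtrans y h.1 := rfl

@[simp] theorem coe_evenL (y : A) (h : 𝒞.evenAlg ω) : (𝒞.evenL ω hω y h).1 = ltrans y h.1 := rfl

theorem comulU_evenR (y : A) (h : 𝒞.evenAlg ω) : 𝒞.comulU ω hω (𝒞.evenR ω hω y h) =
    (𝒞.evenR ω hω y).lTensor _ (𝒞.comulU ω hω h) := by
  refine pairing_injective _ fun x z => ?_
  have key : ∀ t, pairing _ ((𝒞.evenR ω hω y).lTensor _ t) x z = pairing _ t x (z * y) := by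
    intro t
    induction t using TensorProduct.induction_on with
    | zero => simp
    | add p q hp hq => simp only [map_add, LinearMap.add_apply, hp, hq]
    | tmul p q => simp
  rw [key, pairing_comulU, pairing_comulU]
  simp [mul_assoc]

/-- Both sides have the value `h(x y z)` at `(x, z)`. -/
theorem rTensor_evenR_comulU (y : A) (h : 𝒞.evenAlg ω) :
    (𝒞.evenR ω hω y).rTensor _ (𝒞.comulU ω hω h) =
      (𝒞.evenL ω hω y).lTensor _ (𝒞.comulU ω hω h) := by
  refine pairing_injective _ fun x z => ?_
  have key : ∀ t, pairing _ ((𝒞.evenR ω hω y).rTensor _ t) x z = pairing _ t (x * y) z := by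
    intro t
    induction t using TensorProduct.induction_on with
    | zero => simp
    | add p q hp hq => simp only [map_add, LinearMap.add_apply, hp, hq]
    | tmul p q => simp
  have key2 : ∀ t, pairing _ ((𝒞.evenL ω hω y).lTensor _ t) x z = pairing _ t x (y * z) := by
    intro t
    induction t using TensorProduct.induction_on with
    | zero => simp
    | add p q hp hq => simp only [map_add, LinearMap.add_apply, hp, hq]
    | tmul p q => simp
  rw [key, key2, pairing_comulU, pairing_comulU, mul_assoc]

include hω in
/-- The exchange relation between the `f` and the functionals. -/
theorem sum_fc_mul_ltrans (j k : Fin N) (h : WithConv (A →ₗ[ℂ] ℂ)) :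
    ∑ i, 𝒞.fc ω i k * ltrans (𝒞.Jmat ω i j) h = ∑ l, rtrans (𝒞.Jmat ω k l) h * 𝒞.fc ω j l := by
  refine conv_ext fun x => ?_
  -- The functional `h` is evaluated on the relation between `f` and `J` at `x`.
  have e := congrArg h (𝒞.sum_Jmat_mul_ract ω hω j k x)
  simp only [map_sum] at e
  simpa [conv_apply_ract (𝒞.fc ω _ _), conv_apply_lact _ (𝒞.fc ω _ _)] using e

include hω in
-- The coproduct of `J` is matrix multiplication, so translation by `J` is an algebra map into
-- matrices of functionals. Hence the rule `ξ_i h = ∑ h(· J_{im}) ξ_m` is compatible with products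
-- of `h`.
theorem rtrans_Jmat_mul (i m : Fin N) (h k : WithConv (A →ₗ[ℂ] ℂ)) :
    rtrans (𝒞.Jmat ω i m) (h * k) =
      ∑ p, rtrans (𝒞.Jmat ω i p) h * rtrans (𝒞.Jmat ω p m) k := by
  refine conv_ext fun x => ?_
  have e : lact k (x * 𝒞.Jmat ω i m) = ∑ p, lact (rtrans (𝒞.Jmat ω p m) k) x * 𝒞.Jmat ω i p := by
    simp only [lact_apply, Bialgebra.comul_mul, 𝒞.comul_Jmat ω hω]
    generalize Coalgebra.comul (R := ℂ) x = s
    induction s using TensorProduct.induction_on with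
    | zero => simp
    | add p q hp hq => simp only [add_mul, map_add, hp, hq, Finset.sum_add_distrib]
    | tmul p q => simp [Finset.mul_sum]
  rw [rtrans_apply, conv_apply_lact, e, map_sum, ofConv_sum, LinearMap.sum_apply]
  exact Finset.sum_congr rfl fun p _ => (conv_apply_lact (rtrans (𝒞.Jmat ω i p) h) _ x).symm

include hω in
theorem rtrans_Jmat_one (i m : Fin N) :
    rtrans (𝒞.Jmat ω i m) (1 : WithConv (A →ₗ[ℂ] ℂ)) = if i = m then 1 else 0 := by
  refine conv_ext fun x => ?_
  rw [rtrans_apply, one_conv_apply, Bialgebra.counit_mul, 𝒞.counit_Jmat ω hω]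
  split_ifs <;> simp [one_conv_apply]

include hω in
-- Together with `rtrans_Jmat_fc` it shows that the relations of `C_Γ` for `ξ_i f_{kj}` and for `ξ_i
-- X_j` are one rule. The structure constants come from the term `ε(x) X_j(J_{im})` of the Leibniz
-- rule.
theorem rtrans_Jmat_Xc (i m j : Fin N) : rtrans (𝒞.Jmat ω i m) (𝒞.Xc ω j) =
    ∑ k, 𝒞.braid ω i j k m • 𝒞.Xc ω k + 𝒞.structConst ω i j m • 1 := by
  refine conv_ext fun x => ?_
  rw [rtrans_apply, 𝒞.Xc_mul ω hω]
  have : 𝒞.Xc ω j (𝒞.Jmat ω i m) = 𝒞.structConst ω i j m := rfl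
  simp [fc_Jmat, mul_comm, one_conv_apply, this, add_comm]

end EvenAlg

/-! ### Stability of `U` under `S` and `S⁻¹`. -/

section EvenAntipode

variable (hω : ∀ i, 𝒞.IsLeftInvariant (ω i))
  (hS : Function.Bijective (HopfAlgebra.antipode ℂ : A →ₗ[ℂ] A))
  (hc : 𝒞.IsSCompatible ω)

theorem dualS_Xc (hω : ∀ i, 𝒞.IsLeftInvariant (ω i)) (i : Fin N) :
    dualS (𝒞.Xc ω i) = -∑ j, 𝒞.Xc ω j * dualS (𝒞.fc ω j i) := by
  have h := sum_mul_dualS (𝒞.augf_mul ω hω) (𝒞.augf_one ω) none (some i)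
  simp only [Fintype.sum_option, augf, one_mul] at h
  exact eq_neg_of_add_eq_zero_left (by simpa using h)

include hω hc in
theorem dualS_mem (h : 𝒞.evenAlg ω) : dualS h.1 ∈ 𝒞.evenAlg ω := by
  induction h using 𝒞.evenAlg_induction ω with
  | hX i =>
    change dualS (𝒞.Xc ω i) ∈ _
    rw [𝒞.dualS_Xc ω hω]
    exact neg_mem (sum_mem fun j _ => mul_mem (𝒞.Xc_mem ω j) (hc j i))
  | hf i j => exact hc i j
  | h1 => rw [OneMemClass.coe_one, dualS_one]; exact one_mem _
  | hsmul c h ih =>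
    rw [SetLike.val_smul, map_smul]; exact Subalgebra.smul_mem _ ih _
  | hadd h k ih1 ih2 => rw [AddMemClass.coe_add, map_add]; exact add_mem ih1 ih2
  | hmul h k ih1 ih2 => rw [MulMemClass.coe_mul, dualS_mul]; exact mul_mem ih2 ih1

/-- The matrix `∑ₘ f_{rm}(S(J_{jm}))`, which implements the square of the antipode. -/
def sqMat (r j : Fin N) : ℂ := ∑ m, dualS (𝒞.fc ω r m) (𝒞.Jmat ω j m)

/-- The inverse of `sqMat`. -/
def sqMatInv (j x : Fin N) : ℂ := ∑ p, 𝒞.gc ω hS j p (antipodeInv hS (𝒞.Jmat ω x p))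

include hω in
theorem dualS_fc_mul (i j : Fin N) (x y : A) : dualS (𝒞.fc ω i j) (x * y) =
    ∑ k, dualS (𝒞.fc ω k j) x * dualS (𝒞.fc ω i k) y := by
  simp only [dualS_apply, HopfAlgebra.antipode_mul_antidistrib, 𝒞.fc_mul ω hω]
  exact Finset.sum_congr rfl fun k _ => mul_comm _ _

include hω in
-- The exchange relation is used at `S(f_{pj})` and summed over `j`. On one side the translates
-- supply `sqMat`; on the other `S(f)` meets `f` and contracts to the identity.
theorem sum_sqMat_smul_fc_mul_dualS (p k : Fin N) :
    ∑ i, ∑ r, 𝒞.sqMat ω r i • (𝒞.fc ω i k * dualS (𝒞.fc ω p r)) = 𝒞.sqMat ω p k • 1 := by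
  have h := Finset.sum_congr rfl fun j (_ : j ∈ Finset.univ) =>
    𝒞.sum_fc_mul_ltrans ω hω j k (dualS (𝒞.fc ω p j))
  have hl : ∀ y j, ltrans y (dualS (𝒞.fc ω p j)) =
      ∑ r, dualS (𝒞.fc ω r j) y • dualS (𝒞.fc ω p r) := fun y j => conv_ext fun x => by
    rw [ltrans_apply, 𝒞.dualS_fc_mul ω hω]; simp
  have hr : ∀ y j, rtrans y (dualS (𝒞.fc ω p j)) =
      ∑ r, dualS (𝒞.fc ω p r) y • dualS (𝒞.fc ω r j) := fun y j => conv_ext fun x => by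
    rw [rtrans_apply, 𝒞.dualS_fc_mul ω hω]; simp [mul_comm]
  have h1 : ∑ j, ∑ i, 𝒞.fc ω i k * ltrans (𝒞.Jmat ω i j) (dualS (𝒞.fc ω p j)) =
      ∑ i, ∑ r, 𝒞.sqMat ω r i • (𝒞.fc ω i k * dualS (𝒞.fc ω p r)) := by
    rw [Finset.sum_comm]
    simp only [hl, Finset.mul_sum, sqMat, Finset.sum_smul, mul_smul_comm]
    exact Finset.sum_congr rfl fun i _ => Finset.sum_comm
  have h2 : ∑ j, ∑ l, rtrans (𝒞.Jmat ω k l) (dualS (𝒞.fc ω p j)) * 𝒞.fc ω j l =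
      𝒞.sqMat ω p k • 1 := by
    rw [Finset.sum_comm]
    simp only [hr, Finset.sum_mul, smul_mul_assoc]
    rw [sqMat, Finset.sum_smul]
    refine Finset.sum_congr rfl fun l _ => ?_
    rw [Finset.sum_comm]
    simp only [← Finset.smul_sum, sum_dualS_mul (𝒞.fc_mul ω hω) (𝒞.fc_one ω)]
    simp
  rw [← h1, ← h2, h]

include hω in
-- With `Q = sqMat` this is the matrix identity `Q S⁻¹(f) = S(f) Q`. It comes from applying `S⁻¹` to
-- the preceding relation and cancelling `f` with `S(f)`.
theorem sum_sqMat_smul_gc (a k : Fin N) :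
    ∑ i, 𝒞.sqMat ω a i • 𝒞.gc ω hS i k = ∑ p, 𝒞.sqMat ω p k • dualS (𝒞.fc ω a p) := by
  have h : ∀ p, ∑ i, ∑ r, 𝒞.sqMat ω r i • (𝒞.fc ω p r * 𝒞.gc ω hS i k) = 𝒞.sqMat ω p k • 1 := by
    intro p
    have := congrArg (dualSInv hS) (𝒞.sum_sqMat_smul_fc_mul_dualS ω hω p k)
    simpa [dualSInv_mul, gc] using this
  have h2 : ∀ p, 𝒞.sqMat ω p k • dualS (𝒞.fc ω a p) =
      ∑ i, ∑ r, 𝒞.sqMat ω r i • (dualS (𝒞.fc ω a p) * 𝒞.fc ω p r * 𝒞.gc ω hS i k) := by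
    intro p
    have := congrArg (dualS (𝒞.fc ω a p) * ·) (h p)
    simp only [Finset.mul_sum, mul_smul_comm, mul_one, ← mul_assoc] at this
    exact this.symm
  simp only [h2]
  rw [Finset.sum_comm]
  refine Finset.sum_congr rfl fun i _ => ?_
  rw [Finset.sum_comm]
  simp only [← Finset.smul_sum, ← Finset.sum_mul,
    sum_dualS_mul (𝒞.fc_mul ω hω) (𝒞.fc_one ω)]
  simp

include hω in
-- Evaluate `Q S⁻¹(f) = S(f) Q` at `S⁻¹(J_{xk})` and sum over `k`: the right side becomes a value of
-- `f` on `J S(J) = 1`.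
theorem sum_sqMat_mul_sqMatInv (a x : Fin N) :
    ∑ i, 𝒞.sqMat ω a i * 𝒞.sqMatInv ω hS i x = if a = x then 1 else 0 := by
  have h := Finset.sum_congr rfl fun k (_ : k ∈ Finset.univ) => congrArg
    (fun h : WithConv (A →ₗ[ℂ] ℂ) => h (antipodeInv hS (𝒞.Jmat ω x k)))
    (𝒞.sum_sqMat_smul_gc ω hω hS a k)
  have h1 : ∀ k m, ∑ p, 𝒞.fc ω a p (𝒞.Jmat ω x k) *
      𝒞.fc ω p m (HopfAlgebra.antipode ℂ (𝒞.Jmat ω k m)) =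
      𝒞.fc ω a m (𝒞.Jmat ω x k * HopfAlgebra.antipode ℂ (𝒞.Jmat ω k m)) := fun k m =>
    (𝒞.fc_mul ω hω a m _ _).symm
  have h2 : ∑ k, ∑ p, 𝒞.sqMat ω p k * 𝒞.fc ω a p (𝒞.Jmat ω x k) = if a = x then 1 else 0 := by
    simp only [sqMat, dualS_apply, Finset.sum_mul]
    have : ∀ k, ∑ p, ∑ m, 𝒞.fc ω p m (HopfAlgebra.antipode ℂ (𝒞.Jmat ω k m)) *
        𝒞.fc ω a p (𝒞.Jmat ω x k) =
        ∑ m, 𝒞.fc ω a m (𝒞.Jmat ω x k * HopfAlgebra.antipode ℂ (𝒞.Jmat ω k m)) := fun k => by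
      rw [Finset.sum_comm]
      simp only [← h1, mul_comm]
    simp only [this]
    rw [Finset.sum_comm]
    simp only [← map_sum, 𝒞.sum_Jmat_mul_antipode ω hω]
    rw [Finset.sum_eq_single x]
    · simp [𝒞.fc_one ω]
    · intro m _ hm; simp [Ne.symm hm]
    · simp
  rw [← h2]
  simp only [sqMatInv, Finset.mul_sum]
  rw [Finset.sum_comm]
  simpa using h

include hω hc in
-- Since `Q` is invertible, `S⁻¹(f) = Q⁻¹ S(f) Q` is a scalar combination of the `S(f)`. So
-- `S`-compatibility, which speaks only of `S`, also controls `S⁻¹`.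
theorem gc_mem (i j : Fin N) : 𝒞.gc ω hS i j ∈ 𝒞.evenAlg ω := by
  have h : Matrix.of (𝒞.sqMatInv ω hS) * Matrix.of (𝒞.sqMat ω) = 1 := by
    refine mul_eq_one_comm.1 ?_
    ext a x
    simp [Matrix.mul_apply, 𝒞.sum_sqMat_mul_sqMatInv ω hω, Matrix.one_apply]
  have e : 𝒞.gc ω hS i j =
      ∑ a, 𝒞.sqMatInv ω hS i a • ∑ k, 𝒞.sqMat ω a k • 𝒞.gc ω hS k j := by
    simp only [Finset.smul_sum, smul_smul]
    rw [Finset.sum_comm]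
    have : ∀ k, ∑ a, 𝒞.sqMatInv ω hS i a * 𝒞.sqMat ω a k = if i = k then 1 else 0 := fun k => by
      have := congrFun (congrFun h i) k
      rwa [Matrix.mul_apply, Matrix.one_apply] at this
    simp [← Finset.sum_smul, this]
  rw [e]
  refine sum_mem fun a _ => Subalgebra.smul_mem _ ?_ _
  rw [𝒞.sum_sqMat_smul_gc ω hω]
  exact sum_mem fun p _ => Subalgebra.smul_mem _ (hc a p) _

include hω hc in
theorem dualSInv_mem (h : 𝒞.evenAlg ω) : dualSInv hS h.1 ∈ 𝒞.evenAlg ω := by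
  induction h using 𝒞.evenAlg_induction ω with
  | hX i =>
    change dualSInv hS (𝒞.Xc ω i) ∈ _
    rw [← neg_mem_iff, ← 𝒞.sum_gc_mul_Xc ω hω]
    exact sum_mem fun j _ => mul_mem (𝒞.gc_mem ω hω hS hc j i) (𝒞.Xc_mem ω j)
  | hf i j => exact 𝒞.gc_mem ω hω hS hc i j
  | h1 => rw [OneMemClass.coe_one, dualSInv_one]; exact one_mem _
  | hsmul c h ih =>
    rw [SetLike.val_smul, map_smul]; exact Subalgebra.smul_mem _ ih _
  | hadd h k ih1 ih2 => rw [AddMemClass.coe_add, map_add]; exact add_mem ih1 ih2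
  | hmul h k ih1 ih2 => rw [MulMemClass.coe_mul, dualSInv_mul]; exact mul_mem ih2 ih1

/-- The antipode of the even algebra. -/
def evenS : 𝒞.evenAlg ω →ₗ[ℂ] 𝒞.evenAlg ω where
  toFun h := ⟨dualS h.1, 𝒞.dualS_mem ω hω hc h⟩
  map_add' h k := Subtype.ext (map_add dualS h.1 k.1)
  map_smul' c h := Subtype.ext (map_smul dualS c h.1)

/-- The inverse antipode of the even algebra. -/
def evenSInv : 𝒞.evenAlg ω →ₗ[ℂ] 𝒞.evenAlg ω where
  toFun h := ⟨dualSInv hS h.1, 𝒞.dualSInv_mem ω hω hS hc h⟩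
  map_add' h k := Subtype.ext (map_add (dualSInv hS) h.1 k.1)
  map_smul' c h := Subtype.ext (map_smul (dualSInv hS) c h.1)

@[simp] theorem coe_evenS (h : 𝒞.evenAlg ω) : (𝒞.evenS ω hω hc h).1 = dualS h.1 := rfl

@[simp] theorem coe_evenSInv (h : 𝒞.evenAlg ω) :
    (𝒞.evenSInv ω hω hS hc h).1 = dualSInv hS h.1 := rfl

end EvenAntipode

end BicovariantCalculus

end QuantumCartan
end

/-! ### Presentation of `C_Γ`, its parity, and graded anti-homomorphisms. -/

noncomputable section

set_option linter.unusedSectionVars false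

namespace QuantumCartan

namespace BicovariantCalculus

variable {A : Type*} [Ring A] [HopfAlgebra ℂ A]
  {Γ : Type*} [AddCommGroup Γ] [Module ℂ Γ] [Module A Γ] [Module Aᵐᵒᵖ Γ]
  [SMulCommClass A Aᵐᵒᵖ Γ] [IsScalarTower ℂ A Γ] [IsScalarTower ℂ Aᵐᵒᵖ Γ]
  (𝒞 : BicovariantCalculus A Γ) {N : ℕ} (ω : Module.Basis (Fin N) A Γ)

/-! #### The quantum Cartan algebra: basic relations and universal property -/

section CartanBasics

/-- The even algebra inside the quantum Cartan algebra. -/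
def cev : 𝒞.evenAlg ω →ₐ[ℂ] 𝒞.Cartan ω where
  toFun h := 𝒞.cmk ω (𝒞.ev ω h)
  map_one' := by
    have := 𝒞.cmk_rel ω (CartanRel.ev_algebraMap 1)
    rwa [map_one, map_one, map_one] at this
  map_mul' h k := by rw [𝒞.cmk_rel ω (.ev_mul h k), map_mul]
  map_zero' := by
    have := 𝒞.cmk_rel ω (CartanRel.ev_algebraMap 0)
    rwa [map_zero, map_zero, map_zero] at this
  map_add' h k := by rw [𝒞.cmk_rel ω (.ev_add h k), map_add]
  commutes' c := by rw [𝒞.cmk_rel ω (.ev_algebraMap c), AlgHom.commutes]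

theorem cev_evenF (i j : Fin N) : 𝒞.cev ω (𝒞.evenF ω i j) = 𝒞.cf ω i j := rfl

theorem cev_evenX (i : Fin N) : 𝒞.cev ω (𝒞.evenX ω i) = 𝒞.cX ω i := rfl

theorem cdelta_mul_cdelta : 𝒞.cdelta ω * 𝒞.cdelta ω = 0 := by
  have := 𝒞.cmk_rel ω .delta_delta
  rwa [map_mul, map_zero] at this

theorem cxi_mul_cdelta (i : Fin N) :
    𝒞.cxi ω i * 𝒞.cdelta ω + 𝒞.cdelta ω * 𝒞.cxi ω i = 𝒞.cev ω (𝒞.evenX ω i) := by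
  have := 𝒞.cmk_rel ω (.xi_delta i)
  rwa [map_add, map_mul, map_mul] at this

theorem sum_cxi_mul_cxi (c : Fin N → Fin N → ℂ)
    (hc : ∀ k l, ∑ i, ∑ j, c i j * 𝒞.braid ω i j k l = c k l) :
    ∑ i, ∑ j, c i j • (𝒞.cxi ω i * 𝒞.cxi ω j) = 0 := by
  have := 𝒞.cmk_rel ω (.xi_xi c hc)
  simp only [map_sum, map_smul, map_mul, map_zero] at this
  exact this

theorem cev_mul_cdelta (h : 𝒞.evenAlg ω) :
    𝒞.cev ω h * 𝒞.cdelta ω = 𝒞.cdelta ω * 𝒞.cev ω h := by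
  induction h using 𝒞.evenAlg_induction ω with
  | hX i =>
    have := 𝒞.cmk_rel ω (.X_delta i)
    rwa [map_mul, map_mul] at this
  | hf i j =>
    have := 𝒞.cmk_rel ω (.f_delta i j)
    rwa [map_mul, map_mul] at this
  | h1 => rw [map_one, one_mul, mul_one]
  | hsmul c h ih => rw [map_smul, smul_mul_assoc, mul_smul_comm, ih]
  | hadd h k ih1 ih2 => rw [map_add, add_mul, mul_add, ih1, ih2]
  | hmul h k ih1 ih2 => rw [map_mul, mul_assoc, ih2, ← mul_assoc, ih1, mul_assoc]

variable (hω : ∀ i, 𝒞.IsLeftInvariant (ω i))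

theorem evenR_Jmat_evenF (i m k j : Fin N) : 𝒞.evenR ω hω (𝒞.Jmat ω i m) (𝒞.evenF ω k j) =
    ∑ n, 𝒞.braid ω i j n m • 𝒞.evenF ω k n :=
  Subtype.ext <| by
    rw [coe_evenR, AddSubmonoidClass.coe_finsetSum]
    exact 𝒞.rtrans_Jmat_fc ω hω i m k j

theorem evenR_Jmat_evenX (i m j : Fin N) : 𝒞.evenR ω hω (𝒞.Jmat ω i m) (𝒞.evenX ω j) =
    ∑ k, 𝒞.braid ω i j k m • 𝒞.evenX ω k + 𝒞.structConst ω i j m • 1 :=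
  Subtype.ext <| by
    rw [coe_evenR, AddMemClass.coe_add, AddSubmonoidClass.coe_finsetSum]
    exact 𝒞.rtrans_Jmat_Xc ω hω i m j

theorem evenR_Jmat_one (i m : Fin N) : 𝒞.evenR ω hω (𝒞.Jmat ω i m) 1 = if i = m then 1 else 0 :=
  Subtype.ext <| by
    rw [coe_evenR, OneMemClass.coe_one, 𝒞.rtrans_Jmat_one ω hω]
    split_ifs <;> rfl

theorem evenR_Jmat_mul (i m : Fin N) (h k : 𝒞.evenAlg ω) :
    𝒞.evenR ω hω (𝒞.Jmat ω i m) (h * k) =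
      ∑ p, 𝒞.evenR ω hω (𝒞.Jmat ω i p) h * 𝒞.evenR ω hω (𝒞.Jmat ω p m) k :=
  Subtype.ext <| by
    rw [coe_evenR, MulMemClass.coe_mul, AddSubmonoidClass.coe_finsetSum]
    exact 𝒞.rtrans_Jmat_mul ω hω i m h.1 k.1

/-- The defining relations are the cases `h = X_j` and `h = f_{kj}`; products follow because
translation by `J` is a matrix-valued algebra map. -/
theorem cxi_mul_cev (i : Fin N) (h : 𝒞.evenAlg ω) : 𝒞.cxi ω i * 𝒞.cev ω h =
    ∑ m, 𝒞.cev ω (𝒞.evenR ω hω (𝒞.Jmat ω i m) h) * 𝒞.cxi ω m := by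
  induction h using 𝒞.evenAlg_induction ω generalizing i with
  | hX j =>
    have := 𝒞.cmk_rel ω (.xi_X i j)
    simp only [map_add, map_mul, map_sum, map_smul] at this
    simp only [evenR_Jmat_evenX, map_add, map_sum, map_smul, add_mul, Finset.sum_add_distrib,
      Finset.sum_mul, smul_mul_assoc, map_one, one_mul]
    rw [Finset.sum_comm]
    exact this
  | hf k j =>
    have := 𝒞.cmk_rel ω (.xi_f i k j)
    simp only [map_mul, map_sum, map_smul] at this
    simp only [evenR_Jmat_evenF, map_sum, map_smul, Finset.sum_mul, smul_mul_assoc]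
    rw [Finset.sum_comm]
    exact this
  | h1 => simp [evenR_Jmat_one, apply_ite (𝒞.cev ω)]
  | hsmul c h ih => simp only [map_smul, mul_smul_comm, smul_mul_assoc, ih, Finset.smul_sum]
  | hadd h k ih1 ih2 => simp only [map_add, mul_add, add_mul, ih1, ih2, Finset.sum_add_distrib]
  | hmul h k ih1 ih2 =>
    simp only [map_mul, evenR_Jmat_mul, map_sum, Finset.sum_mul]
    rw [← mul_assoc, ih1, Finset.sum_mul, Finset.sum_comm]
    refine Finset.sum_congr rfl fun p _ => ?_
    rw [mul_assoc, ih2, Finset.mul_sum]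
    exact Finset.sum_congr rfl fun m _ => (mul_assoc _ _ _).symm

theorem cartan_induction {p : 𝒞.Cartan ω → Prop} (h1 : p 1) (hadd : ∀ x y, p x → p y → p (x + y))
    (hev : ∀ h x, p x → p (𝒞.cev ω h * x)) (hxi : ∀ i x, p x → p (𝒞.cxi ω i * x))
    (hdelta : ∀ x, p x → p (𝒞.cdelta ω * x)) (x : 𝒞.Cartan ω) : p x := by
  obtain ⟨a, rfl⟩ : ∃ a, 𝒞.cmk ω a = x := RingQuot.mkAlgHom_surjective ℂ (𝒞.CartanRel ω) x
  have key : ∀ a y, p y → p (𝒞.cmk ω a * y) := by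
    intro a
    induction a using FreeAlgebra.induction with
    | grade0 r =>
      intro y hy
      have := hev (algebraMap ℂ _ r) y hy
      rwa [AlgHom.commutes] at this ⊢
    | grade1 g =>
      intro y hy
      cases g with
      | even h => exact hev h y hy
      | xi i => exact hxi i y hy
      | delta => exact hdelta y hy
    | mul a b iha ihb =>
      intro y hy
      rw [map_mul, mul_assoc]
      exact iha _ (ihb _ hy)
    | add a b iha ihb =>
      intro y hy
      rw [map_add, add_mul]
      exact hadd _ _ (iha _ hy) (ihb _ hy)
  have := key a 1 h1
  rwa [mul_one] at this

theorem cartan_hom_ext {B : Type*} [Ring B] [Algebra ℂ B] {f g : 𝒞.Cartan ω →ₐ[ℂ] B}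
    (hev : ∀ h, f (𝒞.cev ω h) = g (𝒞.cev ω h)) (hxi : ∀ i, f (𝒞.cxi ω i) = g (𝒞.cxi ω i))
    (hdelta : f (𝒞.cdelta ω) = g (𝒞.cdelta ω)) : f = g := by
  ext x
  induction x using 𝒞.cartan_induction ω with
  | h1 => simp
  | hadd x y hx hy => rw [map_add, map_add, hx, hy]
  | hev h x hx => rw [map_mul, map_mul, hx, hev]
  | hxi i x hx => rw [map_mul, map_mul, hx, hxi]
  | hdelta x hx => rw [map_mul, map_mul, hx, hdelta]

/-- Images of the generators under a homomorphism. -/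
def liftGen {B : Type*} (ψ : 𝒞.evenAlg ω → B) (x : Fin N → B) (d : B) : 𝒞.CartanGen ω → B
  | .even h => ψ h
  | .xi i => x i
  | .delta => d

/-- The hypothesis `hx` replaces the separate relations of `ξ` with `f` and with `X`. The coproduct,
the counit, the antipode and the action on forms are all obtained from this property. -/
theorem exists_cartan_hom {B : Type*} [Ring B] [Algebra ℂ B] (ψ : 𝒞.evenAlg ω →ₐ[ℂ] B)
    (x : Fin N → B) (d : B)
    (hx : ∀ i h, x i * ψ h = ∑ m, ψ (𝒞.evenR ω hω (𝒞.Jmat ω i m) h) * x m)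
    (hd : ∀ h, ψ h * d = d * ψ h) (hxd : ∀ i, x i * d + d * x i = ψ (𝒞.evenX ω i))
    (hdd : d * d = 0)
    (hxx : ∀ c : Fin N → Fin N → ℂ,
      (∀ k l, ∑ i, ∑ j, c i j * 𝒞.braid ω i j k l = c k l) →
        ∑ i, ∑ j, c i j • (x i * x j) = 0) :
    ∃ f : 𝒞.Cartan ω →ₐ[ℂ] B, (∀ h, f (𝒞.cev ω h) = ψ h) ∧ (∀ i, f (𝒞.cxi ω i) = x i) ∧
      f (𝒞.cdelta ω) = d := by
  have hrel : ∀ ⦃a b⦄, 𝒞.CartanRel ω a b → FreeAlgebra.lift ℂ (𝒞.liftGen ω ψ x d) a =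
      FreeAlgebra.lift ℂ (𝒞.liftGen ω ψ x d) b := by
    intro a b h
    cases h with
    | ev_add h k => simp [liftGen]
    | ev_mul h k => simp [liftGen]
    | ev_algebraMap c => simp [liftGen]
    | xi_xi c hc => simpa [liftGen] using hxx c hc
    | xi_delta i => simpa [liftGen] using hxd i
    | delta_delta => simpa [liftGen] using hdd
    | xi_f i k j =>
      have := hx i (𝒞.evenF ω k j)
      simp only [evenR_Jmat_evenF, map_sum, map_smul, Finset.sum_mul, smul_mul_assoc] at this
      rw [Finset.sum_comm] at this
      simpa [liftGen] using this
    | xi_X i j =>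
      have := hx i (𝒞.evenX ω j)
      simp only [evenR_Jmat_evenX, map_add, map_sum, map_smul, add_mul, Finset.sum_add_distrib,
        Finset.sum_mul, smul_mul_assoc, map_one, one_mul] at this
      rw [Finset.sum_comm] at this
      simpa [liftGen] using this
    | f_delta i j => simpa [liftGen] using hd (𝒞.evenF ω i j)
    | X_delta i => simpa [liftGen] using hd (𝒞.evenX ω i)
  let f : 𝒞.Cartan ω →ₐ[ℂ] B :=
    (RingQuot.liftAlgHom ℂ ⟨FreeAlgebra.lift ℂ (𝒞.liftGen ω ψ x d), hrel⟩ :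
      RingQuot (𝒞.CartanRel ω) →ₐ[ℂ] B)
  have hf : ∀ a, f (𝒞.cmk ω a) = FreeAlgebra.lift ℂ (𝒞.liftGen ω ψ x d) a := fun a =>
    RingQuot.liftAlgHom_mkAlgHom_apply ℂ _ _ _
  refine ⟨f, fun h => ?_, fun i => ?_, ?_⟩
  · exact (hf _).trans (FreeAlgebra.lift_ι_apply _ _)
  · exact (hf _).trans (FreeAlgebra.lift_ι_apply _ _)
  · exact (hf _).trans (FreeAlgebra.lift_ι_apply _ _)

end CartanBasics

/-! #### Parity -/

section Parity

@[simp] theorem parity_cev (h : 𝒞.evenAlg ω) : 𝒞.parity ω (𝒞.cev ω h) = 𝒞.cev ω h :=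
  (𝒞.parity_cmk ω _).trans (FreeAlgebra.lift_ι_apply _ _)

@[simp] theorem parity_cxi (i : Fin N) : 𝒞.parity ω (𝒞.cxi ω i) = -𝒞.cxi ω i :=
  (𝒞.parity_cmk ω _).trans (FreeAlgebra.lift_ι_apply _ _)

@[simp] theorem parity_cdelta : 𝒞.parity ω (𝒞.cdelta ω) = -𝒞.cdelta ω :=
  (𝒞.parity_cmk ω _).trans (FreeAlgebra.lift_ι_apply _ _)

theorem mem_part_zero {x : 𝒞.Cartan ω} : x ∈ 𝒞.part ω 0 ↔ 𝒞.parity ω x = x := by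
  rw [mem_part]; simp

theorem mem_part_one {x : 𝒞.Cartan ω} : x ∈ 𝒞.part ω 1 ↔ 𝒞.parity ω x = -x := by
  rw [mem_part, ZMod.val_one]; simp

theorem cev_mem_part (h : 𝒞.evenAlg ω) : 𝒞.cev ω h ∈ 𝒞.part ω 0 := by
  rw [mem_part_zero, parity_cev]

theorem cxi_mem_part (i : Fin N) : 𝒞.cxi ω i ∈ 𝒞.part ω 1 := by
  rw [mem_part_one, parity_cxi]

theorem cdelta_mem_part : 𝒞.cdelta ω ∈ 𝒞.part ω 1 := by
  rw [mem_part_one, parity_cdelta]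

theorem exists_part_decomp (x : 𝒞.Cartan ω) :
    ∃ x₀ ∈ 𝒞.part ω 0, ∃ x₁ ∈ 𝒞.part ω 1, x = x₀ + x₁ := by
  refine ⟨(2⁻¹ : ℂ) • (x + 𝒞.parity ω x), ?_, (2⁻¹ : ℂ) • (x - 𝒞.parity ω x), ?_, ?_⟩
  · rw [mem_part_zero, map_smul, map_add, parity_parity, add_comm]
  · rw [mem_part_one, map_smul, map_sub, parity_parity]; module
  · module

variable {𝒞 ω}
variable {B : Type*} [Ring B] [Algebra ℂ B] {φ : 𝒞.Cartan ω →ₗ[ℂ] B}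
  (hφ : 𝒞.IsGradedAntiHom ω φ)

include hφ in
theorem IsGradedAntiHom.mul_even {x : 𝒞.Cartan ω} (hx : x ∈ 𝒞.part ω 0) (y : 𝒞.Cartan ω) :
    φ (x * y) = φ y * φ x := by
  obtain ⟨y₀, h0, y₁, h1, rfl⟩ := 𝒞.exists_part_decomp ω y
  have e0 := hφ.mul 0 0 x hx y₀ h0
  have e1 := hφ.mul 0 1 x hx y₁ h1
  simp only [ZMod.val_zero, zero_mul, pow_zero, one_smul] at e0 e1
  rw [mul_add, map_add, e0, e1, map_add, add_mul]

include hφ in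
theorem IsGradedAntiHom.mul_odd {x : 𝒞.Cartan ω} (hx : x ∈ 𝒞.part ω 1) (y : 𝒞.Cartan ω) :
    φ (x * y) = φ (𝒞.parity ω y) * φ x := by
  obtain ⟨y₀, h0, y₁, h1, rfl⟩ := 𝒞.exists_part_decomp ω y
  have e0 := hφ.mul 1 0 x hx y₀ h0
  have e1 := hφ.mul 1 1 x hx y₁ h1
  rw [mem_part_zero] at h0
  rw [mem_part_one] at h1
  simp only [ZMod.val_zero, ZMod.val_one, mul_zero, mul_one, pow_zero, pow_one, one_smul,
    neg_smul] at e0 e1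
  rw [mul_add, map_add, e0, e1, map_add, h0, h1, map_add, map_neg, add_mul, neg_mul]

include hφ in
theorem IsGradedAntiHom.mul_even_right (x : 𝒞.Cartan ω) {y : 𝒞.Cartan ω} (hy : y ∈ 𝒞.part ω 0) :
    φ (x * y) = φ y * φ x := by
  obtain ⟨x₀, h0, x₁, h1, rfl⟩ := 𝒞.exists_part_decomp ω x
  have e0 := hφ.mul 0 0 x₀ h0 y hy
  have e1 := hφ.mul 1 0 x₁ h1 y hy
  simp only [ZMod.val_zero, mul_zero, pow_zero, one_smul] at e0 e1
  rw [add_mul, map_add, e0, e1, map_add, mul_add]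

include hφ in
theorem IsGradedAntiHom.mul_odd_right (x : 𝒞.Cartan ω) {y : 𝒞.Cartan ω} (hy : y ∈ 𝒞.part ω 1) :
    φ (x * y) = φ y * φ (𝒞.parity ω x) := by
  obtain ⟨x₀, h0, x₁, h1, rfl⟩ := 𝒞.exists_part_decomp ω x
  have e0 := hφ.mul 0 1 x₀ h0 y hy
  have e1 := hφ.mul 1 1 x₁ h1 y hy
  rw [mem_part_zero] at h0
  rw [mem_part_one] at h1
  simp only [ZMod.val_zero, ZMod.val_one, zero_mul, mul_one, pow_zero, pow_one, one_smul,
    neg_smul] at e0 e1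
  rw [add_mul, map_add, e0, e1, map_add, h0, h1, map_add, map_neg, mul_add, mul_neg]

end Parity

/-! #### The antipode -/

section Antipode

variable (hω : ∀ i, 𝒞.IsLeftInvariant (ω i))

/-- An ordinary anti-homomorphism that respects parity becomes a graded one when its odd part is
multiplied by `-i`: the factor `(-i)² = -1` is the sign for two odd elements. So the universal
property, applied to the opposite algebra, is enough. -/
theorem exists_gradedAntiHom (s : 𝒞.evenAlg ω →ₗ[ℂ] 𝒞.evenAlg ω) (hs1 : s 1 = 1)
    (hs : ∀ h k, s (h * k) = s k * s h) (t : Fin N → 𝒞.Cartan ω) (ht : ∀ i, t i ∈ 𝒞.part ω 1)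
    (hst : ∀ i h, 𝒞.cev ω (s h) * t i =
      ∑ m, t m * 𝒞.cev ω (s (𝒞.evenR ω hω (𝒞.Jmat ω i m) h)))
    (htd : ∀ i, t i * 𝒞.cdelta ω + 𝒞.cdelta ω * t i = 𝒞.cev ω (s (𝒞.evenX ω i)))
    (htt : ∀ c : Fin N → Fin N → ℂ,
      (∀ k l, ∑ i, ∑ j, c i j * 𝒞.braid ω i j k l = c k l) →
        ∑ i, ∑ j, c i j • (t j * t i) = 0) :
    ∃ T : 𝒞.Cartan ω →ₗ[ℂ] 𝒞.Cartan ω, 𝒞.IsGradedAntiHom ω T ∧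
      (∀ h, T (𝒞.cev ω h) = 𝒞.cev ω (s h)) ∧ (∀ i, T (𝒞.cxi ω i) = t i) ∧
      T (𝒞.cdelta ω) = -𝒞.cdelta ω ∧ ∀ x, 𝒞.parity ω (T x) = T (𝒞.parity ω x) := by
  let ψ₀ : 𝒞.evenAlg ω →ₐ[ℂ] (𝒞.Cartan ω)ᵐᵒᵖ := AlgHom.ofLinearMap
    ((opLinearEquiv ℂ).toLinearMap ∘ₗ (𝒞.cev ω).toLinearMap ∘ₗ s)
    (by simp [hs1]) (fun h k => by simp [hs])
  have hψ₀ : ∀ h, ψ₀ h = op (𝒞.cev ω (s h)) := fun h => rfl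
  -- The scalars `i` and `-i` are chosen so that the later factor `-i` gives `ξ_i ↦ t_i` and `δ ↦
  -- -δ`; their product is `1`, which preserves the relation of `ξ_i` with `δ`.
  obtain ⟨ψ, h1, h2, h3⟩ := 𝒞.exists_cartan_hom ω hω ψ₀ (fun i => op (Complex.I • t i))
    (op (-Complex.I • 𝒞.cdelta ω))
    (fun i h => by
      simp only [hψ₀, ← op_mul, ← Finset.op_sum]
      congr 1
      simp only [mul_smul_comm, smul_mul_assoc, hst, Finset.smul_sum])
    (fun h => by
      simp only [hψ₀, ← op_mul]
      congr 1
      rw [smul_mul_assoc, mul_smul_comm, cev_mul_cdelta])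
    (fun i => by
      simp only [hψ₀, ← op_mul, ← op_add]
      congr 1
      rw [smul_mul_smul_comm, smul_mul_smul_comm, ← htd]
      simp [add_comm])
    (by
      rw [← op_mul, smul_mul_smul_comm, cdelta_mul_cdelta, smul_zero, op_zero])
    (fun c hc => by
      simp only [← op_mul, ← op_smul, ← Finset.op_sum, smul_mul_smul_comm, Complex.I_mul_I, neg_smul,
        one_smul, smul_neg, Finset.sum_neg_distrib]
      rw [htt c hc, neg_zero, op_zero])
  have hp : ∀ x, 𝒞.parity ω (unop (ψ x)) = unop (ψ (𝒞.parity ω x)) := by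
    intro x
    have : (AlgHom.op (𝒞.parity ω)).comp ψ = ψ.comp (𝒞.parity ω) := by
      refine 𝒞.cartan_hom_ext ω (fun h => ?_) (fun i => ?_) ?_
      · simp [h1, hψ₀]
      · simp [h2, 𝒞.mem_part_one ω |>.1 (ht i)]
      · simp [h3]
    exact congrArg unop (DFunLike.congr_fun this x)
  -- The two coefficients have sum `1` and difference `-i`, so `T` is `ψ` on the even part and `-i
  -- ψ` on the odd part.
  let T : 𝒞.Cartan ω →ₗ[ℂ] 𝒞.Cartan ω := (opLinearEquiv ℂ).symm.toLinearMap ∘ₗ ψ.toLinearMap ∘ₗ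
    (((1 - Complex.I) / 2) • LinearMap.id + ((1 + Complex.I) / 2) • (𝒞.parity ω).toLinearMap)
  have hT : ∀ x, T x = ((1 - Complex.I) / 2) • unop (ψ x) +
    ((1 + Complex.I) / 2) • unop (ψ (𝒞.parity ω x)) := fun x => by simp [T]
  have hT0 : ∀ x ∈ 𝒞.part ω 0, T x = unop (ψ x) := by
    intro x hx
    rw [hT, (𝒞.mem_part_zero ω).1 hx]
    module
  have hT1 : ∀ x ∈ 𝒞.part ω 1, T x = -Complex.I • unop (ψ x) := by
    intro x hx
    rw [hT, (𝒞.mem_part_one ω).1 hx, map_neg, unop_neg]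
    module
  refine ⟨T, ⟨?_, ?_⟩, fun h => ?_, fun i => ?_, ?_, fun x => ?_⟩
  · rw [hT0 1 (SetLike.GradedOne.one_mem), map_one, unop_one]
  · intro p q x hx y hy
    have hxy := SetLike.GradedMul.mul_mem hx hy
    rcases zmod_two_cases p with rfl | rfl <;> rcases zmod_two_cases q with rfl | rfl
    · rw [hT0 x hx, hT0 y hy, hT0 _ hxy]; simp
    · rw [hT0 x hx, hT1 y hy, hT1 _ hxy]; simp
    · rw [hT1 x hx, hT0 y hy, hT1 _ hxy]; simp
    · rw [hT1 x hx, hT1 y hy, hT0 _ hxy, smul_mul_smul_comm]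
      simp [ZMod.val_one]
  · rw [hT0 _ (𝒞.cev_mem_part ω h), h1]; rfl
  · rw [hT1 _ (𝒞.cxi_mem_part ω i), h2]; simp [smul_smul]
  · rw [hT1 _ (𝒞.cdelta_mem_part ω), h3]; simp [smul_smul]
  · simp [hT, hp]

end Antipode

end BicovariantCalculus

end QuantumCartan
end

/-! ### The antipode and the coproduct of `C_Γ`. -/

noncomputable section

set_option linter.unusedSectionVars false

namespace QuantumCartan

namespace BicovariantCalculus

variable {A : Type*} [Ring A] [HopfAlgebra ℂ A]
  {Γ : Type*} [AddCommGroup Γ] [Module ℂ Γ] [Module A Γ] [Module Aᵐᵒᵖ Γ]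
  [SMulCommClass A Aᵐᵒᵖ Γ] [IsScalarTower ℂ A Γ] [IsScalarTower ℂ Aᵐᵒᵖ Γ]
  (𝒞 : BicovariantCalculus A Γ) {N : ℕ} (ω : Module.Basis (Fin N) A Γ)

section EvenIdentities

variable (hω : ∀ i, 𝒞.IsLeftInvariant (ω i))
  (hS : Function.Bijective (HopfAlgebra.antipode ℂ : A →ₗ[ℂ] A))
  (hc : 𝒞.IsSCompatible ω)

theorem evenS_mul (h k : 𝒞.evenAlg ω) : 𝒞.evenS ω hω hc (h * k) =
    𝒞.evenS ω hω hc k * 𝒞.evenS ω hω hc h := Subtype.ext (dualS_mul h.1 k.1)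

theorem evenS_one : 𝒞.evenS ω hω hc 1 = 1 := Subtype.ext dualS_one

theorem evenSInv_mul (h k : 𝒞.evenAlg ω) : 𝒞.evenSInv ω hω hS hc (h * k) =
    𝒞.evenSInv ω hω hS hc k * 𝒞.evenSInv ω hω hS hc h := Subtype.ext (dualSInv_mul hS h.1 k.1)

theorem evenSInv_one : 𝒞.evenSInv ω hω hS hc 1 = 1 := Subtype.ext (dualSInv_one hS)

theorem evenS_evenSInv (h : 𝒞.evenAlg ω) :
    𝒞.evenS ω hω hc (𝒞.evenSInv ω hω hS hc h) = h := Subtype.ext (dualS_dualSInv hS h.1)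

theorem evenSInv_evenS (h : 𝒞.evenAlg ω) :
    𝒞.evenSInv ω hω hS hc (𝒞.evenS ω hω hc h) = h := Subtype.ext (dualSInv_dualS hS h.1)

theorem sum_evenF_mul_evenL (j k : Fin N) (h : 𝒞.evenAlg ω) :
    ∑ i, 𝒞.evenF ω i k * 𝒞.evenL ω hω (𝒞.Jmat ω i j) h =
      ∑ l, 𝒞.evenR ω hω (𝒞.Jmat ω k l) h * 𝒞.evenF ω j l :=
  Subtype.ext <| by
    rw [AddSubmonoidClass.coe_finsetSum, AddSubmonoidClass.coe_finsetSum]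
    exact 𝒞.sum_fc_mul_ltrans ω hω j k h.1

include hω in
theorem sum_braid_smul_evenF_mul (i j k l : Fin N) :
    ∑ n, ∑ m, 𝒞.braid ω n m k l • (𝒞.evenF ω n i * 𝒞.evenF ω m j) =
      ∑ a, ∑ b, 𝒞.braid ω i j a b • (𝒞.evenF ω k a * 𝒞.evenF ω l b) :=
  Subtype.ext <| by
    simp only [AddSubmonoidClass.coe_finsetSum]
    exact 𝒞.sum_braid_smul_fc_mul ω hω i j k l

/-- The functionals `∑ c_{ij} f_{ai} f_{bj}`. -/
def quadF (c : Fin N → Fin N → ℂ) (a b : Fin N) : 𝒞.evenAlg ω :=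
  ∑ i, ∑ j, c i j • (𝒞.evenF ω a i * 𝒞.evenF ω b j)

include hω in
theorem sum_braid_smul_quadF (c : Fin N → Fin N → ℂ)
    (hc : ∀ k l, ∑ i, ∑ j, c i j * 𝒞.braid ω i j k l = c k l) (k l : Fin N) :
    ∑ a, ∑ b, 𝒞.braid ω a b k l • 𝒞.quadF ω c a b = 𝒞.quadF ω c k l := by
  simp only [quadF, Finset.smul_sum, smul_smul]
  rw [sum_comm_four (f := fun n m i j => (𝒞.braid ω n m k l * c i j) •
    (𝒞.evenF ω n i * 𝒞.evenF ω m j)), Finset.sum_comm]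
  simp only [mul_comm _ (c _ _), ← smul_smul, ← Finset.smul_sum,
    𝒞.sum_braid_smul_evenF_mul ω hω]
  simp only [Finset.smul_sum, smul_smul]
  rw [sum_comm_four, Finset.sum_comm]
  simp only [← Finset.sum_smul, hc]

include hω in
/-- Quadratic relations with coefficients in the even algebra. -/
theorem sum_bilin_quadF {W R : Type*} [AddCommGroup W] [Module ℂ W] [AddCommGroup R]
    [Module ℂ R] (B : 𝒞.evenAlg ω →ₗ[ℂ] W →ₗ[ℂ] R) (w : Fin N → Fin N → W)
    (hw : ∀ c : Fin N → Fin N → ℂ,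
      (∀ k l, ∑ i, ∑ j, c i j * 𝒞.braid ω i j k l = c k l) → ∑ i, ∑ j, c i j • w i j = 0)
    (c : Fin N → Fin N → ℂ) (hc : ∀ k l, ∑ i, ∑ j, c i j * 𝒞.braid ω i j k l = c k l) :
    ∑ a, ∑ b, B (𝒞.quadF ω c a b) (w a b) = 0 := by
  have h := sum_bilin_eq_zero_of_forall B
    (fun p q : Fin N × Fin N => 𝒞.braid ω p.1 p.2 q.1 q.2)
    (fun p => 𝒞.quadF ω c p.1 p.2) (fun p => w p.1 p.2)
    (fun q => by
      rw [Fintype.sum_prod_type]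
      exact 𝒞.sum_braid_smul_quadF ω hω c hc q.1 q.2)
    (fun c' hc' => by
      rw [Fintype.sum_prod_type]
      refine hw (fun i j => c' (i, j)) fun k l => ?_
      have := hc' (k, l)
      rwa [Fintype.sum_prod_type] at this)
  rwa [Fintype.sum_prod_type] at h

/-- Both translations end up inside the argument of `h`, as `J S(J)`. This is the cancellation
behind moving `ξ` past `S(h)`. -/
theorem sum_evenR_evenS_evenL (p m : Fin N) (h : 𝒞.evenAlg ω) :
    ∑ j, 𝒞.evenR ω hω (𝒞.Jmat ω j m)
      (𝒞.evenS ω hω hc (𝒞.evenL ω hω (𝒞.Jmat ω p j) h)) =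
      if p = m then 𝒞.evenS ω hω hc h else 0 := by
  refine Subtype.ext (conv_ext fun x => ?_)
  have e : ∀ j, (𝒞.evenR ω hω (𝒞.Jmat ω j m)
      (𝒞.evenS ω hω hc (𝒞.evenL ω hω (𝒞.Jmat ω p j) h))).1 x =
      h.1 (𝒞.Jmat ω p j * HopfAlgebra.antipode ℂ (𝒞.Jmat ω j m) * HopfAlgebra.antipode ℂ x) := by
    intro j
    simp [HopfAlgebra.antipode_mul_antidistrib, mul_assoc]
  rw [AddSubmonoidClass.coe_finsetSum, ofConv_sum, LinearMap.sum_apply]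
  simp only [e, ← map_sum, ← Finset.sum_mul, 𝒞.sum_Jmat_mul_antipode ω hω]
  split_ifs <;> simp

theorem evenR_evenSInv (y z : A) (h : 𝒞.evenAlg ω) :
    𝒞.evenR ω hω y (𝒞.evenSInv ω hω hS hc (𝒞.evenR ω hω z h)) =
      𝒞.evenSInv ω hω hS hc (𝒞.evenR ω hω z (𝒞.evenL ω hω (antipodeInv hS y) h)) := by
  refine Subtype.ext (conv_ext fun x => ?_)
  simp [antipodeInv_mul, mul_assoc]

include hS in
theorem sum_evenL_evenL (r q : Fin N) (h : 𝒞.evenAlg ω) :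
    ∑ p, 𝒞.evenL ω hω (𝒞.Jmat ω r p) (𝒞.evenL ω hω (antipodeInv hS (𝒞.Jmat ω p q)) h) =
      if r = q then h else 0 := by
  refine Subtype.ext (conv_ext fun x => ?_)
  rw [AddSubmonoidClass.coe_finsetSum, ofConv_sum, LinearMap.sum_apply]
  simp only [coe_evenL, ltrans_apply, ← mul_assoc, ← map_sum, ← Finset.sum_mul,
    𝒞.sum_antipodeInv_Jmat_mul ω hω]
  split_ifs <;> simp

theorem sum_evenSInv_mul (i q : Fin N) (h : 𝒞.evenAlg ω) :
    ∑ m, ∑ p, 𝒞.evenSInv ω hω hS hc (𝒞.evenF ω p m) *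
      𝒞.evenR ω hω (𝒞.Jmat ω p q) (𝒞.evenSInv ω hω hS hc (𝒞.evenR ω hω (𝒞.Jmat ω i m) h)) =
      𝒞.evenSInv ω hω hS hc h * 𝒞.evenSInv ω hω hS hc (𝒞.evenF ω q i) := by
  simp only [evenR_evenSInv, ← evenSInv_mul, ← map_sum]
  congr 1
  rw [Finset.sum_comm]
  simp only [← sum_evenF_mul_evenL]
  rw [Finset.sum_comm]
  simp only [← Finset.mul_sum, 𝒞.sum_evenL_evenL ω hω hS]
  simp

theorem cev_evenS_evenX (i : Fin N) : 𝒞.cev ω (𝒞.evenS ω hω hc (𝒞.evenX ω i)) =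
    -∑ j, 𝒞.cX ω j * 𝒞.cev ω (𝒞.evenS ω hω hc (𝒞.evenF ω j i)) := by
  rw [eq_neg_iff_add_eq_zero]
  simp only [← cev_evenX, ← map_mul, ← map_sum, ← map_add]
  rw [show 𝒞.evenS ω hω hc (𝒞.evenX ω i) +
    ∑ j, 𝒞.evenX ω j * 𝒞.evenS ω hω hc (𝒞.evenF ω j i) = 0 from Subtype.ext ?_, map_zero]
  have h := 𝒞.dualS_Xc ω hω i
  rw [eq_neg_iff_add_eq_zero] at h
  rw [AddMemClass.coe_add, AddSubmonoidClass.coe_finsetSum]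
  exact h

theorem cev_evenSInv_evenX (i : Fin N) : 𝒞.cev ω (𝒞.evenSInv ω hω hS hc (𝒞.evenX ω i)) =
    -∑ j, 𝒞.cev ω (𝒞.evenSInv ω hω hS hc (𝒞.evenF ω j i)) * 𝒞.cX ω j := by
  rw [eq_neg_iff_add_eq_zero]
  simp only [← cev_evenX, ← map_mul, ← map_sum, ← map_add]
  rw [show 𝒞.evenSInv ω hω hS hc (𝒞.evenX ω i) +
    ∑ j, 𝒞.evenSInv ω hω hS hc (𝒞.evenF ω j i) * 𝒞.evenX ω j = 0 from Subtype.ext ?_, map_zero]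
  have h := 𝒞.sum_gc_mul_Xc ω hω hS i
  rw [eq_neg_iff_add_eq_zero, add_comm] at h
  rw [AddMemClass.coe_add, AddSubmonoidClass.coe_finsetSum]
  exact h

theorem sum_evenS_mul_evenF (i j : Fin N) :
    ∑ k, 𝒞.evenS ω hω hc (𝒞.evenF ω i k) * 𝒞.evenF ω k j = if i = j then 1 else 0 :=
  Subtype.ext <| by
    rw [AddSubmonoidClass.coe_finsetSum]
    refine (sum_dualS_mul (𝒞.fc_mul ω hω) (𝒞.fc_one ω) i j).trans ?_
    split_ifs <;> rfl

theorem sum_evenF_mul_evenSInv (i j : Fin N) :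
    ∑ k, 𝒞.evenF ω k j * 𝒞.evenSInv ω hω hS hc (𝒞.evenF ω i k) = if i = j then 1 else 0 :=
  Subtype.ext <| by
    rw [AddSubmonoidClass.coe_finsetSum]
    refine (sum_mul_dualSInv hS (𝒞.fc_mul ω hω) (𝒞.fc_one ω) i j).trans ?_
    split_ifs <;> rfl

end EvenIdentities

section CartanAntipode

variable (hω : ∀ i, 𝒞.IsLeftInvariant (ω i))
  (hS : Function.Bijective (HopfAlgebra.antipode ℂ : A →ₗ[ℂ] A))
  (hc : 𝒞.IsSCompatible ω)

/-- Exchanging the two factors produces `σ`, which `c` absorbs. -/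
theorem sum_cev_mul_eq (s : 𝒞.evenAlg ω →ₗ[ℂ] 𝒞.evenAlg ω) (t : Fin N → 𝒞.Cartan ω)
    (hst : ∀ i h, 𝒞.cev ω (s h) * t i =
      ∑ m, t m * 𝒞.cev ω (s (𝒞.evenR ω hω (𝒞.Jmat ω i m) h)))
    (c : Fin N → Fin N → ℂ) (hc : ∀ k l, ∑ i, ∑ j, c i j * 𝒞.braid ω i j k l = c k l)
    (k : Fin N) : ∑ i, ∑ j, c i j • (𝒞.cev ω (s (𝒞.evenF ω k j)) * t i) =
      ∑ i, ∑ j, c i j • (t j * 𝒞.cev ω (s (𝒞.evenF ω k i))) := by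
  simp only [hst, evenR_Jmat_evenF, map_sum, map_smul, Finset.mul_sum, mul_smul_comm,
    Finset.smul_sum, smul_smul]
  rw [sum_comm_four]
  simp only [← Finset.sum_smul, hc]

/-- Expand one `t`, exchange by `h`, expand the other; the two signs cancel. It reduces the
quadratic relations of the images `-∑ ξ_a S(f_{aj})` to those of the `ξ_a`, with coefficients on the
right. -/
theorem _root_.QuantumCartan.sum_smul_mul_eq_of_right {B : Type*} [Ring B] [Algebra ℂ B]
    (c : Fin N → Fin N → ℂ) (x t : Fin N → B) (s : Fin N → Fin N → B)
    (ht : ∀ j, t j = -∑ a, x a * s a j)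
    (h : ∀ k, ∑ i, ∑ j, c i j • (s k j * t i) = ∑ i, ∑ j, c i j • (t j * s k i)) :
    ∑ i, ∑ j, c i j • (t j * t i) =
      ∑ a, ∑ b, x a * x b * ∑ i, ∑ j, c i j • (s b j * s a i) := by
  have e1 : ∑ i, ∑ j, c i j • (t j * t i) =
      -∑ a, x a * ∑ i, ∑ j, c i j • (s a j * t i) := by
    simp only [Finset.mul_sum, mul_smul_comm, ← mul_assoc]
    rw [← sum_comm_three, ← Finset.sum_neg_distrib]
    refine Finset.sum_congr rfl fun i _ => ?_
    rw [← Finset.sum_neg_distrib]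
    refine Finset.sum_congr rfl fun j _ => ?_
    rw [← Finset.smul_sum, ← Finset.sum_mul, ← smul_neg, ← neg_mul, ← ht]
  rw [e1, ← Finset.sum_neg_distrib]
  refine Finset.sum_congr rfl fun a _ => ?_
  simp only [h, Finset.mul_sum, mul_smul_comm, mul_assoc]
  rw [← sum_comm_three, ← Finset.sum_neg_distrib]
  refine Finset.sum_congr rfl fun i _ => ?_
  rw [← Finset.sum_neg_distrib]
  refine Finset.sum_congr rfl fun j _ => ?_
  rw [← Finset.smul_sum, ← smul_neg]
  congr 1
  simp only [← mul_assoc (s _ _), ← Finset.mul_sum]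
  rw [ht, ← mul_neg, ← neg_mul, neg_neg, Finset.sum_mul]
  simp only [mul_assoc]

theorem _root_.QuantumCartan.sum_smul_mul_eq_of_left {B : Type*} [Ring B] [Algebra ℂ B]
    (c : Fin N → Fin N → ℂ) (x t : Fin N → B) (s : Fin N → Fin N → B)
    (ht : ∀ j, t j = -∑ a, s a j * x a)
    (h : ∀ k, ∑ i, ∑ j, c i j • (s k j * t i) = ∑ i, ∑ j, c i j • (t j * s k i)) :
    ∑ i, ∑ j, c i j • (t j * t i) =
      ∑ a, ∑ b, (∑ i, ∑ j, c i j • (s b j * s a i)) * (x a * x b) := by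
  have e1 : ∑ i, ∑ j, c i j • (t j * t i) =
      -∑ b, (∑ i, ∑ j, c i j • (t j * s b i)) * x b := by
    simp only [Finset.sum_mul, smul_mul_assoc, mul_assoc]
    rw [← sum_comm_three, ← Finset.sum_neg_distrib]
    refine Finset.sum_congr rfl fun i _ => ?_
    rw [← Finset.sum_neg_distrib]
    refine Finset.sum_congr rfl fun j _ => ?_
    rw [← Finset.smul_sum, ← Finset.mul_sum, ← smul_neg, ← mul_neg, ← ht]
  rw [e1, ← Finset.sum_neg_distrib, Finset.sum_comm]
  refine Finset.sum_congr rfl fun b _ => ?_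
  simp only [← h, Finset.sum_mul, smul_mul_assoc, mul_assoc]
  rw [← sum_comm_three, ← Finset.sum_neg_distrib]
  refine Finset.sum_congr rfl fun i _ => ?_
  rw [← Finset.sum_neg_distrib]
  refine Finset.sum_congr rfl fun j _ => ?_
  rw [← Finset.smul_sum, ← smul_neg]
  congr 1
  rw [← Finset.mul_sum, ht, ← mul_neg, ← neg_mul, neg_neg, Finset.sum_mul]
  simp only [mul_assoc]

theorem exists_cartanAntipode : ∃ T : 𝒞.Cartan ω →ₗ[ℂ] 𝒞.Cartan ω, 𝒞.IsGradedAntiHom ω T ∧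
    (∀ h, T (𝒞.cev ω h) = 𝒞.cev ω (𝒞.evenS ω hω hc h)) ∧
    (∀ i, T (𝒞.cxi ω i) = -∑ j, 𝒞.cxi ω j * 𝒞.cev ω (𝒞.evenS ω hω hc (𝒞.evenF ω j i))) ∧
    T (𝒞.cdelta ω) = -𝒞.cdelta ω ∧ ∀ x, 𝒞.parity ω (T x) = T (𝒞.parity ω x) := by
  have hst : ∀ i h, 𝒞.cev ω (𝒞.evenS ω hω hc h) *
      (-∑ j, 𝒞.cxi ω j * 𝒞.cev ω (𝒞.evenS ω hω hc (𝒞.evenF ω j i))) =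
      ∑ m, (-∑ j, 𝒞.cxi ω j * 𝒞.cev ω (𝒞.evenS ω hω hc (𝒞.evenF ω j m))) *
        𝒞.cev ω (𝒞.evenS ω hω hc (𝒞.evenR ω hω (𝒞.Jmat ω i m) h)) := by
    intro i h
    simp only [neg_mul, mul_neg, Finset.sum_neg_distrib, Finset.sum_mul, mul_assoc, ← map_mul,
      ← evenS_mul]
    congr 1
    rw [Finset.sum_comm]
    simp only [← Finset.mul_sum, ← map_sum, ← sum_evenF_mul_evenL]
    have key : ∀ p, ∑ j, 𝒞.cxi ω j * 𝒞.cev ω (𝒞.evenS ω hω hc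
        (𝒞.evenL ω hω (𝒞.Jmat ω p j) h)) = 𝒞.cev ω (𝒞.evenS ω hω hc h) * 𝒞.cxi ω p := by
      intro p
      simp only [𝒞.cxi_mul_cev ω hω]
      rw [Finset.sum_comm]
      simp only [← Finset.sum_mul, ← map_sum, sum_evenR_evenS_evenL]
      simp [apply_ite (𝒞.cev ω)]
    simp only [map_sum, evenS_mul, map_mul, Finset.mul_sum, ← mul_assoc]
    rw [Finset.sum_comm]
    simp only [← Finset.sum_mul, key]
  refine 𝒞.exists_gradedAntiHom ω hω (𝒞.evenS ω hω hc) (𝒞.evenS_one ω hω hc)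
    (𝒞.evenS_mul ω hω hc) _ (fun i => ?_) hst (fun i => ?_) (fun c hcc => ?_)
  · rw [mem_part_one]
    simp
  · rw [cev_evenS_evenX, neg_mul, mul_neg, ← neg_add]
    congr 1
    rw [Finset.sum_mul, Finset.mul_sum, ← Finset.sum_add_distrib]
    refine Finset.sum_congr rfl fun j _ => ?_
    rw [← cev_evenX, ← cxi_mul_cdelta, mul_assoc, cev_mul_cdelta, add_mul, mul_assoc, mul_assoc]
  -- The coefficients of `ξ_a ξ_b` are `S` of the functionals `∑ c_{ij} f_{ai} f_{bj}`, which are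
  -- fixed by `σ`; so the quadratic relations of the `ξ` apply.
  · have h1 := 𝒞.sum_cev_mul_eq ω hω _ _ hst c hcc
    have h2 := 𝒞.sum_bilin_quadF ω hω
      ((LinearMap.mul ℂ (𝒞.Cartan ω)).flip ∘ₗ (𝒞.cev ω).toLinearMap ∘ₗ 𝒞.evenS ω hω hc)
      (fun a b => 𝒞.cxi ω a * 𝒞.cxi ω b) (𝒞.sum_cxi_mul_cxi ω) c hcc
    refine (sum_smul_mul_eq_of_right c _ _ _ (fun _ => rfl) h1).trans (.trans ?_ h2)
    simp [quadF, evenS_mul, Finset.mul_sum]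

theorem exists_cartanAntipodeInv : ∃ T : 𝒞.Cartan ω →ₗ[ℂ] 𝒞.Cartan ω, 𝒞.IsGradedAntiHom ω T ∧
    (∀ h, T (𝒞.cev ω h) = 𝒞.cev ω (𝒞.evenSInv ω hω hS hc h)) ∧
    (∀ i, T (𝒞.cxi ω i) = -∑ j, 𝒞.cev ω (𝒞.evenSInv ω hω hS hc (𝒞.evenF ω j i)) * 𝒞.cxi ω j) ∧
    T (𝒞.cdelta ω) = -𝒞.cdelta ω ∧ ∀ x, 𝒞.parity ω (T x) = T (𝒞.parity ω x) := by
  have hst : ∀ i h, 𝒞.cev ω (𝒞.evenSInv ω hω hS hc h) *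
      (-∑ j, 𝒞.cev ω (𝒞.evenSInv ω hω hS hc (𝒞.evenF ω j i)) * 𝒞.cxi ω j) =
      ∑ m, (-∑ j, 𝒞.cev ω (𝒞.evenSInv ω hω hS hc (𝒞.evenF ω j m)) * 𝒞.cxi ω j) *
        𝒞.cev ω (𝒞.evenSInv ω hω hS hc (𝒞.evenR ω hω (𝒞.Jmat ω i m) h)) := by
    intro i h
    simp only [neg_mul, mul_neg, Finset.sum_neg_distrib, Finset.sum_mul, mul_assoc,
      𝒞.cxi_mul_cev ω hω, Finset.mul_sum]
    congr 1
    rw [sum_comm_three]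
    refine Finset.sum_congr rfl fun q _ => ?_
    simp only [← mul_assoc, ← Finset.sum_mul, ← map_mul, ← map_sum, sum_evenSInv_mul]
  refine 𝒞.exists_gradedAntiHom ω hω (𝒞.evenSInv ω hω hS hc) (𝒞.evenSInv_one ω hω hS hc)
    (𝒞.evenSInv_mul ω hω hS hc) _ (fun i => ?_) hst (fun i => ?_) (fun c hcc => ?_)
  · rw [mem_part_one]
    simp
  · rw [cev_evenSInv_evenX, neg_mul, mul_neg, ← neg_add]
    congr 1
    rw [Finset.sum_mul, Finset.mul_sum, ← Finset.sum_add_distrib]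
    refine Finset.sum_congr rfl fun j _ => ?_
    rw [← cev_evenX, ← cxi_mul_cdelta, mul_add, ← mul_assoc, ← mul_assoc, ← mul_assoc, cev_mul_cdelta, mul_assoc, mul_assoc]
  · have h1 := 𝒞.sum_cev_mul_eq ω hω _ _ hst c hcc
    have h2 := 𝒞.sum_bilin_quadF ω hω
      (LinearMap.mul ℂ (𝒞.Cartan ω) ∘ₗ (𝒞.cev ω).toLinearMap ∘ₗ 𝒞.evenSInv ω hω hS hc)
      (fun a b => 𝒞.cxi ω a * 𝒞.cxi ω b) (𝒞.sum_cxi_mul_cxi ω) c hcc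
    refine (sum_smul_mul_eq_of_left c _ _ _ (fun _ => rfl) h1).trans (.trans ?_ h2)
    simp [quadF, evenSInv_mul, Finset.sum_mul]

/-- When the inner map preserves parity, the signs of two graded anti-homomorphisms cancel in the
composite. The composite is thus multiplicative and is determined on generators. -/
theorem comp_eq_id_of_generators {T T' : 𝒞.Cartan ω →ₗ[ℂ] 𝒞.Cartan ω}
    (hT : 𝒞.IsGradedAntiHom ω T) (hT' : 𝒞.IsGradedAntiHom ω T')
    (hp : ∀ x, 𝒞.parity ω (T' x) = T' (𝒞.parity ω x))
    (hev : ∀ h, T (T' (𝒞.cev ω h)) = 𝒞.cev ω h) (hxi : ∀ i, T (T' (𝒞.cxi ω i)) = 𝒞.cxi ω i)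
    (hdelta : T (T' (𝒞.cdelta ω)) = 𝒞.cdelta ω) (x : 𝒞.Cartan ω) : T (T' x) = x := by
  have h0 : ∀ y ∈ 𝒞.part ω 0, T' y ∈ 𝒞.part ω 0 := fun y hy => by
    rw [mem_part_zero, hp, (𝒞.mem_part_zero ω).1 hy]
  have h1 : ∀ y ∈ 𝒞.part ω 1, T' y ∈ 𝒞.part ω 1 := fun y hy => by
    rw [mem_part_one, hp, (𝒞.mem_part_one ω).1 hy, map_neg]
  induction x using 𝒞.cartan_induction ω with
  | h1 => rw [hT'.one, hT.one]
  | hadd x y hx hy => rw [map_add, map_add, hx, hy]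
  | hev h x hx =>
    rw [hT'.mul_even (𝒞.cev_mem_part ω h), hT.mul_even_right _ (h0 _ (𝒞.cev_mem_part ω h)), hev, hx]
  | hxi i x hx =>
    rw [hT'.mul_odd (𝒞.cxi_mem_part ω i), hT.mul_odd_right _ (h1 _ (𝒞.cxi_mem_part ω i)), hxi, hp,
      parity_parity, hx]
  | hdelta x hx =>
    rw [hT'.mul_odd (𝒞.cdelta_mem_part ω), hT.mul_odd_right _ (h1 _ (𝒞.cdelta_mem_part ω)), hdelta,
      hp, parity_parity, hx]

include hS in
/-- The antipode of the quantum Cartan algebra, with the values of its inverse. -/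
theorem exists_cartanAntipodeEquiv : ∃ T : 𝒞.Cartan ω ≃ₗ[ℂ] 𝒞.Cartan ω,
    𝒞.IsGradedAntiHom ω T ∧ 𝒞.IsGradedAntiHom ω T.symm ∧
    (∀ h, T (𝒞.cev ω h) = 𝒞.cev ω (𝒞.evenS ω hω hc h)) ∧
    (∀ i, T (𝒞.cxi ω i) = -∑ j, 𝒞.cxi ω j * 𝒞.cev ω (𝒞.evenS ω hω hc (𝒞.evenF ω j i))) ∧
    T (𝒞.cdelta ω) = -𝒞.cdelta ω ∧ (∀ x, 𝒞.parity ω (T x) = T (𝒞.parity ω x)) := by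
  obtain ⟨T, hT, Tev, Txi, Td, Tp⟩ := 𝒞.exists_cartanAntipode ω hω hc
  obtain ⟨T', hT', Tev', Txi', Td', Tp'⟩ := 𝒞.exists_cartanAntipodeInv ω hω hS hc
  have h1 : ∀ x, T (T' x) = x := 𝒞.comp_eq_id_of_generators ω hT hT' Tp'
    (fun h => by rw [Tev', Tev, evenS_evenSInv])
    (fun i => by
      rw [Txi', map_neg, map_sum]
      simp only [hT.mul_even (𝒞.cev_mem_part ω _), Txi, Tev, evenS_evenSInv, neg_mul,
        Finset.sum_neg_distrib, neg_neg, Finset.sum_mul, mul_assoc, ← map_mul]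
      rw [Finset.sum_comm]
      simp only [← Finset.mul_sum, ← map_sum, sum_evenS_mul_evenF]
      simp [apply_ite (𝒞.cev ω)])
    (by rw [Td', map_neg, Td, neg_neg])
  have h2 : ∀ x, T' (T x) = x := 𝒞.comp_eq_id_of_generators ω hT' hT Tp
    (fun h => by rw [Tev, Tev', evenSInv_evenS])
    (fun i => by
      rw [Txi, map_neg, map_sum]
      simp only [hT'.mul_even_right _ (𝒞.cev_mem_part ω _), Txi', Tev', evenSInv_evenS, mul_neg,
        Finset.sum_neg_distrib, neg_neg, Finset.mul_sum, ← mul_assoc, ← map_mul]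
      rw [Finset.sum_comm]
      simp only [← Finset.sum_mul, ← map_sum, sum_evenF_mul_evenSInv]
      simp [apply_ite (𝒞.cev ω)])
    (by rw [Td, map_neg, Td', neg_neg])
  let Te : 𝒞.Cartan ω ≃ₗ[ℂ] 𝒞.Cartan ω := LinearEquiv.ofLinearMap T T' (LinearMap.ext h1)
    (LinearMap.ext h2)
  exact ⟨Te, hT, hT', Tev, Txi, Td, Tp⟩

end CartanAntipode

/-! #### The coproduct and the counit -/

section Comul

variable (hω : ∀ i, 𝒞.IsLeftInvariant (ω i))

include hω in
theorem sum_cxi_mul_cf (c : Fin N → Fin N → ℂ)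
    (hc : ∀ k l, ∑ i, ∑ j, c i j * 𝒞.braid ω i j k l = c k l) (b : Fin N) :
    ∑ i, ∑ j, c i j • (𝒞.cxi ω i * 𝒞.cf ω b j) = ∑ i, ∑ j, c i j • (𝒞.cf ω b i * 𝒞.cxi ω j) := by
  simp only [← cev_evenF, 𝒞.cxi_mul_cev ω hω, evenR_Jmat_evenF, map_sum, map_smul, Finset.sum_mul,
    smul_mul_assoc, Finset.smul_sum, smul_smul]
  rw [sum_comm_four]
  simp only [← Finset.sum_smul, hc]

/-- The graded tensor product enters only through its two inclusions, whose images commute up to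
sign. With abstract maps `L` and `R` of this kind, every relation is checked inside an ordinary
algebra `B`. -/
theorem exists_comul_of_maps {B : Type*} [Ring B] [Algebra ℂ B] (L R : 𝒞.Cartan ω →ₐ[ℂ] B)
    (hLR : ∀ p q : ZMod 2, ∀ x ∈ 𝒞.part ω p, ∀ y ∈ 𝒞.part ω q,
      R y * L x = (-1 : ℂ) ^ (p.val * q.val) • (L x * R y)) :
    ∃ Δ : 𝒞.Cartan ω →ₐ[ℂ] B,
      (∀ h, Δ (𝒞.cev ω h) = TensorProduct.lift ((LinearMap.mul ℂ B).compl₁₂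
        (L.comp (𝒞.cev ω)).toLinearMap (R.comp (𝒞.cev ω)).toLinearMap) (𝒞.comulU ω hω h)) ∧
      (∀ i, Δ (𝒞.cxi ω i) = R (𝒞.cxi ω i) + ∑ j, L (𝒞.cxi ω j) * R (𝒞.cf ω j i)) ∧
      Δ (𝒞.cdelta ω) = R (𝒞.cdelta ω) + L (𝒞.cdelta ω) := by
  have e0 : ∀ h p, ∀ x ∈ 𝒞.part ω p, R (𝒞.cev ω h) * L x = L x * R (𝒞.cev ω h) := fun h p x hx => by
    have := hLR p 0 x hx _ (𝒞.cev_mem_part ω h)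
    simpa using this
  have e0' : ∀ h p, ∀ y ∈ 𝒞.part ω p, R y * L (𝒞.cev ω h) = L (𝒞.cev ω h) * R y := fun h p y hy => by
    have := hLR 0 p _ (𝒞.cev_mem_part ω h) y hy
    simpa using this
  have e1 : ∀ x ∈ 𝒞.part ω 1, ∀ y ∈ 𝒞.part ω 1, R y * L x = -(L x * R y) := fun x hx y hy => by
    have := hLR 1 1 x hx y hy
    simpa [ZMod.val_one] using this
  let Ψ : 𝒞.evenAlg ω ⊗[ℂ] 𝒞.evenAlg ω →ₐ[ℂ] B :=
    Algebra.TensorProduct.lift (L.comp (𝒞.cev ω)) (R.comp (𝒞.cev ω))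
      (fun h k => (e0 k 0 _ (𝒞.cev_mem_part ω h)).symm)
  have hΨ : ∀ h k, Ψ (h ⊗ₜ k) = L (𝒞.cev ω h) * R (𝒞.cev ω k) := fun h k =>
    Algebra.TensorProduct.lift_tmul _ _ _ _ _
  have hR : ∀ i t, R (𝒞.cxi ω i) * Ψ t =
      ∑ m, Ψ ((𝒞.evenR ω hω (𝒞.Jmat ω i m)).lTensor _ t) * R (𝒞.cxi ω m) := by
    intro i t
    induction t using TensorProduct.induction_on with
    | zero => simp
    | add p q hp hq => simp only [map_add, mul_add, add_mul, hp, hq, Finset.sum_add_distrib]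
    | tmul h k =>
      simp only [LinearMap.lTensor_tmul, hΨ]
      rw [← mul_assoc, e0' h 1 _ (𝒞.cxi_mem_part ω i), mul_assoc, ← map_mul, 𝒞.cxi_mul_cev ω hω,
        map_sum, Finset.mul_sum]
      simp only [map_mul, mul_assoc]
  have hL : ∀ i t, L (𝒞.cxi ω i) * Ψ t =
      ∑ m, Ψ ((𝒞.evenR ω hω (𝒞.Jmat ω i m)).rTensor _ t) * L (𝒞.cxi ω m) := by
    intro i t
    induction t using TensorProduct.induction_on with
    | zero => simp
    | add p q hp hq => simp only [map_add, mul_add, add_mul, hp, hq, Finset.sum_add_distrib]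
    | tmul h k =>
      simp only [LinearMap.rTensor_tmul, hΨ, mul_assoc, e0 k 1 _ (𝒞.cxi_mem_part ω _)]
      rw [← mul_assoc, ← map_mul, 𝒞.cxi_mul_cev ω hω, map_sum, Finset.sum_mul]
      simp only [map_mul, mul_assoc]
  have hf : ∀ j i, R (𝒞.cf ω j i) = Ψ (1 ⊗ₜ 𝒞.evenF ω j i) := fun j i => by
    rw [hΨ, map_one, map_one, one_mul, cev_evenF]
  have hcomm : ∀ j i, L (𝒞.cxi ω j) * R (𝒞.cf ω j i) = Ψ (1 ⊗ₜ 𝒞.evenF ω j i) * L (𝒞.cxi ω j) :=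
    fun j i => by rw [← hf, ← cev_evenF, e0 _ 1 _ (𝒞.cxi_mem_part ω j)]
  obtain ⟨Δ, h1, h2, h3⟩ := 𝒞.exists_cartan_hom ω hω (Ψ.comp (𝒞.comulU ω hω))
    (fun i => R (𝒞.cxi ω i) + ∑ j, L (𝒞.cxi ω j) * R (𝒞.cf ω j i))
    (R (𝒞.cdelta ω) + L (𝒞.cdelta ω))
    (fun i h => by
      have hexch : ∀ m (t : 𝒞.evenAlg ω ⊗[ℂ] 𝒞.evenAlg ω),
          ∑ j, ((1 : 𝒞.evenAlg ω) ⊗ₜ[ℂ] 𝒞.evenF ω j i) * (𝒞.evenL ω hω (𝒞.Jmat ω j m)).lTensor _ t =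
          ∑ l, (𝒞.evenR ω hω (𝒞.Jmat ω i l)).lTensor _ t * (1 ⊗ₜ 𝒞.evenF ω m l) := by
        intro m t
        induction t using TensorProduct.induction_on with
        | zero => simp
        | add p q hp hq => simp only [map_add, mul_add, add_mul, hp, hq, Finset.sum_add_distrib]
        | tmul h k =>
          simp only [LinearMap.lTensor_tmul, Algebra.TensorProduct.tmul_mul_tmul, one_mul, mul_one,
            ← TensorProduct.tmul_sum, sum_evenF_mul_evenL]
      have hr : ∀ j m (t : 𝒞.evenAlg ω ⊗[ℂ] 𝒞.evenAlg ω),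
          (𝒞.evenR ω hω (𝒞.Jmat ω j m)).rTensor _ ((1 ⊗ₜ 𝒞.evenF ω j i) * t) =
          (1 ⊗ₜ 𝒞.evenF ω j i) * (𝒞.evenR ω hω (𝒞.Jmat ω j m)).rTensor _ t := by
        intro j m t
        induction t using TensorProduct.induction_on with
        | zero => simp
        | add p q hp hq => simp only [map_add, mul_add, hp, hq]
        | tmul h k => simp
      simp only [AlgHom.comp_apply, add_mul, mul_add, Finset.sum_add_distrib, hR, comulU_evenR]
      congr 1
      have hLf : ∀ j (t : 𝒞.evenAlg ω ⊗[ℂ] 𝒞.evenAlg ω), L (𝒞.cxi ω j) * R (𝒞.cf ω j i) * Ψ t =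
          ∑ m, Ψ ((1 ⊗ₜ 𝒞.evenF ω j i) * (𝒞.evenR ω hω (𝒞.Jmat ω j m)).rTensor _ t) *
            L (𝒞.cxi ω m) := fun j t => by
        rw [hf, mul_assoc, ← map_mul, hL]
        simp only [hr]
      -- Right translation of the first leg of the coproduct is left translation of the second,
      -- where the exchange relation `hexch` moves it across `f`.
      simp only [Finset.sum_mul, hLf, rTensor_evenR_comulU]
      rw [Finset.sum_comm]
      simp only [← Finset.sum_mul, ← map_sum, hexch]
      simp only [hcomm, Finset.mul_sum, ← mul_assoc, ← map_mul]
      rw [Finset.sum_comm]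
      simp only [map_sum, Finset.sum_mul])
    (fun h => by
      simp only [AlgHom.comp_apply]
      generalize 𝒞.comulU ω hω h = t
      induction t using TensorProduct.induction_on with
      | zero => simp
      | add p q hp hq => rw [map_add, add_mul (Ψ p), mul_add _ (Ψ p), hp, hq]
      | tmul h k =>
        rw [hΨ, mul_add, add_mul, mul_assoc, ← map_mul, cev_mul_cdelta, map_mul, mul_assoc,
          e0 k 1 _ (𝒞.cdelta_mem_part ω), ← mul_assoc, ← e0' h 1 _ (𝒞.cdelta_mem_part ω),
          ← mul_assoc (L _) (L _), ← map_mul L, cev_mul_cdelta, map_mul, mul_assoc, mul_assoc])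
    (fun i => by
      change _ = Ψ (𝒞.comulU ω hω (𝒞.evenX ω i))
      have a1 := e1 _ (𝒞.cdelta_mem_part ω) _ (𝒞.cxi_mem_part ω i)
      have a2 : ∀ j, L (𝒞.cxi ω j) * R (𝒞.cf ω j i) * (R (𝒞.cdelta ω) + L (𝒞.cdelta ω)) +
          (R (𝒞.cdelta ω) + L (𝒞.cdelta ω)) * (L (𝒞.cxi ω j) * R (𝒞.cf ω j i)) =
          L (𝒞.cX ω j) * R (𝒞.cf ω j i) := fun j => by
        have b1 := e1 _ (𝒞.cxi_mem_part ω j) _ (𝒞.cdelta_mem_part ω)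
        have b2 : R (𝒞.cf ω j i) * R (𝒞.cdelta ω) = R (𝒞.cdelta ω) * R (𝒞.cf ω j i) := by
          rw [← map_mul, ← map_mul, ← cev_evenF, cev_mul_cdelta]
        have b3 := e0 (𝒞.evenF ω j i) 1 _ (𝒞.cdelta_mem_part ω)
        rw [cev_evenF] at b3
        rw [← cev_evenX, ← cxi_mul_cdelta, map_add, map_mul, map_mul]
        simp only [mul_add, add_mul, mul_assoc, b2, b3]
        rw [← mul_assoc (R (𝒞.cdelta ω)) (L _), b1, neg_mul, mul_assoc]
        abel
      rw [comulU_evenX, map_add, map_sum]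
      simp only [hΨ, map_one, one_mul, cev_evenF, cev_evenX, ← a2]
      rw [← cev_evenX, ← cxi_mul_cdelta, map_add, map_mul, map_mul, Finset.sum_add_distrib,
        ← Finset.sum_mul, ← Finset.mul_sum, add_mul, mul_add, mul_add, add_mul, mul_add (R _),
        mul_add (L _), a1]
      generalize ∑ j, L (𝒞.cxi ω j) * R (𝒞.cf ω j i) = z
      simp only [mul_add, add_mul]
      abel)
    (by
      simp only [add_mul, mul_add, ← map_mul, cdelta_mul_cdelta, map_zero,
        e1 _ (𝒞.cdelta_mem_part ω) _ (𝒞.cdelta_mem_part ω)]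
      abel)
    (fun c hc => by
      have hRR : ∑ i, ∑ j, c i j • (R (𝒞.cxi ω i) * R (𝒞.cxi ω j)) = 0 := by
        have := congrArg R (𝒞.sum_cxi_mul_cxi ω c hc)
        simpa only [map_sum, map_smul, map_mul, map_zero] using this
      have hLL : ∑ i, ∑ j, c i j • ((∑ a, L (𝒞.cxi ω a) * R (𝒞.cf ω a i)) *
          ∑ b, L (𝒞.cxi ω b) * R (𝒞.cf ω b j)) = 0 := by
        have h2 := 𝒞.sum_bilin_quadF ω hω ((LinearMap.mul ℂ B).flip.compl₁₂
          (R.toLinearMap ∘ₗ (𝒞.cev ω).toLinearMap) L.toLinearMap)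
          (fun a b => 𝒞.cxi ω a * 𝒞.cxi ω b) (𝒞.sum_cxi_mul_cxi ω) c hc
        rw [← h2]
        simp only [quadF, LinearMap.compl₁₂_apply, LinearMap.flip_apply, LinearMap.mul_apply',
          LinearMap.comp_apply, AlgHom.toLinearMap_apply, map_sum, map_smul, map_mul, cev_evenF,
          LinearMap.sum_apply, LinearMap.smul_apply, Finset.mul_sum, Finset.sum_mul, mul_smul_comm, Finset.smul_sum]
        rw [sum_comm_four]
        refine Finset.sum_congr rfl fun a _ => Finset.sum_congr rfl fun b _ =>
          Finset.sum_congr rfl fun i _ => Finset.sum_congr rfl fun j _ => ?_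
        have := e0 (𝒞.evenF ω a i) 1 _ (𝒞.cxi_mem_part ω b)
        rw [cev_evenF] at this
        rw [mul_assoc, ← mul_assoc (R _), this]
        simp only [mul_assoc]
      -- The odd elements `R ξ_i` and `L ξ_b` anticommute, and `c` absorbs the exchange of `ξ` with
      -- `f`; the two mixed sums therefore cancel.
      have hRL : ∑ i, ∑ j, c i j • (R (𝒞.cxi ω i) * ∑ b, L (𝒞.cxi ω b) * R (𝒞.cf ω b j)) =
          -∑ i, ∑ j, c i j • ((∑ b, L (𝒞.cxi ω b) * R (𝒞.cf ω b i)) * R (𝒞.cxi ω j)) := by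
        have : ∀ b, ∑ i, ∑ j, c i j • (R (𝒞.cxi ω i) * R (𝒞.cf ω b j)) =
            ∑ i, ∑ j, c i j • (R (𝒞.cf ω b i) * R (𝒞.cxi ω j)) := fun b => by
          have := congrArg R (𝒞.sum_cxi_mul_cf ω hω c hc b)
          simpa only [map_sum, map_smul, map_mul] using this
        calc _ = -∑ b, L (𝒞.cxi ω b) *
              ∑ i, ∑ j, c i j • (R (𝒞.cxi ω i) * R (𝒞.cf ω b j)) := by
              simp only [Finset.mul_sum, Finset.smul_sum, mul_smul_comm, ← mul_assoc,
                e1 _ (𝒞.cxi_mem_part ω _) _ (𝒞.cxi_mem_part ω _), neg_mul, smul_neg,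
                Finset.sum_neg_distrib]
              rw [sum_comm_three]
          _ = _ := by
              simp only [this, Finset.mul_sum, Finset.sum_mul, Finset.smul_sum, mul_smul_comm,
                mul_assoc]
              rw [← sum_comm_three]
      simp only [mul_add, add_mul, smul_add, Finset.sum_add_distrib, hRR, hLL, hRL]
      abel)
  exact ⟨Δ, h1, h2, h3⟩

end Comul

end BicovariantCalculus

end QuantumCartan
end

/-! ### Signs in the graded tensor square; coproduct, counit and antipode assembled. -/

noncomputable section

set_option linter.unusedSectionVars false

namespace QuantumCartan

namespace BicovariantCalculus

variable {A : Type*} [Ring A] [HopfAlgebra ℂ A]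
  {Γ : Type*} [AddCommGroup Γ] [Module ℂ Γ] [Module A Γ] [Module Aᵐᵒᵖ Γ]
  [SMulCommClass A Aᵐᵒᵖ Γ] [IsScalarTower ℂ A Γ] [IsScalarTower ℂ Aᵐᵒᵖ Γ]
  (𝒞 : BicovariantCalculus A Γ) {N : ℕ} (ω : Module.Basis (Fin N) A Γ)

section Grading

/-! #### Parity -/

theorem add_gtmul (x y b : 𝒞.Cartan ω) : ((x + y) ᵍ⊗ₜ[ℂ] b : 𝒞.part ω ᵍ⊗[ℂ] 𝒞.part ω) =
    x ᵍ⊗ₜ[ℂ] b + y ᵍ⊗ₜ[ℂ] b :=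
  (congrArg (GradedTensorProduct.of ℂ (𝒞.part ω) (𝒞.part ω))
    (TensorProduct.add_tmul x y b)).trans (map_add _ _ _)

theorem smul_gtmul (c : ℂ) (x b : 𝒞.Cartan ω) :
    ((c • x) ᵍ⊗ₜ[ℂ] b : 𝒞.part ω ᵍ⊗[ℂ] 𝒞.part ω) = c • (x ᵍ⊗ₜ[ℂ] b) :=
  (congrArg (GradedTensorProduct.of ℂ (𝒞.part ω) (𝒞.part ω))
    (TensorProduct.smul_tmul' c x b).symm).trans (LinearEquiv.map_smul _ _ _)

theorem neg_gtmul (x b : 𝒞.Cartan ω) : ((-x) ᵍ⊗ₜ[ℂ] b : 𝒞.part ω ᵍ⊗[ℂ] 𝒞.part ω) =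
    -(x ᵍ⊗ₜ[ℂ] b) := by
  rw [← neg_one_smul ℂ x, smul_gtmul, neg_one_smul]

theorem gtmul_mul_of_even (x a b : 𝒞.Cartan ω) {y : 𝒞.Cartan ω} (hy : y ∈ 𝒞.part ω 0) :
    (x ᵍ⊗ₜ[ℂ] y * a ᵍ⊗ₜ[ℂ] b : 𝒞.part ω ᵍ⊗[ℂ] 𝒞.part ω) = (x * a) ᵍ⊗ₜ[ℂ] (y * b) := by
  obtain ⟨a₀, h0, a₁, h1, rfl⟩ := 𝒞.exists_part_decomp ω a
  have e0 := GradedTensorProduct.tmul_zero_coe_mul_coe_tmul (R := ℂ) (𝒞.part ω) (𝒞.part ω) x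
    ⟨y, hy⟩ (⟨a₀, h0⟩ : 𝒞.part ω 0) b
  have e1 := GradedTensorProduct.tmul_zero_coe_mul_coe_tmul (R := ℂ) (𝒞.part ω) (𝒞.part ω) x
    ⟨y, hy⟩ (⟨a₁, h1⟩ : 𝒞.part ω 1) b
  rw [mul_add x, add_gtmul, add_gtmul, mul_add]
  exact congrArg₂ (· + ·) e0 e1

theorem gtmul_mul_of_odd (x a b : 𝒞.Cartan ω) {y : 𝒞.Cartan ω} (hy : y ∈ 𝒞.part ω 1) :
    (x ᵍ⊗ₜ[ℂ] y * a ᵍ⊗ₜ[ℂ] b : 𝒞.part ω ᵍ⊗[ℂ] 𝒞.part ω) =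
      (x * 𝒞.parity ω a) ᵍ⊗ₜ[ℂ] (y * b) := by
  obtain ⟨a₀, h0, a₁, h1, rfl⟩ := 𝒞.exists_part_decomp ω a
  have e0 := GradedTensorProduct.tmul_coe_mul_coe_tmul (R := ℂ) (𝒞.part ω) (𝒞.part ω) x
    (⟨y, hy⟩ : 𝒞.part ω 1) (⟨a₀, h0⟩ : 𝒞.part ω 0) b
  have e1 := GradedTensorProduct.tmul_coe_mul_coe_tmul (R := ℂ) (𝒞.part ω) (𝒞.part ω) x
    (⟨y, hy⟩ : 𝒞.part ω 1) (⟨a₁, h1⟩ : 𝒞.part ω 1) b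
  rw [mul_zero, uzpow_zero, one_smul] at e0
  rw [mul_one, uzpow_one, Units.neg_smul, one_smul] at e1
  rw [map_add, (𝒞.mem_part_zero ω).1 h0, (𝒞.mem_part_one ω).1 h1, mul_add x, mul_neg,
    add_gtmul, add_gtmul, neg_gtmul, mul_add]
  exact congrArg₂ (· + ·) e0 e1

end Grading

section Bialgebra

variable (hω : ∀ i, 𝒞.IsLeftInvariant (ω i))

theorem exists_cartanComul : ∃ Δ : 𝒞.Cartan ω →ₐ[ℂ] 𝒞.part ω ᵍ⊗[ℂ] 𝒞.part ω,
    𝒞.IsCartanComul ω Δ ∧ ∀ h, Δ (𝒞.cev ω h) = GradedTensorProduct.of ℂ (𝒞.part ω) (𝒞.part ω)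
      (TensorProduct.map (𝒞.cev ω).toLinearMap (𝒞.cev ω).toLinearMap (𝒞.comulU ω hω h)) := by
  have hone : (1 : 𝒞.Cartan ω) ∈ 𝒞.part ω 0 := by simp [mem_part_zero]
  have hmul : ∀ x y : 𝒞.Cartan ω, (x ᵍ⊗ₜ[ℂ] 1 * 1 ᵍ⊗ₜ[ℂ] y : 𝒞.part ω ᵍ⊗[ℂ] 𝒞.part ω) =
      x ᵍ⊗ₜ[ℂ] y := fun x y => by rw [𝒞.gtmul_mul_of_even ω _ _ _ hone, mul_one, one_mul]
  obtain ⟨Δ, h1, h2, h3⟩ := 𝒞.exists_comul_of_maps ω hω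
    (GradedTensorProduct.includeLeft (𝒞.part ω) (𝒞.part ω))
    (GradedTensorProduct.includeRight (𝒞.part ω) (𝒞.part ω))
    (fun p q x hx y hy => by
      change (1 ᵍ⊗ₜ[ℂ] y * x ᵍ⊗ₜ[ℂ] 1 : 𝒞.part ω ᵍ⊗[ℂ] 𝒞.part ω) =
        _ • (x ᵍ⊗ₜ[ℂ] 1 * 1 ᵍ⊗ₜ[ℂ] y : 𝒞.part ω ᵍ⊗[ℂ] 𝒞.part ω)
      rw [hmul]
      rcases zmod_two_cases q with rfl | rfl
      · rw [𝒞.gtmul_mul_of_even ω _ _ _ hy]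
        simp
      · rw [𝒞.gtmul_mul_of_odd ω _ _ _ hy, (𝒞.mem_part ω).1 hx, ZMod.val_one, mul_one, mul_one,
          one_mul, smul_gtmul])
  have h1' : ∀ h, Δ (𝒞.cev ω h) = GradedTensorProduct.of ℂ (𝒞.part ω) (𝒞.part ω)
      (TensorProduct.map (𝒞.cev ω).toLinearMap (𝒞.cev ω).toLinearMap (𝒞.comulU ω hω h)) := by
    intro h
    rw [h1]
    generalize 𝒞.comulU ω hω h = t
    induction t using TensorProduct.induction_on with
    | zero => simp only [map_zero]
    | add p q hp hq => simp only [map_add, hp, hq]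
    | tmul h k => exact hmul _ _
  have h2' : ∀ i, Δ (𝒞.cxi ω i) = 1 ᵍ⊗ₜ[ℂ] 𝒞.cxi ω i + ∑ j, 𝒞.cxi ω j ᵍ⊗ₜ[ℂ] 𝒞.cf ω j i := fun i =>
    (h2 i).trans (congrArg _ (Finset.sum_congr rfl fun j _ => hmul _ _))
  refine ⟨Δ, ⟨fun i => ?_, fun i j => ?_, h2', h3⟩, h1'⟩
  · rw [← cev_evenX, h1', comulU_evenX, map_add, map_sum, map_add, map_sum]
    simp only [TensorProduct.map_tmul, AlgHom.toLinearMap_apply, map_one, cev_evenX, cev_evenF]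
  · rw [← cev_evenF, h1', comulU_evenF, map_sum, map_sum]
    simp only [TensorProduct.map_tmul, AlgHom.toLinearMap_apply, cev_evenF]

include hω in
theorem exists_cartanCounit : ∃ ε : 𝒞.Cartan ω →ₐ[ℂ] ℂ,
    𝒞.IsCartanCounit ω ε ∧ ∀ h, ε (𝒞.cev ω h) = h.1 1 := by
  let ψ : 𝒞.evenAlg ω →ₐ[ℂ] ℂ := AlgHom.ofLinearMap
    { toFun := fun h => h.1 1
      map_add' := fun h k => by simp
      map_smul' := fun c h => by simp }
    (by
      change (1 : WithConv (A →ₗ[ℂ] ℂ)) 1 = 1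
      rw [one_conv_apply, Bialgebra.counit_one])
    (fun h k => by
      change (h.1 * k.1) 1 = h.1 1 * k.1 1
      rw [conv_apply_lact, lact_apply, Bialgebra.comul_one, Algebra.TensorProduct.one_def]
      simp [mul_comm])
  obtain ⟨ε, h1, h2, h3⟩ := 𝒞.exists_cartan_hom ω hω ψ 0 0 (by simp) (by simp)
    (fun i => by
      rw [mul_zero, zero_mul, add_zero]
      exact (𝒞.Xc_one ω i).symm) (by simp) (by simp)
  exact ⟨ε, ⟨fun i => (h1 _).trans (𝒞.Xc_one ω i),
    fun i j => (h1 _).trans (𝒞.fc_one ω i j), h2, h3⟩, h1⟩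

theorem exists_isCartanAntipode (hS : Function.Bijective (HopfAlgebra.antipode ℂ : A →ₗ[ℂ] A))
    (hc : 𝒞.IsSCompatible ω) : ∃ T : 𝒞.Cartan ω ≃ₗ[ℂ] 𝒞.Cartan ω,
    𝒞.IsCartanAntipode ω hc T ∧ 𝒞.IsGradedAntiHom ω T.symm ∧
    (∀ h, T (𝒞.cev ω h) = 𝒞.cev ω (𝒞.evenS ω hω hc h)) ∧
    (∀ x, 𝒞.parity ω (T x) = T (𝒞.parity ω x)) := by
  obtain ⟨T, h1, h2, h3, h4, h5, h6⟩ := 𝒞.exists_cartanAntipodeEquiv ω hω hS hc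
  exact ⟨T, ⟨h1, fun i j => h3 _, fun i => (h3 _).trans (𝒞.cev_evenS_evenX ω hω hc i), h4, h5⟩,
    h2, h3, h6⟩

end Bialgebra

end BicovariantCalculus

end QuantumCartan
end

/-! ### The operators on forms as a representation of `C_Γ`. -/

noncomputable section

set_option linter.unusedSectionVars false

namespace QuantumCartan

namespace BicovariantCalculus

variable {A : Type*} [Ring A] [HopfAlgebra ℂ A]
  {Γ : Type*} [AddCommGroup Γ] [Module ℂ Γ] [Module A Γ] [Module Aᵐᵒᵖ Γ]
  [SMulCommClass A Aᵐᵒᵖ Γ] [IsScalarTower ℂ A Γ] [IsScalarTower ℂ Aᵐᵒᵖ Γ]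
  (𝒞 : BicovariantCalculus A Γ) {N : ℕ} (ω : Module.Basis (Fin N) A Γ)

/-! #### The right representation -/

section Representation

variable {D : 𝒞.Ext →ₗ[ℂ] 𝒞.Ext} (hD : 𝒞.IsExteriorDifferential D)
  (hω : ∀ i, 𝒞.IsLeftInvariant (ω i))
  (hS : Function.Bijective (HopfAlgebra.antipode ℂ : A →ₗ[ℂ] A))
  {δL : 𝒞.Ext →ₐ[ℂ] A ⊗[ℂ] 𝒞.Ext} (hδ : 𝒞.IsExteriorCoaction δL)

theorem eact_one_form (h : WithConv (A →ₗ[ℂ] ℂ)) : eact δL h 1 = h 1 • (1 : 𝒞.Ext) := by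
  rw [eact_apply, map_one, Algebra.TensorProduct.one_def]
  simp

include hω in
theorem eact_mul_comulU (h : 𝒞.evenAlg ω) (α β : 𝒞.Ext) : eact δL h.1 (α * β) =
    LinearMap.mul' ℂ 𝒞.Ext (TensorProduct.map
      ((eact δL).flip α ∘ₗ (𝒞.evenAlg ω).val.toLinearMap)
      ((eact δL).flip β ∘ₗ (𝒞.evenAlg ω).val.toLinearMap) (𝒞.comulU ω hω h)) := by
  obtain ⟨S, hS⟩ := TensorProduct.exists_finset (𝒞.comulU ω hω h)
  have hab : ∀ x y, h.1 (x * y) = ∑ s : S, s.1.1.1 x * s.1.2.1 y := fun x y => by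
    rw [← 𝒞.pairing_comulU ω hω, hS, Finset.sum_coe_sort S fun s => s.1.1 x * s.2.1 y]
    simp [LinearMap.sum_apply]
  rw [eact_apply_mul hab, hS, Finset.sum_coe_sort S fun s => eact δL s.1.1 α * eact δL s.2.1 β,
    map_sum, map_sum]
  rfl

include hD hω hS hδ in
/-- The homomorphism of the quantum Cartan algebra to the endomorphisms of the exterior algebra
obtained from the right representation by composition with the inverse antipode. -/
theorem exists_cartanHomEnd : ∃ π : 𝒞.Cartan ω →ₐ[ℂ] Module.End ℂ 𝒞.Ext,
    (∀ h α, π (𝒞.cev ω h) α = eact δL (dualSInv hS h.1) α) ∧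
    (∀ i, π (𝒞.cxi ω i) = -𝒞.inner ω hω hS hδ i) ∧ π (𝒞.cdelta ω) = D := by
  let ψ : 𝒞.evenAlg ω →ₐ[ℂ] Module.End ℂ 𝒞.Ext := AlgHom.ofLinearMap
    (eact δL ∘ₗ (dualSInv hS) ∘ₗ (𝒞.evenAlg ω).val.toLinearMap)
    (LinearMap.ext fun α => by
      change eact δL (dualSInv hS 1) α = α
      rw [dualSInv_one, eact_one hδ])
    (fun h k => LinearMap.ext fun α => by
      change eact δL (dualSInv hS (h.1 * k.1)) α =
        eact δL (dualSInv hS h.1) (eact δL (dualSInv hS k.1) α)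
      rw [dualSInv_mul, eact_mul hδ])
  have hψ : ∀ h α, ψ h α = eact δL (dualSInv hS h.1) α := fun _ _ => rfl
  -- The map `h ↦ (◁ S⁻¹(h))` preserves products as a composite of two order-reversing maps. The
  -- sign of `-i_i` turns Cartan's formula, whose right side is `-(◁ S⁻¹(X_i))`, into the relation
  -- of `ξ_i` with `δ`.
  obtain ⟨π, h1, h2, h3⟩ := 𝒞.exists_cartan_hom ω hω ψ (fun i => -𝒞.inner ω hω hS hδ i) D
    (fun i h => LinearMap.ext fun α => by
      change -(𝒞.inner ω hω hS hδ i (ψ h α)) = _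
      rw [hψ, 𝒞.inner_eact ω hω hS hδ, LinearMap.sum_apply, ← Finset.sum_neg_distrib]
      exact Finset.sum_congr rfl fun m _ => (map_neg (eact δL _) _).symm)
    (fun h => LinearMap.ext fun α => by
      rw [Module.End.mul_apply, Module.End.mul_apply, hψ, hψ, eact_differential hD hδ])
    (fun i => LinearMap.ext fun α => by
      have := 𝒞.inner_differential_add ω hD hω hS hδ i α
      change -(𝒞.inner ω hω hS hδ i (D α)) + D (-(𝒞.inner ω hω hS hδ i α)) =
        eact δL (dualSInv hS (𝒞.Xc ω i)) α
      rw [map_neg, ← neg_add, this, neg_neg])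
    (LinearMap.ext fun α => hD.sq α)
    (fun c hc => LinearMap.ext fun α => by
      refine Eq.trans ?_ (𝒞.inner_inner ω hω hS hδ c hc α)
      rw [LinearMap.sum_apply]
      refine Finset.sum_congr rfl fun i _ => ?_
      rw [LinearMap.sum_apply]
      refine Finset.sum_congr rfl fun j _ => ?_
      change c i j • -(𝒞.inner ω hω hS hδ i (-(𝒞.inner ω hω hS hδ j α))) = _
      rw [map_neg, neg_neg])
  exact ⟨π, fun h α => by rw [h1, hψ], h2, h3⟩

end Representation

section RightRep

variable {D : 𝒞.Ext →ₗ[ℂ] 𝒞.Ext} (hD : 𝒞.IsExteriorDifferential D)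
  (hω : ∀ i, 𝒞.IsLeftInvariant (ω i))
  (hS : Function.Bijective (HopfAlgebra.antipode ℂ : A →ₗ[ℂ] A))
  {δL : 𝒞.Ext →ₐ[ℂ] A ⊗[ℂ] 𝒞.Ext} (hδ : 𝒞.IsExteriorCoaction δL)

include hω hS hδ in
-- The operator `∑ i_j ∘ (◁ f_{ji})` is the action of `ξ_i` under `ρ`. In the twisted term of the
-- Leibniz rule `f` cancels `S⁻¹(f)`, which leaves the rule dictated by `Δ(ξ_i) = 1 ⊗ ξ_i + ∑ ξ_j ⊗
-- f_{ji}`.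
theorem sum_inner_eact_fc_mul (i : Fin N) (α β : 𝒞.Ext) :
    ∑ j, 𝒞.inner ω hω hS hδ j (eact δL (𝒞.fc ω j i) (α * β)) =
      𝒞.extParity α * ∑ j, 𝒞.inner ω hω hS hδ j (eact δL (𝒞.fc ω j i) β) +
      ∑ k, (∑ j, 𝒞.inner ω hω hS hδ j (eact δL (𝒞.fc ω j k) α)) * eact δL (𝒞.fc ω k i) β := by
  simp only [eact_apply_mul (𝒞.fc_mul ω hω _ _), map_sum, inner_mul, Finset.sum_add_distrib]
  rw [add_comm]
  refine congrArg₂ (· + ·) ?_ ?_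
  · have key : ∀ k m, ∑ j, eact δL (𝒞.gc ω hS m j) (eact δL (𝒞.fc ω j k) α) =
        if m = k then α else 0 := by
      intro k m
      simp only [← eact_mul hδ]
      rw [← LinearMap.sum_apply, ← map_sum, 𝒞.sum_fc_mul_gc ω hω]
      split_ifs
      · rw [eact_one hδ]
      · simp
    rw [Finset.mul_sum, Finset.sum_comm]
    refine Finset.sum_congr rfl fun k _ => ?_
    rw [Finset.sum_comm]
    simp only [← Finset.sum_mul, ← map_sum, key]
    simp [apply_ite (𝒞.extParity)]
  · rw [Finset.sum_comm]
    simp only [Finset.sum_mul]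

end RightRep

end BicovariantCalculus

end QuantumCartan
end

/-! ### Sign rules for the action of the graded tensor square on pairs of forms. -/

noncomputable section

set_option linter.unusedSectionVars false

namespace QuantumCartan

namespace BicovariantCalculus

variable {A : Type*} [Ring A] [HopfAlgebra ℂ A]
  {Γ : Type*} [AddCommGroup Γ] [Module ℂ Γ] [Module A Γ] [Module Aᵐᵒᵖ Γ]
  [SMulCommClass A Aᵐᵒᵖ Γ] [IsScalarTower ℂ A Γ] [IsScalarTower ℂ Aᵐᵒᵖ Γ]
  (𝒞 : BicovariantCalculus A Γ) {N : ℕ} (ω : Module.Basis (Fin N) A Γ)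

section ModuleAlgebra

theorem gtensor_induction {p : 𝒞.part ω ᵍ⊗[ℂ] 𝒞.part ω → Prop} (h0 : p 0)
    (htmul : ∀ a b : 𝒞.Cartan ω, p (a ᵍ⊗ₜ[ℂ] b)) (hadd : ∀ s t, p s → p t → p (s + t))
    (t : 𝒞.part ω ᵍ⊗[ℂ] 𝒞.part ω) : p t := by
  obtain ⟨t, rfl⟩ := (GradedTensorProduct.of ℂ (𝒞.part ω) (𝒞.part ω)).surjective t
  induction t using TensorProduct.induction_on with
  | zero => rw [map_zero]; exact h0
  | tmul a b => exact htmul a b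
  | add s t hs ht => rw [map_add]; exact hadd _ _ hs ht

/-- The parity automorphism of the graded tensor square. -/
def gparity : 𝒞.part ω ᵍ⊗[ℂ] 𝒞.part ω →ₗ[ℂ] 𝒞.part ω ᵍ⊗[ℂ] 𝒞.part ω :=
  (GradedTensorProduct.of ℂ (𝒞.part ω) (𝒞.part ω)).toLinearMap ∘ₗ
    TensorProduct.map (𝒞.parity ω).toLinearMap (𝒞.parity ω).toLinearMap ∘ₗ
      (GradedTensorProduct.of ℂ (𝒞.part ω) (𝒞.part ω)).symm.toLinearMap

theorem gparity_tmul (a b : 𝒞.Cartan ω) : 𝒞.gparity ω (a ᵍ⊗ₜ[ℂ] b) =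
    𝒞.parity ω a ᵍ⊗ₜ[ℂ] 𝒞.parity ω b := rfl

theorem gparity_mul_of_even (x : 𝒞.Cartan ω) {y : 𝒞.Cartan ω} (hy : y ∈ 𝒞.part ω 0)
    (t : 𝒞.part ω ᵍ⊗[ℂ] 𝒞.part ω) :
    𝒞.gparity ω (x ᵍ⊗ₜ[ℂ] y * t) = 𝒞.parity ω x ᵍ⊗ₜ[ℂ] y * 𝒞.gparity ω t := by
  induction t using 𝒞.gtensor_induction ω with
  | h0 => rw [mul_zero, map_zero, mul_zero]
  | hadd s t hs ht => rw [mul_add (x ᵍ⊗ₜ[ℂ] y), map_add, hs, ht, map_add, mul_add]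
  | htmul a b =>
    rw [𝒞.gtmul_mul_of_even ω _ _ _ hy, gparity_tmul, gparity_tmul, 𝒞.gtmul_mul_of_even ω _ _ _ hy,
      map_mul, map_mul, (𝒞.mem_part_zero ω).1 hy]

theorem gparity_mul_of_odd {y : 𝒞.Cartan ω} (hy : y ∈ 𝒞.part ω 1)
    (t : 𝒞.part ω ᵍ⊗[ℂ] 𝒞.part ω) :
    𝒞.gparity ω (1 ᵍ⊗ₜ[ℂ] y * t) = -(1 ᵍ⊗ₜ[ℂ] y * 𝒞.gparity ω t) := by
  induction t using 𝒞.gtensor_induction ω with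
  | h0 => rw [mul_zero, map_zero, mul_zero, neg_zero]
  | hadd s t hs ht => rw [mul_add (1 ᵍ⊗ₜ[ℂ] y), map_add, hs, ht, map_add, mul_add, neg_add]
  | htmul a b =>
    rw [𝒞.gtmul_mul_of_odd ω _ _ _ hy, gparity_tmul, gparity_tmul, 𝒞.gtmul_mul_of_odd ω _ _ _ hy,
      map_mul, map_mul, (𝒞.mem_part_one ω).1 hy, map_one, ← neg_gtmul]
    exact congrArg (GradedTensorProduct.of ℂ (𝒞.part ω) (𝒞.part ω))
      (by rw [neg_mul, TensorProduct.tmul_neg, TensorProduct.neg_tmul])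

variable {ω} {Δ : 𝒞.Cartan ω →ₐ[ℂ] 𝒞.part ω ᵍ⊗[ℂ] 𝒞.part ω} (hΔ : 𝒞.IsCartanComul ω Δ)
  (hω : ∀ i, 𝒞.IsLeftInvariant (ω i))
  (hU : ∀ h, Δ (𝒞.cev ω h) = GradedTensorProduct.of ℂ (𝒞.part ω) (𝒞.part ω)
      (TensorProduct.map (𝒞.cev ω).toLinearMap (𝒞.cev ω).toLinearMap (𝒞.comulU ω hω h)))

theorem cf_mem_part (i j : Fin N) : 𝒞.cf ω i j ∈ 𝒞.part ω 0 := 𝒞.cev_mem_part ω _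

include hΔ hU in
theorem comul_parity (x : 𝒞.Cartan ω) : Δ (𝒞.parity ω x) = 𝒞.gparity ω (Δ x) := by
  induction x using 𝒞.cartan_induction ω with
  | h1 =>
    rw [map_one, map_one]
    change (1 ᵍ⊗ₜ[ℂ] 1 : 𝒞.part ω ᵍ⊗[ℂ] 𝒞.part ω) = 𝒞.gparity ω (1 ᵍ⊗ₜ[ℂ] 1)
    rw [gparity_tmul, map_one]
  | hadd x y hx hy => rw [map_add, map_add, hx, hy, map_add, map_add]
  | hev h x hx =>
    rw [map_mul, map_mul, parity_cev, hx, map_mul, hU]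
    generalize 𝒞.comulU ω hω h = u
    induction u using TensorProduct.induction_on with
    | zero => rw [map_zero, map_zero, zero_mul, zero_mul, map_zero]
    | add s t hs ht => rw [map_add, map_add, add_mul, add_mul, hs, ht, map_add]
    | tmul h k =>
      refine Eq.trans ?_ (𝒞.gparity_mul_of_even ω _ (𝒞.cev_mem_part ω k) _).symm
      rw [AlgHom.toLinearMap_apply, parity_cev]
      rfl
  | hxi i x hx =>
    rw [map_mul, map_mul, parity_cxi, hx, map_mul, map_neg, hΔ.xi, neg_mul, add_mul, add_mul,
      Finset.sum_mul, Finset.sum_mul, map_add, map_sum, 𝒞.gparity_mul_of_odd ω (𝒞.cxi_mem_part ω i),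
      neg_add, ← Finset.sum_neg_distrib]
    congr 1
    refine Finset.sum_congr rfl fun j _ => ?_
    rw [𝒞.gparity_mul_of_even ω _ (𝒞.cf_mem_part j i), parity_cxi, neg_gtmul, neg_mul]
  | hdelta x hx =>
    rw [map_mul, map_mul, parity_cdelta, hx, map_mul, map_neg, hΔ.delta, neg_mul, add_mul, add_mul,
      map_add, 𝒞.gparity_mul_of_odd ω (𝒞.cdelta_mem_part ω), neg_add]
    congr 1
    rw [𝒞.gparity_mul_of_even ω _ (by simp [mem_part_zero]), parity_cdelta, neg_gtmul, neg_mul]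

theorem parity_pow_of_even {y : 𝒞.Cartan ω} (hy : y ∈ 𝒞.part ω 0) (k : ℕ) :
    (𝒞.parity ω ^ k) y = y := by
  induction k with
  | zero => rfl
  | succ k ih => rw [pow_succ, AlgHom.mul_apply, (𝒞.mem_part_zero ω).1 hy, ih]

theorem parity_pow_of_odd {y : 𝒞.Cartan ω} (hy : y ∈ 𝒞.part ω 1) (k : ℕ) :
    (𝒞.parity ω ^ k) y = (-1 : ℂ) ^ k • y := by
  induction k with
  | zero => simp
  | succ k ih =>
    rw [pow_succ, AlgHom.mul_apply, (𝒞.mem_part_one ω).1 hy, map_neg, ih, pow_succ]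
    simp

/-- The graded product of the actions of a tensor on a pair of forms. -/
def gprod (φ : 𝒞.Cartan ω →ₗ[ℂ] Module.End ℂ 𝒞.Ext) (k : ℕ) (α β : 𝒞.Ext) :
    𝒞.part ω ᵍ⊗[ℂ] 𝒞.part ω →ₗ[ℂ] 𝒞.Ext :=
  𝒞.gradedProd ω φ k α β ∘ₗ (GradedTensorProduct.of ℂ (𝒞.part ω) (𝒞.part ω)).symm.toLinearMap

theorem gprod_tmul (φ : 𝒞.Cartan ω →ₗ[ℂ] Module.End ℂ 𝒞.Ext) (k : ℕ) (α β : 𝒞.Ext)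
    (a b : 𝒞.Cartan ω) :
    𝒞.gprod φ k α β (a ᵍ⊗ₜ[ℂ] b) = φ a α * φ ((𝒞.parity ω ^ k) b) β := rfl

variable {φ : 𝒞.Cartan ω →ₗ[ℂ] Module.End ℂ 𝒞.Ext} (hφ : 𝒞.IsGradedAntiHom ω φ)

include hφ

theorem gprod_even_mul_even {x y : 𝒞.Cartan ω} (hx : x ∈ 𝒞.part ω 0) (hy : y ∈ 𝒞.part ω 0)
    (k : ℕ) (α β : 𝒞.Ext) (t : 𝒞.part ω ᵍ⊗[ℂ] 𝒞.part ω) :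
    𝒞.gprod φ k α β (x ᵍ⊗ₜ[ℂ] y * t) = 𝒞.gprod φ k (φ x α) (φ y β) t := by
  induction t using 𝒞.gtensor_induction ω with
  | h0 => rw [mul_zero, map_zero, map_zero]
  | hadd s t hs ht => rw [mul_add (x ᵍ⊗ₜ[ℂ] y), map_add, hs, ht, map_add]
  | htmul a b =>
    rw [𝒞.gtmul_mul_of_even ω _ _ _ hy, gprod_tmul, gprod_tmul, map_mul (𝒞.parity ω ^ k), 𝒞.parity_pow_of_even hy,
      hφ.mul_even hx, hφ.mul_even hy]
    rfl

/-- Reversing the odd `x` with the first leg of `t` costs the parity of that leg. Acting by `x`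
changes the parity of `α`, hence `k + 1`, and on the second leg this extra power of the parity
undoes the one contained in `gparity`. -/
theorem gprod_odd_mul_even {x y : 𝒞.Cartan ω} (hx : x ∈ 𝒞.part ω 1) (hy : y ∈ 𝒞.part ω 0)
    (k : ℕ) (α β : 𝒞.Ext) (t : 𝒞.part ω ᵍ⊗[ℂ] 𝒞.part ω) :
    𝒞.gprod φ k α β (x ᵍ⊗ₜ[ℂ] y * t) = 𝒞.gprod φ (k + 1) (φ x α) (φ y β) (𝒞.gparity ω t) := by
  induction t using 𝒞.gtensor_induction ω with
  | h0 => rw [mul_zero, map_zero, map_zero, map_zero]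
  | hadd s t hs ht => rw [mul_add (x ᵍ⊗ₜ[ℂ] y), map_add, hs, ht, map_add, map_add]
  | htmul a b =>
    rw [𝒞.gtmul_mul_of_even ω _ _ _ hy, gparity_tmul, gprod_tmul, gprod_tmul, map_mul (𝒞.parity ω ^ k),
      𝒞.parity_pow_of_even hy, hφ.mul_odd hx, hφ.mul_even hy, pow_succ, AlgHom.mul_apply,
      parity_parity]
    rfl

theorem gprod_one_mul_odd {y : 𝒞.Cartan ω} (hy : y ∈ 𝒞.part ω 1)
    (k : ℕ) (α β : 𝒞.Ext) (t : 𝒞.part ω ᵍ⊗[ℂ] 𝒞.part ω) :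
    𝒞.gprod φ k α β (1 ᵍ⊗ₜ[ℂ] y * t) =
      (-1 : ℂ) ^ k • 𝒞.gprod φ k α (φ y β) (𝒞.gparity ω t) := by
  induction t using 𝒞.gtensor_induction ω with
  | h0 => rw [mul_zero, map_zero, map_zero, map_zero, smul_zero]
  | hadd s t hs ht => rw [mul_add (1 ᵍ⊗ₜ[ℂ] y), map_add, hs, ht, map_add, map_add, smul_add]
  | htmul a b =>
    rw [𝒞.gtmul_mul_of_odd ω _ _ _ hy, gparity_tmul, gprod_tmul, gprod_tmul, map_mul (𝒞.parity ω ^ k),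
      𝒞.parity_pow_of_odd hy, one_mul, smul_mul_assoc, map_smul, hφ.mul_odd hy,
      ← AlgHom.mul_apply, ← AlgHom.mul_apply, ← pow_succ, ← pow_succ', LinearMap.smul_apply,
      mul_smul_comm]
    rfl

include hΔ hU in
-- This is the induction step shared by `ξ_i` and `δ`. The number `k` records only the parity of
-- `α`, not its degree: `ξ_i` lowers the degree and `δ` raises it, and `k + 1` is right for both.
theorem action_mul_of_odd {ι : Type*} [Fintype ι] {g : 𝒞.Cartan ω} (hg : g ∈ 𝒞.part ω 1)
    (g' y : ι → 𝒞.Cartan ω) (hg' : ∀ j, g' j ∈ 𝒞.part ω 1) (hy : ∀ j, y j ∈ 𝒞.part ω 0)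
    (hΔg : Δ g = 1 ᵍ⊗ₜ[ℂ] g + ∑ j, g' j ᵍ⊗ₜ[ℂ] y j)
    (hφg : ∀ α β, φ g (α * β) = 𝒞.extParity α * φ g β + ∑ j, φ (g' j) α * φ (y j) β)
    (hG : ∀ j α, 𝒞.extParity (φ (g' j) α) = -φ (g' j) (𝒞.extParity α)) {x : 𝒞.Cartan ω}
    (hx : ∀ k α β, 𝒞.extParity α = (-1 : ℂ) ^ k • α →
      φ (𝒞.parity ω x) (α * β) = 𝒞.gprod φ k α β (Δ (𝒞.parity ω x)))
    (k : ℕ) (α β : 𝒞.Ext) (hα : 𝒞.extParity α = (-1 : ℂ) ^ k • α) :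
    φ (g * x) (α * β) = 𝒞.gprod φ k α β (Δ (g * x)) := by
  rw [hφ.mul_odd hg, Module.End.mul_apply, hφg, hα, smul_mul_assoc, map_add, map_smul, map_sum,
    hx k _ _ hα, map_mul, hΔg, add_mul, map_add, 𝒞.gprod_one_mul_odd hφ hg, Finset.sum_mul,
    map_sum, 𝒞.comul_parity hΔ hω hU]
  congr 1
  refine Finset.sum_congr rfl fun j _ => ?_
  rw [hx (k + 1), 𝒞.gprod_odd_mul_even hφ (hg' j) (hy j), 𝒞.comul_parity hΔ hω hU]
  rw [hG, hα, map_smul, pow_succ, mul_neg_one, neg_smul]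

end ModuleAlgebra

end BicovariantCalculus

end QuantumCartan
end

/-! ### Parity of forms; existence and uniqueness of the right representation. -/

noncomputable section

set_option linter.unusedSectionVars false

namespace QuantumCartan

namespace BicovariantCalculus

variable {A : Type*} [Ring A] [HopfAlgebra ℂ A]
  {Γ : Type*} [AddCommGroup Γ] [Module ℂ Γ] [Module A Γ] [Module Aᵐᵒᵖ Γ]
  [SMulCommClass A Aᵐᵒᵖ Γ] [IsScalarTower ℂ A Γ] [IsScalarTower ℂ Aᵐᵒᵖ Γ]
  (𝒞 : BicovariantCalculus A Γ) {N : ℕ} (ω : Module.Basis (Fin N) A Γ)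

section FormParity

/-- Up to the factor `2`, the operator `1 + (-1)^p extParity` projects onto the forms of parity `p`,
so these are an eigenspace of `extParity`. Parity statements can then be proved by computing with
one automorphism. -/
theorem mem_formParity_iff {p : ZMod 2} {α : 𝒞.Ext} :
    α ∈ 𝒞.formParity p ↔ 𝒞.extParity α = (-1 : ℂ) ^ p.val • α := by
  have hpow : ∀ k : ℕ, (-1 : ℂ) ^ (k : ZMod 2).val = (-1 : ℂ) ^ k := fun k => by
    rw [ZMod.val_natCast, ← neg_one_pow_eq_pow_mod_two]
  have hproj : ∀ α, α + (-1 : ℂ) ^ p.val • 𝒞.extParity α ∈ 𝒞.formParity p := by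
    intro α
    induction α using 𝒞.homogeneous_induction with
    | h k α hα =>
      rw [𝒞.extParity_of_mem hα, smul_smul, ← hpow k]
      by_cases h : (k : ZMod 2) = p
      · have hm : α ∈ 𝒞.formParity p :=
          Submodule.mem_iSup_of_mem (p := fun k : {k : ℕ // (k : ZMod 2) = p} => 𝒞.form k)
            ⟨k, h⟩ hα
        exact add_mem hm (Submodule.smul_mem _ _ hm)
      · have : (-1 : ℂ) ^ p.val * (-1 : ℂ) ^ (k : ZMod 2).val = -1 := by
          rcases zmod_two_cases p with rfl | rfl <;>
            rcases zmod_two_cases (k : ZMod 2) with hk | hk <;> rw [hk] at h ⊢ <;>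
            first
              | exact absurd rfl h
              | simp [ZMod.val_one]
        rw [this, neg_one_smul, add_neg_cancel]
        exact zero_mem _
    | h0 => simp
    | hadd α β h1 h2 =>
      rw [map_add, smul_add, add_add_add_comm]
      exact add_mem h1 h2
  constructor
  · intro h
    refine Submodule.iSup_induction (fun k : {k : ℕ // (k : ZMod 2) = p} => 𝒞.form k)
      (motive := fun α => 𝒞.extParity α = (-1 : ℂ) ^ p.val • α) h ?_ (by simp) ?_
    · rintro ⟨k, rfl⟩ α hα
      rw [𝒞.extParity_of_mem hα, hpow]
    · intro α β h1 h2
      rw [map_add, h1, h2, smul_add]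
  · intro h
    have h2 := hproj α
    rw [h, smul_smul, ← pow_add, Even.neg_one_pow ⟨_, rfl⟩, one_smul, ← two_smul ℂ α] at h2
    have := Submodule.smul_mem _ (2⁻¹ : ℂ) h2
    rwa [smul_smul, inv_mul_cancel₀ two_ne_zero, one_smul] at this

end FormParity

section RightModuleAlgebra

variable {D : 𝒞.Ext →ₗ[ℂ] 𝒞.Ext} (hD : 𝒞.IsExteriorDifferential D)
  (hω : ∀ i, 𝒞.IsLeftInvariant (ω i))
  (hS : Function.Bijective (HopfAlgebra.antipode ℂ : A →ₗ[ℂ] A))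
  {δL : 𝒞.Ext →ₐ[ℂ] A ⊗[ℂ] 𝒞.Ext} (hδ : 𝒞.IsExteriorCoaction δL)
  (hc : 𝒞.IsSCompatible ω) {T : 𝒞.Cartan ω ≃ₗ[ℂ] 𝒞.Cartan ω}
  (hT : 𝒞.IsCartanAntipode ω hc T)
  (hTev : ∀ h, T (𝒞.cev ω h) = 𝒞.cev ω (𝒞.evenS ω hω hc h))

include hD hT hTev in
-- The representation is `π ∘ T`: a homomorphism after a graded anti-homomorphism is again one of
-- the latter kind. Its values on `ξ_i` and `δ` themselves, rather than on their images under `S⁻¹`,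
-- are recorded for the induction over generators.
theorem exists_rightRep : ∃ φ : 𝒞.Cartan ω →ₗ[ℂ] Module.End ℂ 𝒞.Ext,
    𝒞.IsRightCartanRep ω hS δL (𝒞.inner ω hω hS hδ) D T φ ∧
    (∀ h α, φ (𝒞.cev ω h) α = eact δL h.1 α) ∧
    (∀ i α, φ (𝒞.cxi ω i) α = ∑ j, 𝒞.inner ω hω hS hδ j (eact δL (𝒞.fc ω j i) α)) ∧
    φ (𝒞.cdelta ω) = -D := by
  obtain ⟨π, h1, h2, h3⟩ := 𝒞.exists_cartanHomEnd ω hD hω hS hδ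
  have hev : ∀ h α, π (T (𝒞.cev ω h)) α = eact δL h.1 α := fun h α => by
    rw [hTev, h1]
    exact congrArg (eact δL · α) (dualSInv_dualS hS h.1)
  have hsymm : ∀ x, (π.toLinearMap ∘ₗ T.toLinearMap) (T.symm x) = π x := fun x =>
    congrArg π (T.apply_symm_apply x)
  refine ⟨π.toLinearMap ∘ₗ T.toLinearMap, ⟨⟨?_, ?_⟩, ?_, ?_, ?_, ?_⟩, hev, ?_, ?_⟩
  · change π (T 1) = 1
    rw [hT.antiHom.one, map_one]
  · intro p q x hx y hy
    change π (T (x * y)) = _ • (π (T y) * π (T x))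
    rw [hT.antiHom.mul p q x hx y hy, map_smul, map_mul]
  · intro j
    rw [map_neg, hsymm]
    refine LinearMap.ext fun α => ?_
    rw [← cev_evenX, LinearMap.neg_apply, h1]
    change _ = eact δL (-(dualSInv hS (𝒞.Xc ω j))) α
    rw [map_neg]
    rfl
  · intro j k
    rw [hsymm]
    exact LinearMap.ext fun α => h1 _ α
  · intro j
    rw [map_neg, hsymm, h2]
    exact neg_neg _
  · rw [hsymm, h3]
  · intro i α
    change π (T (𝒞.cxi ω i)) α = _
    rw [hT.xi, map_neg, map_sum]
    change -((∑ j, π (𝒞.cxi ω j * _)) α) = _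
    rw [LinearMap.sum_apply, ← Finset.sum_neg_distrib]
    refine Finset.sum_congr rfl fun j _ => ?_
    have := hev (𝒞.evenF ω j i) α
    rw [hTev] at this
    rw [map_mul, h2]
    change -(-(𝒞.inner ω hω hS hδ j (π (𝒞.cev ω (𝒞.evenS ω hω hc (𝒞.evenF ω j i))) α))) = _
    rw [neg_neg, this]
    rfl
  · change π (T (𝒞.cdelta ω)) = -D
    rw [hT.delta, map_neg, h3]

/-- Composition with `T⁻¹` removes the signs, so `φ ∘ T⁻¹` is an ordinary homomorphism. Its values
on `X`, `f`, `ξ` and `δ` are prescribed, and these generate `C_Γ`. -/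
theorem isRightCartanRep_unique (hT' : 𝒞.IsGradedAntiHom ω T.symm)
    (hTp : ∀ x, 𝒞.parity ω (T x) = T (𝒞.parity ω x)) {I : Fin N → 𝒞.Ext →ₗ[ℂ] 𝒞.Ext}
    {φ φ' : 𝒞.Cartan ω →ₗ[ℂ] Module.End ℂ 𝒞.Ext} (h : 𝒞.IsRightCartanRep ω hS δL I D T φ)
    (h' : 𝒞.IsRightCartanRep ω hS δL I D T φ') : φ = φ' := by
  have hmem : ∀ p, ∀ x ∈ 𝒞.part ω p, T.symm x ∈ 𝒞.part ω p := fun p x hx => by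
    rw [mem_part] at hx ⊢
    apply T.injective
    rw [← hTp, map_smul, T.apply_symm_apply, hx]
  have key : ∀ φ : 𝒞.Cartan ω →ₗ[ℂ] Module.End ℂ 𝒞.Ext, 𝒞.IsRightCartanRep ω hS δL I D T φ →
      ∃ ψ : 𝒞.Cartan ω →ₐ[ℂ] Module.End ℂ 𝒞.Ext, ∀ x, ψ x = φ (T.symm x) := by
    intro φ h
    refine ⟨AlgHom.ofLinearMap (φ ∘ₗ T.symm.toLinearMap) ?_ ?_, fun x => rfl⟩
    · exact (congrArg φ hT'.one).trans h.antiHom.one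
    · intro x y
      change φ (T.symm (x * y)) = φ (T.symm x) * φ (T.symm y)
      obtain ⟨x₀, h0, x₁, h1, rfl⟩ := 𝒞.exists_part_decomp ω x
      have hs : ∀ z, T.symm (𝒞.parity ω (𝒞.parity ω z)) = T.symm z := fun z => by rw [parity_parity]
      have hp : ∀ z, 𝒞.parity ω (T.symm z) = T.symm (𝒞.parity ω z) := fun z => by
        apply T.injective
        rw [← hTp, T.apply_symm_apply, T.apply_symm_apply]
      have e0 := IsGradedAntiHom.mul_even (φ := T.symm.toLinearMap) hT' h0 y
      have e1 := IsGradedAntiHom.mul_odd (φ := T.symm.toLinearMap) hT' h1 y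
      simp only [LinearEquiv.coe_coe] at e0 e1
      rw [add_mul, map_add, e0, e1, map_add, h.antiHom.mul_even_right _ (hmem 0 _ h0),
        h.antiHom.mul_odd_right _ (hmem 1 _ h1), hp, parity_parity, map_add, map_add, add_mul]
  obtain ⟨ψ, hψ⟩ := key φ h
  obtain ⟨ψ', hψ'⟩ := key φ' h'
  have hψψ : ψ = ψ' := by
    refine 𝒞.cartan_hom_ext ω (fun k => ?_) (fun i => ?_) ?_
    · induction k using 𝒞.evenAlg_induction ω with
      | hX i =>
        rw [hψ, hψ', cev_evenX, ← neg_inj (G := Module.End ℂ 𝒞.Ext), ← map_neg φ, ← map_neg φ', h.R, h'.R]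
      | hf i j => rw [hψ, hψ', cev_evenF, h.f, h'.f]
      | h1 => rw [map_one, map_one, map_one]
      | hsmul c k hk => rw [map_smul, map_smul, map_smul, hk]
      | hadd k l hk hl => rw [map_add, map_add, map_add, hk, hl]
      | hmul k l hk hl => rw [map_mul, map_mul, map_mul, hk, hl]
    · rw [hψ, hψ', ← neg_inj (G := Module.End ℂ 𝒞.Ext), ← map_neg φ, ← map_neg φ', h.xi, h'.xi]
    · rw [hψ, hψ', h.delta, h'.delta]
  refine LinearMap.ext fun x => ?_
  rw [← T.symm_apply_apply x, ← hψ, ← hψ', hψψ]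

end RightModuleAlgebra

end BicovariantCalculus

end QuantumCartan
end

/-! ### The module algebra law and the theorem. -/

noncomputable section

set_option linter.unusedSectionVars false

namespace QuantumCartan

namespace BicovariantCalculus

variable {A : Type*} [Ring A] [HopfAlgebra ℂ A]
  {Γ : Type*} [AddCommGroup Γ] [Module ℂ Γ] [Module A Γ] [Module Aᵐᵒᵖ Γ]
  [SMulCommClass A Aᵐᵒᵖ Γ] [IsScalarTower ℂ A Γ] [IsScalarTower ℂ Aᵐᵒᵖ Γ]
  (𝒞 : BicovariantCalculus A Γ) {N : ℕ} (ω : Module.Basis (Fin N) A Γ)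

section RightModuleAlgebra

variable {ω} {D : 𝒞.Ext →ₗ[ℂ] 𝒞.Ext} (hD : 𝒞.IsExteriorDifferential D)
  (hω : ∀ i, 𝒞.IsLeftInvariant (ω i))
  (hS : Function.Bijective (HopfAlgebra.antipode ℂ : A →ₗ[ℂ] A))
  {δL : 𝒞.Ext →ₐ[ℂ] A ⊗[ℂ] 𝒞.Ext} (hδ : 𝒞.IsExteriorCoaction δL)
  {Δ : 𝒞.Cartan ω →ₐ[ℂ] 𝒞.part ω ᵍ⊗[ℂ] 𝒞.part ω} (hΔ : 𝒞.IsCartanComul ω Δ)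
  (hU : ∀ h, Δ (𝒞.cev ω h) = GradedTensorProduct.of ℂ (𝒞.part ω) (𝒞.part ω)
      (TensorProduct.map (𝒞.cev ω).toLinearMap (𝒞.cev ω).toLinearMap (𝒞.comulU ω hω h)))
  {ε : 𝒞.Cartan ω →ₐ[ℂ] ℂ} (hε : 𝒞.IsCartanCounit ω ε) (hεev : ∀ h, ε (𝒞.cev ω h) = h.1 1)
  {φ : 𝒞.Cartan ω →ₗ[ℂ] Module.End ℂ 𝒞.Ext} (hφ : 𝒞.IsGradedAntiHom ω φ)
  (hev : ∀ h α, φ (𝒞.cev ω h) α = eact δL h.1 α)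
  (hxi : ∀ i α, φ (𝒞.cxi ω i) α = ∑ j, 𝒞.inner ω hω hS hδ j (eact δL (𝒞.fc ω j i) α))
  (hdelta : φ (𝒞.cdelta ω) = -D)

include hφ hev hxi hdelta hD

theorem extParity_action (x : 𝒞.Cartan ω) (α : 𝒞.Ext) :
    𝒞.extParity (φ x α) = φ (𝒞.parity ω x) (𝒞.extParity α) := by
  have hGxi : ∀ i α, 𝒞.extParity (φ (𝒞.cxi ω i) α) = -φ (𝒞.cxi ω i) (𝒞.extParity α) := by
    intro i α
    simp only [hxi, map_sum, extParity_inner, extParity_eact hδ, Finset.sum_neg_distrib]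
  have hGd : ∀ α, 𝒞.extParity (φ (𝒞.cdelta ω) α) = -φ (𝒞.cdelta ω) (𝒞.extParity α) := by
    intro α
    rw [hdelta, LinearMap.neg_apply, LinearMap.neg_apply, map_neg, extParity_differential hD]
  -- The claim is proved for `x` and for its parity image together, because splitting off an odd
  -- generator replaces the remaining factor by its parity image.
  suffices h : ∀ α, 𝒞.extParity (φ x α) = φ (𝒞.parity ω x) (𝒞.extParity α) ∧
      𝒞.extParity (φ (𝒞.parity ω x) α) = φ x (𝒞.extParity α) from (h α).1
  induction x using 𝒞.cartan_induction ω with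
  | h1 => intro α; simp [hφ.one]
  | hadd x y hx hy =>
    intro α
    simp only [map_add, LinearMap.add_apply, (hx α).1, (hx α).2, (hy α).1, (hy α).2, and_self]
  | hev h x hx =>
    intro α
    rw [map_mul (𝒞.parity ω), parity_cev, hφ.mul_even (𝒞.cev_mem_part ω h), hφ.mul_even (𝒞.cev_mem_part ω h)]
    simp only [Module.End.mul_apply, (hx _).1, (hx _).2, hev, extParity_eact hδ, and_self]
  | hxi i x hx =>
    intro α
    rw [map_mul (𝒞.parity ω), parity_cxi, neg_mul, map_neg φ, hφ.mul_odd (𝒞.cxi_mem_part ω i),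
      hφ.mul_odd (𝒞.cxi_mem_part ω i), parity_parity]
    simp only [LinearMap.neg_apply, Module.End.mul_apply, (hx _).1, (hx _).2, hGxi, map_neg, neg_neg,
      and_self]
  | hdelta x hx =>
    intro α
    rw [map_mul (𝒞.parity ω), parity_cdelta, neg_mul, map_neg φ, hφ.mul_odd (𝒞.cdelta_mem_part ω),
      hφ.mul_odd (𝒞.cdelta_mem_part ω), parity_parity]
    simp only [LinearMap.neg_apply, Module.End.mul_apply, (hx _).1, (hx _).2, hGd, map_neg, neg_neg,
      and_self]

include hΔ hU in
theorem action_mul (x : 𝒞.Cartan ω) (k : ℕ) (α β : 𝒞.Ext)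
    (hα : 𝒞.extParity α = (-1 : ℂ) ^ k • α) : φ x (α * β) = 𝒞.gprod φ k α β (Δ x) := by
  have hG := 𝒞.extParity_action hD hω hS hδ hφ hev hxi hdelta
  -- The law is again proved for `x` and its parity image at once; it is stated for all `α` of
  -- parity `k`, since the induction changes both `α` and `k`.
  suffices h : (∀ k α β, 𝒞.extParity α = (-1 : ℂ) ^ k • α →
      φ x (α * β) = 𝒞.gprod φ k α β (Δ x)) ∧ (∀ k α β, 𝒞.extParity α = (-1 : ℂ) ^ k • α →
      φ (𝒞.parity ω x) (α * β) = 𝒞.gprod φ k α β (Δ (𝒞.parity ω x))) from h.1 k α β hα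
  have hodd : ∀ {g : 𝒞.Cartan ω}, g ∈ 𝒞.part ω 1 → (∀ {x : 𝒞.Cartan ω},
      (∀ k α β, 𝒞.extParity α = (-1 : ℂ) ^ k • α →
        φ (𝒞.parity ω x) (α * β) = 𝒞.gprod φ k α β (Δ (𝒞.parity ω x))) →
      ∀ k α β, 𝒞.extParity α = (-1 : ℂ) ^ k • α →
        φ (g * x) (α * β) = 𝒞.gprod φ k α β (Δ (g * x))) → ∀ {x : 𝒞.Cartan ω},
      ((∀ k α β, 𝒞.extParity α = (-1 : ℂ) ^ k • α →
        φ x (α * β) = 𝒞.gprod φ k α β (Δ x)) ∧ (∀ k α β, 𝒞.extParity α = (-1 : ℂ) ^ k • α →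
        φ (𝒞.parity ω x) (α * β) = 𝒞.gprod φ k α β (Δ (𝒞.parity ω x)))) →
      (∀ k α β, 𝒞.extParity α = (-1 : ℂ) ^ k • α →
        φ (g * x) (α * β) = 𝒞.gprod φ k α β (Δ (g * x))) ∧
      (∀ k α β, 𝒞.extParity α = (-1 : ℂ) ^ k • α →
        φ (𝒞.parity ω (g * x)) (α * β) = 𝒞.gprod φ k α β (Δ (𝒞.parity ω (g * x)))) := by
    intro g hg step x hx
    refine ⟨step hx.2, fun k α β hα => ?_⟩
    have := step (x := 𝒞.parity ω x) (by simpa only [parity_parity] using hx.1) k α β hα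
    rw [map_mul (𝒞.parity ω), (𝒞.mem_part_one ω).1 hg, neg_mul, map_neg φ, map_neg Δ, map_neg, ← this,
      LinearMap.neg_apply]
  induction x using 𝒞.cartan_induction ω with
  | h1 =>
    have : ∀ k α β, φ 1 (α * β) = 𝒞.gprod φ k α β (1 ᵍ⊗ₜ[ℂ] 1) := fun k α β => by
      rw [gprod_tmul, map_one (𝒞.parity ω ^ k), hφ.one]
      rfl
    rw [map_one (𝒞.parity ω), map_one Δ]
    exact ⟨fun k α β _ => this k α β, fun k α β _ => this k α β⟩
  | hadd x y hx hy =>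
    constructor
    · intro k α β hα
      rw [map_add, LinearMap.add_apply, hx.1 k α β hα, hy.1 k α β hα, map_add, map_add]
    · intro k α β hα
      rw [map_add, map_add, LinearMap.add_apply, hx.2 k α β hα, hy.2 k α β hα, map_add, map_add]
  | hev h x hx =>
    have step : ∀ x, (∀ k α β, 𝒞.extParity α = (-1 : ℂ) ^ k • α →
        φ x (α * β) = 𝒞.gprod φ k α β (Δ x)) → ∀ k α β, 𝒞.extParity α = (-1 : ℂ) ^ k • α →
        φ (𝒞.cev ω h * x) (α * β) = 𝒞.gprod φ k α β (Δ (𝒞.cev ω h * x)) := by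
      intro x hx k α β hα
      rw [hφ.mul_even (𝒞.cev_mem_part ω h), Module.End.mul_apply, hev, 𝒞.eact_mul_comulU ω hω,
        map_mul Δ, hU]
      generalize 𝒞.comulU ω hω h = u
      induction u using TensorProduct.induction_on with
      | zero => simp only [map_zero, zero_mul]
      | add s t hs ht => simp only [map_add, add_mul, hs, ht]
      | tmul h l =>
        refine Eq.trans ?_ (𝒞.gprod_even_mul_even hφ (𝒞.cev_mem_part ω h) (𝒞.cev_mem_part ω l)
          k α β (Δ x)).symm
        rw [hev, hev, ← hx k _ _ (by rw [extParity_eact hδ, hα, map_smul])]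
        rfl
    refine ⟨step x hx.1, ?_⟩
    rw [map_mul (𝒞.parity ω), parity_cev]
    exact step _ hx.2
  | hxi i x hx =>
    refine hodd (𝒞.cxi_mem_part ω i) (fun hx => 𝒞.action_mul_of_odd hΔ hω hU hφ
      (𝒞.cxi_mem_part ω i) (fun j => 𝒞.cxi ω j) (fun j => 𝒞.cf ω j i)
      (fun j => 𝒞.cxi_mem_part ω j) (fun j => 𝒞.cf_mem_part j i) (hΔ.xi i) (fun α β => ?_)
      (fun j α => ?_) hx) hx
    · simp only [hxi, ← cev_evenF, hev]
      exact 𝒞.sum_inner_eact_fc_mul ω hω hS hδ i α β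
    · rw [hG, parity_cxi, map_neg, LinearMap.neg_apply]
  | hdelta x hx =>
    refine hodd (𝒞.cdelta_mem_part ω) (fun hx => 𝒞.action_mul_of_odd hΔ hω hU hφ (ι := Unit)
      (𝒞.cdelta_mem_part ω) (fun _ => 𝒞.cdelta ω) (fun _ => 1)
      (fun _ => 𝒞.cdelta_mem_part ω) (fun _ => by simp [mem_part_zero])
      (by rw [hΔ.delta, Fintype.sum_unique]) (fun α β => ?_)
      (fun j α => ?_) hx) hx
    · rw [hdelta, Fintype.sum_unique, hφ.one]
      change -D (α * β) = 𝒞.extParity α * -D β + -D α * β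
      rw [differential_mul hD, mul_neg, neg_mul, neg_add, add_comm]
    · rw [hG, parity_cdelta, map_neg, LinearMap.neg_apply]

include hε hεev in
theorem action_one (x : 𝒞.Cartan ω) : φ x 1 = ε x • (1 : 𝒞.Ext) := by
  have hp : ∀ x, ε (𝒞.parity ω x) = ε x := fun x => by
    have : ε.comp (𝒞.parity ω) = ε := 𝒞.cartan_hom_ext ω (fun h => by simp)
      (fun i => by simp [hε.xi]) (by simp [hε.delta])
    exact DFunLike.congr_fun this x
  have hG := 𝒞.extParity_action hD hω hS hδ hφ hev hxi hdelta
  induction x using 𝒞.cartan_induction ω with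
  | h1 => simp [hφ.one]
  | hadd x y hx hy => rw [map_add, LinearMap.add_apply, hx, hy, map_add, add_smul]
  | hev h x hx =>
    rw [hφ.mul_even (𝒞.cev_mem_part ω h), Module.End.mul_apply, hev, eact_one_form, map_smul, hx,
      map_mul, hεev, smul_smul]
  | hxi i x hx =>
    have h0 : φ (𝒞.cxi ω i) 1 = 0 := by
      simp only [hxi, eact_one_form, map_smul]
      refine Finset.sum_eq_zero fun j _ => ?_
      rw [← ofA_one, inner_ofA, smul_zero]
    rw [hφ.mul_odd (𝒞.cxi_mem_part ω i), Module.End.mul_apply, h0, map_zero, map_mul, hε.xi,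
      zero_mul, zero_smul]
  | hdelta x hx =>
    have h0 : φ (𝒞.cdelta ω) 1 = 0 := by
      rw [hdelta, LinearMap.neg_apply, ← ofA_one, hD.ofA, d_one, map_zero, neg_zero]
    rw [hφ.mul_odd (𝒞.cdelta_mem_part ω), Module.End.mul_apply, h0, map_zero, map_mul, hε.delta,
      zero_mul, zero_smul]

include hΔ hU hε hεev in
theorem isRightModuleAlgebra_action : 𝒞.IsRightModuleAlgebra ω Δ ε φ where
  antiHom := hφ
  parity p q x hx α hα := by
    rw [mem_formParity_iff] at hα ⊢
    rw [𝒞.extParity_action hD hω hS hδ hφ hev hxi hdelta, hα, (𝒞.mem_part ω).1 hx, map_smul,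
      map_smul, LinearMap.smul_apply, smul_smul]
    congr 1
    rcases zmod_two_cases p with rfl | rfl <;> rcases zmod_two_cases q with rfl | rfl <;>
      simp [ZMod.val_one, CharTwo.add_self_eq_zero]
  mul x k α hα β := 𝒞.action_mul hD hω hS hδ hΔ hU hφ hev hxi hdelta x k α β
    (𝒞.extParity_of_mem hα)
  one x := 𝒞.action_one hD hω hS hδ hε hεev hφ hev hxi hdelta x

end RightModuleAlgebra

end BicovariantCalculus

end QuantumCartan
end

theorem theorem3p4
    {A : Type*} [Ring A] [HopfAlgebra ℂ A]
    (hS : Function.Bijective (HopfAlgebra.antipode ℂ : A →ₗ[ℂ] A))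
    {Γ : Type*} [AddCommGroup Γ] [Module ℂ Γ] [Module A Γ] [Module Aᵐᵒᵖ Γ]
    [SMulCommClass A Aᵐᵒᵖ Γ] [IsScalarTower ℂ A Γ] [IsScalarTower ℂ Aᵐᵒᵖ Γ]
    (𝒞 : QuantumCartan.BicovariantCalculus A Γ)
    {N : ℕ} (ω : Module.Basis (Fin N) A Γ) (hω : ∀ i, 𝒞.IsLeftInvariant (ω i))
    (D : 𝒞.Ext →ₗ[ℂ] 𝒞.Ext) (hD : 𝒞.IsExteriorDifferential D)
    (hc : 𝒞.IsSCompatible ω) :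
    ∃ (δL : 𝒞.Ext →ₐ[ℂ] A ⊗[ℂ] 𝒞.Ext) (I : Fin N → 𝒞.Ext →ₗ[ℂ] 𝒞.Ext)
      (Δ : 𝒞.Cartan ω →ₐ[ℂ] 𝒞.part ω ᵍ⊗[ℂ] 𝒞.part ω) (ε : 𝒞.Cartan ω →ₐ[ℂ] ℂ)
      (T : 𝒞.Cartan ω ≃ₗ[ℂ] 𝒞.Cartan ω),
      𝒞.IsExteriorCoaction δL ∧ 𝒞.IsRightInner ω hS δL I ∧
      𝒞.IsCartanComul ω Δ ∧ 𝒞.IsCartanCounit ω ε ∧ 𝒞.IsCartanAntipode ω hc T ∧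
      (∃! φ : 𝒞.Cartan ω →ₗ[ℂ] Module.End ℂ 𝒞.Ext, 𝒞.IsRightCartanRep ω hS δL I D T φ) ∧
      ∀ φ : 𝒞.Cartan ω →ₗ[ℂ] Module.End ℂ 𝒞.Ext,
        𝒞.IsRightCartanRep ω hS δL I D T φ → 𝒞.IsRightModuleAlgebra ω Δ ε φ := by
  have hδ := 𝒞.isExteriorCoaction_extCoact ω hω hS
  obtain ⟨Δ, hΔ, hU⟩ := 𝒞.exists_cartanComul ω hω
  obtain ⟨ε, hε, hεev⟩ := 𝒞.exists_cartanCounit ω hω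
  obtain ⟨T, hT, hT', hTev, hTp⟩ := 𝒞.exists_isCartanAntipode ω hω hS hc
  obtain ⟨φ, hφ, hev, hxi, hdelta⟩ := 𝒞.exists_rightRep ω hD hω hS hδ hc hT hTev
  -- By uniqueness the module algebra law need only be verified for the constructed `φ`, whose
  -- values on generators are known.
  have huniq : ∀ ψ : 𝒞.Cartan ω →ₗ[ℂ] Module.End ℂ 𝒞.Ext,
      𝒞.IsRightCartanRep ω hS _ (𝒞.inner ω hω hS hδ) D T ψ → ψ = φ := fun ψ hψ =>
    𝒞.isRightCartanRep_unique ω hS hT' hTp hψ hφ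
  refine ⟨_, _, Δ, ε, T, hδ, 𝒞.isRightInner_inner ω hω hS hδ, hΔ, hε, hT, ⟨φ, hφ, huniq⟩,
    fun ψ hψ => ?_⟩
  rw [huniq ψ hψ]
  exact 𝒞.isRightModuleAlgebra_action hD hω hS hδ hΔ hU hε hεev hφ.antiHom hev hxi hdelta
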